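/- **Setting.** Let $d\ge1$, let $\xi$ be a random element with law $\Pi$, let $g(\beta,\xi)$ be a real-valued noisy loss on $\beta\in\mathbb R^d$, measurable in $\xi$ and with $\mathbb E|g(\beta,\xi)|<\infty$ for all $\beta$, and put $G(\beta)=\mathbb E\,g(\beta,\xi)$. Let $|v|_s=(\sum_i|v_i|^s)^{1/s}$, $|v|_\infty=\max_i|v_i|$, $\|X\|_q=(\mathbb E|X|^q)^{1/q}$, and $$s=s_d:=2\min\{\ell\in\mathbb N:\ 2\ell>\log d\}.$$ Let $q\ge2$, $\mu,L>0$, $K\ge0$, and let $\beta^*$ be a global minimizer of $G$. Assume: 1. (Coercivity) $G(\beta_n)\to\infty$ whenever $|\beta_n|_s\to\infty$. 2. ($\ell^s$-strong convexity) $\sum_{i}(\beta_i-\beta_i')^{s-1}\big(\partial_iG(\beta)-\partial_iG(\beta')\big)\ge\mu|\beta-\beta'|_s^s$ for all $\beta,\beta'\in\mathbb R^d$. 3. (Stochastic Lipschitz continuity) $M:=\big\||\nabla g(\beta^*,\xi)|_s\big\|_q<\infty$ and $\big\||\nabla g(\beta,\xi)-\nabla g(\beta',\xi)|_s\big\|_q\le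 L|\beta-\beta'|_s$ for all $\beta,\beta'\in\mathbb R^d$. 4. (Smoothness) $\beta\mapsto g(\beta,\xi)$ is twice differentiable, $G$ is three times differentiable, the Hessian $\nabla^2G(\beta^*)$ is positive definite, and $\max_{i}\max_{l}\sum_{r}|\partial_i\partial_l\partial_rG(\beta)|\le K$ for all $\beta\in\mathbb R^d$. Put $$\alpha_{s,q}=\frac{2\mu}{\max\{q,s\}L^2},\qquad r_{\alpha}=1-2\mu\alpha+\max\{q,s\}L^2\alpha^2 .$$ For i.i.d. $\xi_1,\xi_2,\ldots\sim\Pi$ and a learning rate $\alpha>0$, let $\beta_k=\beta_{k-1}-\alpha\nabla g(\beta_{k-1},\xi_k)$ and $\bar\beta_k=\frac1k\sum_{i=1}^k\beta_i$ for $k\ge1$. **Theorem.** There are an absolute constant $C_2>0$ and, for each $q\ge 2$, a constant $c_q>0$ depending only on $q$, such that for all $\mu>0$ and $\rho\in(0,1)$ there is a constant $C_1>0$ depending only on $(\mu,\rho)$, and for each $K\ge0$ a constant $C_3>0$ depending only on $(\mu,\rho,K)$, for which the following holds for all $d$, $q$, $L$, $\Pi$, $g$ as above and all learning rates $0<\alpha\le\rho\,\alpha_{s,q}$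 (so every $\alpha\in(0,\alpha_{s,q})$ is covered by some $\rho<1$). The recursion has a unique stationary distribution $\pi_\alpha$ with finite $q$-th moment, and, for every initialization $\beta_0$ (deterministic, or random) and every $\beta_0^\circ\sim\pi_\alpha$ such that $(\beta_0,\beta_0^\circ)$ is independent of $(\xi_k)_{k\ge1}$, and every $k\ge1$, $$\big\||\bar\beta_k-\beta^*|_\infty\big\|_q\le C_1\sqrt{\frac{c_q s}{k}}\,M\Big(L\sqrt{\alpha\max\{q,s\}}+1\Big)+\frac{C_2}{k(1-r_{\alpha})}\big\||\beta_0-\beta_0^\circ|_\infty\big\|_q+C_3\,M^2\max\{q,s\}\,\alpha\, d^{\frac{q}{q-1}\left(1-\frac2{s}\right)} .$$ -/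

import Mathlib

open MeasureTheory ProbabilityTheory Filter

namespace ASGD

noncomputable section

/-- The `ℓ^s`-norm `(∑ |v_i|^s)^(1/s)` on `ℝ^d`. The max-norm is Mathlib's norm on `Fin d → ℝ`. -/
def lsNorm {d : ℕ} (s : ℕ) (v : Fin d → ℝ) : ℝ :=
  (∑ i, |v i| ^ s) ^ ((1 : ℝ) / (s : ℝ))

/-- The partial derivative `∂_i f`. -/
def pderiv {d : ℕ} (i : Fin d) (f : (Fin d → ℝ) → ℝ) (x : Fin d → ℝ) : ℝ :=
  fderiv ℝ f x (Pi.single i 1)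

/-- The gradient `(∂_1 f, …, ∂_d f)`. -/
def grad {d : ℕ} (f : (Fin d → ℝ) → ℝ) (x : Fin d → ℝ) : Fin d → ℝ :=
  fun i => pderiv i f x

/-- The Hessian matrix `[∂_i ∂_j f]`. -/
def hessian {d : ℕ} (f : (Fin d → ℝ) → ℝ) (x : Fin d → ℝ) : Matrix (Fin d) (Fin d) ℝ :=
  Matrix.of fun i j => pderiv i (pderiv j f) x

/-- `s_d = 2 min {ℓ : 2ℓ > log d}`. -/
def sDim (d : ℕ) : ℕ := 2 * sInf {l : ℕ | Real.log (d : ℝ) < 2 * (l : ℝ)}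

variable {d : ℕ} {Ξ : Type*} [MeasurableSpace Ξ]

/-- The population loss `G(β) = E g(β, ξ)`, where `ξ` has law `Q`. -/
def loss (g : (Fin d → ℝ) → Ξ → ℝ) (Q : Measure Ξ) (β : Fin d → ℝ) : ℝ :=
  ∫ x, g β x ∂Q

/-- The stochastic gradient `∇_β g(β, x)`. -/
def stochGrad (g : (Fin d → ℝ) → Ξ → ℝ) (β : Fin d → ℝ) (x : Ξ) : Fin d → ℝ :=
  grad (fun b => g b x) β

/-- Coercivity of `G`. -/
def Coercive (s : ℕ) (G : (Fin d → ℝ) → ℝ) : Prop :=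
  ∀ b : ℕ → (Fin d → ℝ),
    Tendsto (fun n => lsNorm s (b n)) atTop atTop → Tendsto (fun n => G (b n)) atTop atTop

/-- Strong convexity of `G` in the `ℓ^s`-sense with constant `μ`. -/
def LsStrongConvex (s : ℕ) (μ : ℝ) (G : (Fin d → ℝ) → ℝ) : Prop :=
  ∀ β β' : Fin d → ℝ,
    μ * lsNorm s (β - β') ^ s ≤ ∑ i, (β i - β' i) ^ (s - 1) * (grad G β i - grad G β' i)

/-- The (extended) moment `(E |∇g(β, ξ)|_s^q)^(1/q)`. -/
def gradMoment (s : ℕ) (q : ℝ) (g : (Fin d → ℝ) → Ξ → ℝ) (Q : Measure Ξ)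
    (β : Fin d → ℝ) : ENNReal :=
  eLpNorm (fun x => lsNorm s (stochGrad g β x)) (ENNReal.ofReal q) Q

/-- Stochastic Lipschitz continuity of `∇g` in the `ℓ^s`-norm with constant `L`. -/
def StochLipschitz (s : ℕ) (q L : ℝ) (g : (Fin d → ℝ) → Ξ → ℝ) (Q : Measure Ξ) : Prop :=
  ∀ β β' : Fin d → ℝ,
    eLpNorm (fun x => lsNorm s (stochGrad g β x - stochGrad g β' x)) (ENNReal.ofReal q) Q
      ≤ ENNReal.ofReal (L * lsNorm s (β - β'))

/-- `f` is twice differentiable. -/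
def TwiceDifferentiable (f : (Fin d → ℝ) → ℝ) : Prop :=
  Differentiable ℝ f ∧ ∀ i, Differentiable ℝ (pderiv i f)

/-- `f` is three times differentiable. -/
def ThriceDifferentiable (f : (Fin d → ℝ) → ℝ) : Prop :=
  TwiceDifferentiable f ∧ ∀ i j, Differentiable ℝ (pderiv i (pderiv j f))

/-- All matrices `∇³G_i(β) = [∂_i ∂_l ∂_r G(β)]_{l,r}` have maximal absolute row sum at most `K`,
uniformly in `β` and `i`. -/
def ThirdDerivBound (K : ℝ) (G : (Fin d → ℝ) → ℝ) : Prop :=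
  ∀ (β : Fin d → ℝ) (i l : Fin d), ∑ r, |pderiv i (pderiv l (pderiv r G)) β| ≤ K

/-- The critical learning rate `α_{s,q} = 2μ / (max{q,s} L²)`. -/
def alphaMax (s : ℕ) (q μ L : ℝ) : ℝ := 2 * μ / (max q (s : ℝ) * L ^ 2)

/-- The contraction constant `r_{α,s,q} = 1 - 2μα + max{q,s} L² α²`. -/
def contr (s : ℕ) (q μ L α : ℝ) : ℝ := 1 - 2 * μ * α + max q (s : ℝ) * L ^ 2 * α ^ 2

/-- The SGD iterates with learning rate `α` and initial value `b₀`;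
the sample `x k` is the one used in iteration `k + 1`. -/
def sgd (g : (Fin d → ℝ) → Ξ → ℝ) (α : ℝ) (x : ℕ → Ξ) (b₀ : Fin d → ℝ) : ℕ → (Fin d → ℝ)
  | 0 => b₀
  | k + 1 => sgd g α x b₀ k - α • stochGrad g (sgd g α x b₀ k) (x k)

/-- The averaged iterates `k⁻¹ ∑_{i=1}^k β_i`. -/
def asgd (g : (Fin d → ℝ) → Ξ → ℝ) (α : ℝ) (x : ℕ → Ξ) (b₀ : Fin d → ℝ) (k : ℕ) : Fin d → ℝ :=
  ((k : ℝ)⁻¹) • ∑ i ∈ Finset.Icc 1 k, sgd g α x b₀ i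

/-- `π` is a stationary distribution of the SGD recursion with finite `q`-th moment: a probability
measure such that `β - α ∇g(β, ξ)` has law `π` if `β ∼ π` and `ξ ∼ Q` are independent. -/
def IsStationaryLaw (s : ℕ) (q α : ℝ) (g : (Fin d → ℝ) → Ξ → ℝ) (Q : Measure Ξ)
    (π : Measure (Fin d → ℝ)) : Prop :=
  IsProbabilityMeasure π ∧
    (π.prod Q).map (fun p => p.1 - α • stochGrad g p.1 p.2) = π ∧
    eLpNorm (fun u => lsNorm s u) (ENNReal.ofReal q) π < ⊤

end

end ASGD

/-!
The proof treats the recursion `β ↦ β - α ∇g(β, ξ)` as a random map on `ℝ^d` with the norm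
`|·|_s`. Since `s > log d`, `|·|_s` and the maximum norm differ by a factor of at most `e`
(`rpow_inv_sDim_le`), so all estimates can be made in `lsMoment`, the norm `‖|·|_s‖_q`.

*Smoothness of the norm.* For even `s`, the norm `‖|·|_s‖_q` is 2-uniformly smooth with constant
`max{q,s} - 1` (`lsMoment_smooth`). This follows from the two-point inequality on the line
(`two_point_real`), which Minkowski's inequality transfers to sums and integrals
(`two_point_transfer`). Dyadic subdivision of a segment turns it into a sharp second-order
inequality for `‖|x + Y|_s‖_q²` (`lsMoment_add_sq_le`), a form of Rio's inequality in which only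
the mean of `Y` enters to first order.

*Contraction.* With `Y = -α(∇g(β,ξ) - ∇g(β',ξ))`, strong convexity bounds the first-order term and
stochastic Lipschitz continuity the second-order term. One step therefore contracts
`‖|β - β'|_s‖_q²` by the factor `r_α` (`ConvexNoisyLoss.sq_toReal_lsMoment_sgdMap_sub_le`).
The backward iterates then converge to the stationary law, and a coupling shows that it is unique
(`exists_stationary`, `stationary_unique`). Applied with `x = β - β*` and
`Y = -α ∇g(β,ξ)`, the moment inequality shows that the stationary law has distance
`O(M √(max{q,s} α))` from `β*`
(`ConvexNoisyLoss.lsMoment_stationary_le`).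

*Three error terms.* The error of the averaged iterates is split by comparison with the stationary
iterates driven by the same samples, and with the mean `β̄` of the stationary law.
The influence of the initial value decays like `r_α^{n/2}`, and summation of the geometric series
gives the second term of the bound (`ConvexNoisyLoss.lsMoment_asgd_sub_le`).
The sum of `k` stationary iterates is the end point of the martingale of its conditional
expectations. The conditional expectation of the remaining sum is Lipschitz in the current iterate
with constant `O(1/(μα))`, and a step moves the iterate by `O(α)`, so that the
martingale increments do not depend on `α` to leading order; applying `lsMoment_add_sq_le` to each of
them gives the rate `√(max{q,s}/k)` (`ContractingMap.lsMoment_sum_sub_le`,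
`ConvexNoisyLoss.lsMoment_asgd_stationary_sub_le`), and `max{q,s} ≤ q s` allows `c_q = q`.
Finally, stationarity forces the gradient of `G` to vanish on average. Expanded at `β̄`, its linear
part has mean zero, so `∇G(β̄)` is of the order of the variance of the stationary law, and strong
convexity bounds `|β̄ - β*|_s` by it (`ConvexNoisyLoss.lsNorm_mean_sub_le`).
-/

namespace ASGD

open scoped Topology ENNReal

/-! ### The `ℓ^s` norm on `ℝ^d` -/

section LsNorm

variable {d : ℕ} {s : ℕ}

lemma lsNorm_nonneg (s : ℕ) (v : Fin d → ℝ) : 0 ≤ lsNorm s v := by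
  unfold lsNorm; positivity

lemma lsNorm_pow (hs : s ≠ 0) (v : Fin d → ℝ) : lsNorm s v ^ s = ∑ i, |v i| ^ s := by
  unfold lsNorm
  rw [one_div, Real.rpow_inv_natCast_pow (by positivity) hs]

lemma lsNorm_eq_norm (hs : s ≠ 0) (v : Fin d → ℝ) :
    lsNorm s v = ‖WithLp.toLp (s : ℝ≥0∞) v‖ := by
  rw [PiLp.norm_eq_sum (by simpa using Nat.pos_of_ne_zero hs)]
  simp [lsNorm]

lemma lsNorm_add_le (hs : 1 ≤ s) (v w : Fin d → ℝ) :
    lsNorm s (v + w) ≤ lsNorm s v + lsNorm s w := by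
  have : Fact (1 ≤ (s : ℝ≥0∞)) := ⟨by exact_mod_cast hs⟩
  simp only [lsNorm_eq_norm (by omega : s ≠ 0), WithLp.toLp_add]
  exact norm_add_le _ _

lemma lsNorm_smul (hs : 1 ≤ s) (c : ℝ) (v : Fin d → ℝ) :
    lsNorm s (c • v) = |c| * lsNorm s v := by
  have : Fact (1 ≤ (s : ℝ≥0∞)) := ⟨by exact_mod_cast hs⟩
  simp only [lsNorm_eq_norm (by omega : s ≠ 0), WithLp.toLp_smul, norm_smul, Real.norm_eq_abs]

lemma lsNorm_neg (s : ℕ) (v : Fin d → ℝ) : lsNorm s (-v) = lsNorm s v := by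
  simp [lsNorm]

lemma lsNorm_sub_comm (s : ℕ) (v w : Fin d → ℝ) : lsNorm s (v - w) = lsNorm s (w - v) := by
  rw [← lsNorm_neg, neg_sub]

lemma lsNorm_zero (hs : 1 ≤ s) : lsNorm s (0 : Fin d → ℝ) = 0 := by
  simpa using lsNorm_smul hs 0 (0 : Fin d → ℝ)

lemma lsNorm_le_add_sub (hs : 1 ≤ s) (v w : Fin d → ℝ) :
    lsNorm s v ≤ lsNorm s w + lsNorm s (v - w) := by
  have := lsNorm_add_le hs w (v - w)
  rwa [add_sub_cancel] at this

lemma abs_apply_le_lsNorm (hs : s ≠ 0) (v : Fin d → ℝ) (i : Fin d) : |v i| ≤ lsNorm s v := by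
  refine (pow_le_pow_iff_left₀ (abs_nonneg _) (lsNorm_nonneg _ _) hs).1 ?_
  rw [lsNorm_pow hs]
  exact Finset.single_le_sum (f := fun i => |v i| ^ s) (fun _ _ => by positivity)
    (Finset.mem_univ i)

lemma norm_le_lsNorm (hs : s ≠ 0) (v : Fin d → ℝ) : ‖v‖ ≤ lsNorm s v :=
  (pi_norm_le_iff_of_nonneg (lsNorm_nonneg _ _)).2 fun i => abs_apply_le_lsNorm hs v i

lemma eq_zero_of_lsNorm_eq_zero (hs : s ≠ 0) {v : Fin d → ℝ} (h : lsNorm s v = 0) : v = 0 :=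
  norm_le_zero_iff.1 (h ▸ norm_le_lsNorm hs v)

lemma lsNorm_le_mul_of_abs_le (hs : s ≠ 0) {v : Fin d → ℝ} {c : ℝ} (hc : 0 ≤ c)
    (h : ∀ i, |v i| ≤ c) : lsNorm s v ≤ (d : ℝ) ^ ((1 : ℝ) / s) * c := by
  refine (pow_le_pow_iff_left₀ (lsNorm_nonneg _ _) (by positivity) hs).1 ?_
  rw [lsNorm_pow hs, mul_pow, one_div, Real.rpow_inv_natCast_pow (by positivity) hs]
  calc ∑ i, |v i| ^ s ≤ ∑ _i : Fin d, c ^ s :=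
        Finset.sum_le_sum fun i _ => pow_le_pow_left₀ (abs_nonneg _) (h i) _
    _ = d * c ^ s := by simp

lemma lsNorm_le_mul_norm (hs : s ≠ 0) (v : Fin d → ℝ) :
    lsNorm s v ≤ (d : ℝ) ^ ((1 : ℝ) / s) * ‖v‖ :=
  lsNorm_le_mul_of_abs_le hs (norm_nonneg v) fun i => norm_le_pi_norm v i

lemma continuous_lsNorm (hs : s ≠ 0) : Continuous (lsNorm (d := d) s) := by
  unfold lsNorm
  refine Continuous.rpow_const (by fun_prop) fun x => Or.inr (by positivity)

/-- The duality bound `⟨x^{s-1}, y⟩ ≤ |x|_s^{s-1} |y|_s`, an instance of Hölder's inequality. -/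
lemma sum_pow_mul_le (hs : 2 ≤ s) (x y : Fin d → ℝ) :
    ∑ i, x i ^ (s - 1) * y i ≤ lsNorm s x ^ (s - 1) * lsNorm s y := by
  have hs1 : (1 : ℝ) < s := by exact_mod_cast hs
  have hs0 : s ≠ 0 := by omega
  have hc : ((s - 1 : ℕ) : ℝ) = s - 1 := by
    rw [Nat.cast_sub (by omega)]; simp
  have hq : (Real.conjExponent s).HolderConjugate (s : ℝ) :=
    (Real.HolderConjugate.conjExponent hs1).symm
  have H := Real.inner_le_Lp_mul_Lq Finset.univ (fun i => x i ^ (s - 1)) y hq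
  refine H.trans (le_of_eq ?_)
  have e1 : ∀ i, |x i ^ (s - 1)| ^ (Real.conjExponent (s : ℝ)) = |x i| ^ s := by
    intro i
    rw [abs_pow, ← Real.rpow_natCast, ← Real.rpow_mul (abs_nonneg _), ← Real.rpow_natCast,
      Real.conjExponent, hc, mul_div_cancel₀ _ (by linarith)]
  congr 1
  · simp_rw [e1]
    rw [← lsNorm_pow hs0, ← Real.rpow_natCast, ← Real.rpow_natCast,
      ← Real.rpow_mul (lsNorm_nonneg _ _), hc, Real.conjExponent]
    congr 1
    field_simp
  · simp [lsNorm]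

/-- Comparison of the Euclidean and the `ℓ^s` norm. -/
lemma sum_sq_le (hs : 2 ≤ s) (v : Fin d → ℝ) :
    ∑ i, v i ^ 2 ≤ (d : ℝ) ^ (1 - 2 / (s : ℝ)) * lsNorm s v ^ 2 := by
  have hs0 : s ≠ 0 := by omega
  have hs' : (0 : ℝ) < s := by exact_mod_cast (by omega : 0 < s)
  have hp : (1 : ℝ) ≤ s / 2 := by
    rw [le_div_iff₀ (by norm_num)]; simpa using (by exact_mod_cast hs : (2 : ℝ) ≤ s)
  have H := Real.rpow_sum_le_const_mul_sum_rpow Finset.univ (fun i => v i ^ 2) hp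
  have e1 : ∀ i, |v i ^ 2| ^ ((s : ℝ) / 2) = |v i| ^ s := by
    intro i
    rw [abs_pow, ← Real.rpow_natCast, ← Real.rpow_mul (abs_nonneg _)]
    simp [mul_div_cancel₀]
  have e2 : ∀ i, |v i ^ 2| = v i ^ 2 := fun i => abs_of_nonneg (sq_nonneg _)
  simp_rw [e1] at H
  simp_rw [e2] at H
  rw [← lsNorm_pow hs0, Finset.card_univ, Fintype.card_fin] at H
  have hS : 0 ≤ ∑ i, v i ^ 2 := Finset.sum_nonneg fun i _ => sq_nonneg _
  have H2 := Real.rpow_le_rpow (by positivity) H (by positivity : (0 : ℝ) ≤ 2 / s)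
  rw [← Real.rpow_mul hS, Real.mul_rpow (by positivity) (by have := lsNorm_nonneg s v; positivity),
    ← Real.rpow_mul (by positivity), ← Real.rpow_natCast (lsNorm s v), ← Real.rpow_mul
    (lsNorm_nonneg _ _)] at H2
  have f1 : (s : ℝ) / 2 * (2 / s) = 1 := by field_simp
  have f2 : ((s : ℝ) / 2 - 1) * (2 / s) = 1 - 2 / s := by field_simp
  have f3 : (s : ℝ) * (2 / s) = (2 : ℕ) := by field_simp; simp
  rwa [f1, f2, f3, Real.rpow_one, Real.rpow_natCast] at H2

lemma lsNorm_integral_le {Ω : Type*} [MeasurableSpace Ω] {P : Measure Ω} (hs : 1 ≤ s)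
    {f : Ω → Fin d → ℝ} (hf : Integrable f P) :
    lsNorm s (∫ ω, f ω ∂P) ≤ ∫ ω, lsNorm s (f ω) ∂P := by
  have : Fact (1 ≤ (s : ℝ≥0∞)) := ⟨by exact_mod_cast hs⟩
  simp only [lsNorm_eq_norm (by omega : s ≠ 0)]
  have h := ((PiLp.continuousLinearEquiv (s : ℝ≥0∞) ℝ (fun _ : Fin d => ℝ)).symm :
    (Fin d → ℝ) →L[ℝ] PiLp (s : ℝ≥0∞) (fun _ : Fin d => ℝ)).integral_comp_comm hf
  have h' : WithLp.toLp (s : ℝ≥0∞) (∫ ω, f ω ∂P) = ∫ ω, WithLp.toLp (s : ℝ≥0∞) (f ω) ∂P :=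
    h.symm
  rw [h']
  exact norm_integral_le_integral_norm _

end LsNorm

section SDim

lemma sDim_spec (d : ℕ) : Real.log d < sDim d := by
  have hne : {l : ℕ | Real.log (d : ℝ) < 2 * (l : ℝ)}.Nonempty := by
    obtain ⟨n, hn⟩ := exists_nat_gt (Real.log d)
    refine ⟨n, ?_⟩
    have : (0 : ℝ) ≤ n := by positivity
    simp only [Set.mem_ofPred_eq]; linarith
  have := Nat.sInf_mem hne
  simpa [sDim] using this

lemma even_sDim (d : ℕ) : Even (sDim d) := even_two_mul _

lemma two_le_sDim {d : ℕ} (hd : 1 ≤ d) : 2 ≤ sDim d := by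
  have h0 : 0 ≤ Real.log d := Real.log_nonneg (by exact_mod_cast hd)
  have h1 : (0 : ℝ) < sDim d := h0.trans_lt (sDim_spec d)
  have h2 : 0 < sDim d := by exact_mod_cast h1
  obtain ⟨k, hk⟩ := even_sDim d
  omega

/-- The choice of `s` makes the `ℓ^s` and the maximum norm equivalent up to an absolute factor. -/
lemma rpow_inv_sDim_le {d : ℕ} (hd : 1 ≤ d) :
    (d : ℝ) ^ ((1 : ℝ) / (sDim d : ℕ)) ≤ Real.exp 1 := by
  have hs : (0 : ℝ) < sDim d := by exact_mod_cast (by have := two_le_sDim hd; omega : 0 < sDim d)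
  rw [Real.rpow_def_of_pos (by exact_mod_cast hd)]
  refine Real.exp_le_exp.2 ?_
  rw [mul_one_div, div_le_one hs]
  exact (sDim_spec d).le

end SDim

/-! ### Two-point uniform smoothness -/

section TwoPoint

/-- The normalised scalar two-point inequality. With `f t = ((1+t)^p + (1-t)^p)/2`, the function
`1 + (p-1) t² - f t ^ (2/p)` vanishes to second order at `0`, and its second derivative is
nonnegative because `((1+t)^(p-2) + (1-t)^(p-2))/2 ≤ f t ^ ((p-2)/p)` by Jensen. -/
lemma two_point_unit {p t : ℝ} (hp : 2 ≤ p) (ht0 : 0 ≤ t) (ht1 : t ≤ 1) :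
    (((1 + t) ^ p + (1 - t) ^ p) / 2) ^ (2 / p) ≤ 1 + (p - 1) * t ^ 2 := by
  have hp0 : 0 < p := by linarith
  set f : ℝ → ℝ := fun t => ((1 + t) ^ p + (1 - t) ^ p) / 2 with hf
  set g : ℝ → ℝ := fun t => (1 + t) ^ (p - 1) - (1 - t) ^ (p - 1) with hg
  have fpos : ∀ t ∈ Set.Icc (0 : ℝ) 1, 0 < f t := by
    intro t ht
    have h1 : 0 < (1 + t) ^ p := Real.rpow_pos_of_pos (by linarith [ht.1]) _
    have h2 : 0 ≤ (1 - t) ^ p := Real.rpow_nonneg (by linarith [ht.2]) _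
    simp only [hf]; linarith
  have hfd : ∀ t : ℝ, HasDerivAt f (p / 2 * g t) t := by
    intro t
    have h1 : HasDerivAt (fun t : ℝ => (1 + t) ^ p) (1 * p * (1 + t) ^ (p - 1)) t :=
      ((hasDerivAt_id t).const_add 1).rpow_const (Or.inr (by linarith))
    have h2 : HasDerivAt (fun t : ℝ => (1 - t) ^ p) (-1 * p * (1 - t) ^ (p - 1)) t :=
      ((hasDerivAt_id t).const_sub 1).rpow_const (Or.inr (by linarith))
    convert! (h1.add h2).div_const 2 using 1
    simp only [hg]; ring
  have hgd : ∀ t ∈ Set.Ioo (0 : ℝ) 1,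
      HasDerivAt g ((p - 1) * ((1 + t) ^ (p - 2) + (1 - t) ^ (p - 2))) t := by
    intro t ht
    have h1 : HasDerivAt (fun t : ℝ => (1 + t) ^ (p - 1)) (1 * (p - 1) * (1 + t) ^ (p - 1 - 1)) t :=
      ((hasDerivAt_id t).const_add 1).rpow_const (Or.inl (by simp; linarith [ht.1]))
    have h2 : HasDerivAt (fun t : ℝ => (1 - t) ^ (p - 1))
        (-1 * (p - 1) * (1 - t) ^ (p - 1 - 1)) t :=
      ((hasDerivAt_id t).const_sub 1).rpow_const (Or.inl (by simp; linarith [ht.2]))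
    convert! h1.sub h2 using 1
    rw [show p - 1 - 1 = p - 2 by ring]; ring
  have hfc : Continuous f := continuous_iff_continuousAt.2 fun t => (hfd t).continuousAt
  have hgc : Continuous g := by
    simp only [hg]
    exact (Continuous.rpow_const (by fun_prop) fun _ => Or.inr (by linarith)).sub
      (Continuous.rpow_const (by fun_prop) fun _ => Or.inr (by linarith))
  have gnn : ∀ t ∈ Set.Icc (0 : ℝ) 1, 0 ≤ g t := by
    intro t ht
    simp only [hg, sub_nonneg]
    exact Real.rpow_le_rpow (by linarith [ht.2]) (by linarith [ht.1]) (by linarith)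
  have jensen : ∀ t ∈ Set.Icc (0 : ℝ) 1,
      ((1 + t) ^ (p - 2) + (1 - t) ^ (p - 2)) ≤ 2 * f t ^ ((p - 2) / p) := by
    intro t ht
    have a1 : 0 ≤ 1 + t := by linarith [ht.1]
    have a2 : 0 ≤ 1 - t := by linarith [ht.2]
    rcases hp.eq_or_lt with rfl | hp2
    · norm_num
    have hp2' : 0 < p - 2 := by linarith
    have hr : 1 ≤ p / (p - 2) := by rw [le_div_iff₀ hp2']; linarith
    have J := (convexOn_rpow hr).2 (Set.mem_Ici.2 (by positivity : 0 ≤ (1 + t) ^ (p - 2)))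
      (Set.mem_Ici.2 (by positivity : 0 ≤ (1 - t) ^ (p - 2)))
      (by norm_num : (0 : ℝ) ≤ 1 / 2) (by norm_num : (0 : ℝ) ≤ 1 / 2) (by norm_num)
    simp only [smul_eq_mul] at J
    rw [← Real.rpow_mul a1, ← Real.rpow_mul a2, mul_div_cancel₀ _ hp2'.ne'] at J
    have J2 := Real.rpow_le_rpow (by positivity) J (by positivity : 0 ≤ (p - 2) / p)
    rw [← Real.rpow_mul (by positivity), show p / (p - 2) * ((p - 2) / p) = 1 by field_simp,
      Real.rpow_one] at J2
    have e : (1 / 2 * (1 + t) ^ p + 1 / 2 * (1 - t) ^ p) = f t := by simp only [hf]; ring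
    rw [e] at J2
    linarith
  set E : ℝ → ℝ := fun t => 2 * (p - 1) * t - f t ^ (2 / p - 1) * g t with hE
  have hEd : ∀ t ∈ Set.Ioo (0 : ℝ) 1, HasDerivAt E
      (2 * (p - 1) - ((p / 2 * g t) * (2 / p - 1) * f t ^ (2 / p - 1 - 1) * g t
        + f t ^ (2 / p - 1) * ((p - 1) * ((1 + t) ^ (p - 2) + (1 - t) ^ (p - 2))))) t := by
    intro t ht
    have h1 := (hfd t).rpow_const (p := 2 / p - 1) (Or.inl (fpos t ⟨ht.1.le, ht.2.le⟩).ne')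
    have h2 : HasDerivAt (fun t : ℝ => 2 * (p - 1) * t) (2 * (p - 1)) t := by
      simpa using (hasDerivAt_id t).const_mul (2 * (p - 1))
    exact h2.sub (h1.mul (hgd t ht))
  have hEc : ContinuousOn E (Set.Icc 0 1) := by
    refine ContinuousOn.sub (by fun_prop) (ContinuousOn.mul ?_ hgc.continuousOn)
    exact hfc.continuousOn.rpow_const fun t ht => Or.inl (fpos t ht).ne'
  have hEmono : MonotoneOn E (Set.Icc 0 1) := by
    refine monotoneOn_of_deriv_nonneg (convex_Icc 0 1) hEc ?_ ?_
    · rw [interior_Icc]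
      exact fun t ht => (hEd t ht).differentiableAt.differentiableWithinAt
    · rw [interior_Icc]
      intro t ht
      have htc : t ∈ Set.Icc (0 : ℝ) 1 := ⟨ht.1.le, ht.2.le⟩
      rw [(hEd t ht).deriv]
      have h1 : (p / 2 * g t) * (2 / p - 1) * f t ^ (2 / p - 1 - 1) * g t ≤ 0 := by
        have b1 : 2 / p - 1 ≤ 0 := by rw [sub_nonpos, div_le_one hp0]; exact hp
        have b2 : 0 ≤ f t ^ (2 / p - 1 - 1) := Real.rpow_nonneg (fpos t htc).le _
        have b3 := gnn t htc
        have b4 : 0 ≤ (p / 2 * g t) * f t ^ (2 / p - 1 - 1) * g t := by positivity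
        nlinarith
      have h2 : f t ^ (2 / p - 1) * ((p - 1) * ((1 + t) ^ (p - 2) + (1 - t) ^ (p - 2)))
          ≤ 2 * (p - 1) := by
        have c1 : f t ^ (2 / p - 1) * f t ^ ((p - 2) / p) = 1 := by
          rw [← Real.rpow_add (fpos t htc), show 2 / p - 1 + (p - 2) / p = 0 by field_simp; ring,
            Real.rpow_zero]
        have c2 : 0 ≤ f t ^ (2 / p - 1) := Real.rpow_nonneg (fpos t htc).le _
        calc _ ≤ f t ^ (2 / p - 1) * ((p - 1) * (2 * f t ^ ((p - 2) / p))) := by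
              gcongr
              · linarith
              · exact jensen t htc
          _ = 2 * (p - 1) * (f t ^ (2 / p - 1) * f t ^ ((p - 2) / p)) := by ring
          _ = 2 * (p - 1) := by rw [c1, mul_one]
      linarith
  have E0 : E 0 = 0 := by simp [hE, hg]
  set D : ℝ → ℝ := fun t => 1 + (p - 1) * t ^ 2 - f t ^ (2 / p) with hD
  have hDd : ∀ t ∈ Set.Ioo (0 : ℝ) 1, HasDerivAt D (E t) t := by
    intro t ht
    have h1 := (hfd t).rpow_const (p := 2 / p) (Or.inl (fpos t ⟨ht.1.le, ht.2.le⟩).ne')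
    have h2 : HasDerivAt (fun t : ℝ => 1 + (p - 1) * t ^ 2) ((p - 1) * (2 * t)) t := by
      simpa using ((hasDerivAt_pow 2 t).const_mul (p - 1)).const_add 1
    convert! h2.sub h1 using 1
    simp only [hE]
    field_simp
  have hDmono : MonotoneOn D (Set.Icc 0 1) := by
    refine monotoneOn_of_deriv_nonneg (convex_Icc 0 1) ?_ ?_ ?_
    · refine ContinuousOn.sub (by fun_prop) ?_
      exact hfc.continuousOn.rpow_const fun t ht => Or.inl (fpos t ht).ne'
    · rw [interior_Icc]
      exact fun t ht => (hDd t ht).differentiableAt.differentiableWithinAt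
    · rw [interior_Icc]
      intro t ht
      rw [(hDd t ht).deriv, ← E0]
      exact hEmono ⟨le_rfl, zero_le_one⟩ ⟨ht.1.le, ht.2.le⟩ ht.1.le
  have D0 : D 0 = 0 := by simp [hD, hf]
  have := hDmono ⟨le_rfl, zero_le_one⟩ ⟨ht0, ht1⟩ ht0
  rw [D0] at this
  simpa [hD] using this

/-- The scalar two-point inequality: `ℝ` is 2-uniformly smooth with constant `p - 1`. -/
lemma two_point_real {p : ℝ} (hp : 2 ≤ p) (a b : ℝ) :
    ((|a + b| ^ p + |a - b| ^ p) / 2) ^ (2 / p) ≤ a ^ 2 + (p - 1) * b ^ 2 := by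
  have hp0 : 0 < p := by linarith
  have key : ∀ a b : ℝ, 0 ≤ b → b ≤ a →
      ((|a + b| ^ p + |a - b| ^ p) / 2) ^ (2 / p) ≤ a ^ 2 + (p - 1) * b ^ 2 := by
    intro a b hb hba
    have ha : 0 ≤ a := hb.trans hba
    rcases ha.eq_or_lt with rfl | ha
    · obtain rfl : b = 0 := le_antisymm hba hb
      simp [Real.zero_rpow hp0.ne', Real.zero_rpow (by positivity : 2 / p ≠ 0)]
    · have h := two_point_unit hp (by positivity : 0 ≤ b / a) ((div_le_one ha).2 hba)
      have e1 : |a + b| = a * (1 + b / a) := by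
        rw [abs_of_nonneg (by linarith)]; field_simp
      have e2 : |a - b| = a * (1 - b / a) := by
        rw [abs_of_nonneg (by linarith)]; field_simp
      have u2 : 0 ≤ 1 - b / a := by rw [sub_nonneg]; exact (div_le_one ha).2 hba
      rw [e1, e2, Real.mul_rpow ha.le (by positivity), Real.mul_rpow ha.le u2, ← mul_add,
        mul_div_assoc, Real.mul_rpow (by positivity) (by positivity), ← Real.rpow_mul ha.le,
        mul_div_cancel₀ _ hp0.ne']
      calc a ^ (2 : ℝ) * (((1 + b / a) ^ p + (1 - b / a) ^ p) / 2) ^ (2 / p)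
          ≤ a ^ (2 : ℝ) * (1 + (p - 1) * (b / a) ^ 2) := by gcongr
        _ = _ := by
          rw [Real.rpow_two]; field_simp
  have key2 : ∀ a b : ℝ, 0 ≤ a → 0 ≤ b →
      ((|a + b| ^ p + |a - b| ^ p) / 2) ^ (2 / p) ≤ a ^ 2 + (p - 1) * b ^ 2 := by
    intro a b ha hb
    rcases le_total b a with h | h
    · exact key a b hb h
    · rw [add_comm a b, abs_sub_comm]
      refine (key b a ha h).trans ?_
      nlinarith [mul_nonneg (by linarith : 0 ≤ p - 2) (by nlinarith : 0 ≤ b ^ 2 - a ^ 2)]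
  have h := key2 |a| |b| (abs_nonneg _) (abs_nonneg _)
  rw [sq_abs, sq_abs] at h
  refine le_trans (le_of_eq ?_) h
  congr 2
  rcases abs_cases a with ⟨h1, _⟩ | ⟨h1, _⟩ <;> rcases abs_cases b with ⟨h2, _⟩ | ⟨h2, _⟩ <;>
    rw [h1, h2]
  · rw [sub_neg_eq_add, ← sub_eq_add_neg, add_comm]
  · rw [neg_add_eq_sub, abs_sub_comm, show -a - b = -(a + b) by ring, abs_neg, add_comm]
  · rw [show -a + -b = -(a + b) by ring, abs_neg, show -a - -b = -(a - b) by ring, abs_neg]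

variable {α : Type*} [MeasurableSpace α]

/-- Minkowski's integral inequality for the `ℓ^θ` norm on two points. -/
lemma two_point_minkowski (ν : Measure α) {θ : ℝ} (hθ : 1 ≤ θ) {a b : α → ℝ≥0∞}
    (ha : AEMeasurable a ν) (hb : AEMeasurable b ν) :
    ((∫⁻ x, a x ∂ν) ^ θ + (∫⁻ x, b x ∂ν) ^ θ) ^ (1 / θ)
      ≤ ∫⁻ x, (a x ^ θ + b x ^ θ) ^ (1 / θ) ∂ν := by
  rcases hθ.eq_or_lt with rfl | hθ1
  · simp [lintegral_add_left' ha]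
  have hθ0 : 0 < θ := by linarith
  have hle : ∀ u v : ℝ≥0∞, u ≤ (u ^ θ + v ^ θ) ^ (1 / θ) := by
    intro u v
    calc u = (u ^ θ) ^ (1 / θ) := by
          rw [← ENNReal.rpow_mul, mul_one_div_cancel hθ0.ne', ENNReal.rpow_one]
      _ ≤ _ := ENNReal.rpow_le_rpow le_self_add (by positivity)
  set x := ∫⁻ x, a x ∂ν
  set y := ∫⁻ x, b x ∂ν
  have hx : x ≤ ∫⁻ x, (a x ^ θ + b x ^ θ) ^ (1 / θ) ∂ν := lintegral_mono fun z => hle _ _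
  have hy : y ≤ ∫⁻ x, (a x ^ θ + b x ^ θ) ^ (1 / θ) ∂ν :=
    lintegral_mono fun z => by rw [add_comm]; exact hle _ _
  by_cases hxt : x = ⊤
  · rw [hxt, top_le_iff] at hx; rw [hx]; exact le_top
  by_cases hyt : y = ⊤
  · rw [hyt, top_le_iff] at hy; rw [hy]; exact le_top
  set S := (x ^ θ + y ^ θ) ^ (1 / θ) with hS
  set I := ∫⁻ x, (a x ^ θ + b x ^ θ) ^ (1 / θ) ∂ν
  have hSt : S ≠ ⊤ := by
    refine ENNReal.rpow_ne_top_of_nonneg (by positivity) (ENNReal.add_ne_top.2 ⟨?_, ?_⟩)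
    · exact ENNReal.rpow_ne_top_of_nonneg hθ0.le hxt
    · exact ENNReal.rpow_ne_top_of_nonneg hθ0.le hyt
  by_cases hS0 : S = 0
  · rw [hS0]; exact zero_le
  have hSθ : x ^ θ + y ^ θ = S ^ θ := by
    rw [hS, ← ENNReal.rpow_mul, one_div_mul_cancel hθ0.ne', ENNReal.rpow_one]
  have hsplit : ∀ u : ℝ≥0∞, u ^ θ = u ^ (θ - 1) * u := by
    intro u
    have := ENNReal.rpow_add_of_nonneg (x := u) (θ - 1) 1 (by linarith) zero_le_one
    rwa [sub_add_cancel, ENNReal.rpow_one] at this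
  -- Hölder on two points, against the dual vector `(x^(θ-1), y^(θ-1))`
  have hold : ∀ u v : ℝ≥0∞, x ^ (θ - 1) * u + y ^ (θ - 1) * v
      ≤ S ^ (θ - 1) * (u ^ θ + v ^ θ) ^ (1 / θ) := by
    intro u v
    have hconj : (Real.conjExponent θ).HolderConjugate θ :=
      (Real.HolderConjugate.conjExponent hθ1).symm
    have H := ENNReal.inner_le_Lp_mul_Lq (Finset.univ : Finset (Fin 2)) ![x ^ (θ - 1), y ^ (θ - 1)]
      ![u, v] hconj
    simp only [Fin.sum_univ_two, Matrix.cons_val_zero, Matrix.cons_val_one] at H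
    refine H.trans (le_of_eq ?_)
    have e : (θ - 1) * Real.conjExponent θ = θ := by
      rw [Real.conjExponent, mul_div_cancel₀ _ (by linarith)]
    rw [← ENNReal.rpow_mul, ← ENNReal.rpow_mul, e, hSθ, ← ENNReal.rpow_mul]
    congr 2
    rw [Real.conjExponent]; field_simp
  have main : S ^ (θ - 1) * S ≤ S ^ (θ - 1) * I := by
    rw [← hsplit, ← hSθ, hsplit x, hsplit y]
    calc x ^ (θ - 1) * x + y ^ (θ - 1) * y
        = ∫⁻ z, (x ^ (θ - 1) * a z + y ^ (θ - 1) * b z) ∂ν := by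
          rw [lintegral_add_left' (ha.const_mul _), lintegral_const_mul'' _ ha,
            lintegral_const_mul'' _ hb]
      _ ≤ ∫⁻ z, S ^ (θ - 1) * (a z ^ θ + b z ^ θ) ^ (1 / θ) ∂ν :=
          lintegral_mono fun z => hold _ _
      _ = S ^ (θ - 1) * I := by
          rw [lintegral_const_mul'']
          exact ((ha.pow_const _).add (hb.pow_const _)).pow_const _
  refine (ENNReal.mul_le_mul_iff_right ?_ ?_).1 main
  · exact (ENNReal.rpow_pos (pos_iff_ne_zero.2 hS0) hSt).ne'
  · exact ENNReal.rpow_ne_top_of_nonneg (by linarith) hSt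

/-- Minkowski's inequality in `L^{q/2}`, for sums of squares. -/
lemma lintegral_sq_add_le (ν : Measure α) {q : ℝ} (hq : 2 ≤ q) {U V : α → ℝ≥0∞}
    (hU : AEMeasurable U ν) (hV : AEMeasurable V ν) (C : ℝ≥0∞) :
    (∫⁻ x, (U x ^ (2 : ℝ) + C * V x ^ (2 : ℝ)) ^ (q / 2) ∂ν) ^ (2 / q)
      ≤ (∫⁻ x, U x ^ q ∂ν) ^ (2 / q) + C * (∫⁻ x, V x ^ q ∂ν) ^ (2 / q) := by
  have hq0 : 0 < q := by linarith
  have h := ENNReal.lintegral_Lp_add_le (p := q / 2) (μ := ν)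
    (f := fun x => U x ^ (2 : ℝ)) (g := fun x => C * V x ^ (2 : ℝ)) (hU.pow_const _)
    ((hV.pow_const _).const_mul _) (by linarith)
  have e : 1 / (q / 2) = 2 / q := by field_simp
  have e2 : 2 * (q / 2) = q := by field_simp
  have e3 : (q / 2) * (2 / q) = 1 := by field_simp
  simp only [Pi.add_apply, e] at h
  refine h.trans (le_of_eq ?_)
  simp_rw [ENNReal.mul_rpow_of_nonneg _ _ (by linarith : 0 ≤ q / 2), ← ENNReal.rpow_mul, e2]
  rw [lintegral_const_mul'' _ (hV.pow_const _), ENNReal.mul_rpow_of_nonneg _ _ (by positivity),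
    ← ENNReal.rpow_mul, e3, ENNReal.rpow_one]

/-- The two-point smoothness inequality with exponent `p` is inherited by `L^q` norms with
`2 ≤ q ≤ p`, with the same constant. -/
lemma two_point_transfer (ν : Measure α) {p q : ℝ} (hq : 2 ≤ q) (hqp : q ≤ p) (C : ℝ≥0∞)
    {A B U V : α → ℝ≥0∞} (hA : AEMeasurable A ν) (hB : AEMeasurable B ν)
    (hU : AEMeasurable U ν) (hV : AEMeasurable V ν)
    (h : ∀ x, ((A x ^ p + B x ^ p) / 2) ^ (2 / p) ≤ U x ^ (2 : ℝ) + C * V x ^ (2 : ℝ)) :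
    ((((∫⁻ x, A x ^ q ∂ν) ^ (1 / q)) ^ p + ((∫⁻ x, B x ^ q ∂ν) ^ (1 / q)) ^ p) / 2) ^ (2 / p)
      ≤ ((∫⁻ x, U x ^ q ∂ν) ^ (1 / q)) ^ (2 : ℝ)
        + C * ((∫⁻ x, V x ^ q ∂ν) ^ (1 / q)) ^ (2 : ℝ) := by
  have hq0 : 0 < q := by linarith
  have hp0 : 0 < p := by linarith
  have hθ : 1 ≤ p / q := (one_le_div hq0).2 hqp
  have M := two_point_minkowski ν hθ (hA.pow_const q) (hB.pow_const q)
  simp_rw [← ENNReal.rpow_mul] at M ⊢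
  have e1 : q * (p / q) = p := by field_simp
  have e2 : 1 / (p / q) = q / p := by field_simp
  have e3 : 1 / q * p = p / q := by field_simp
  have e4 : 1 / q * 2 = 2 / q := by field_simp
  rw [e3, e4]
  simp_rw [e1, e2] at M
  set X := (∫⁻ x, A x ^ q ∂ν) ^ (p / q) + (∫⁻ x, B x ^ q ∂ν) ^ (p / q)
  have step1 : (X / 2) ^ (q / p) ≤ ∫⁻ x, (U x ^ (2 : ℝ) + C * V x ^ (2 : ℝ)) ^ (q / 2) ∂ν := by
    calc (X / 2) ^ (q / p) = X ^ (q / p) * (2⁻¹ : ℝ≥0∞) ^ (q / p) := by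
          rw [ENNReal.div_eq_inv_mul, ENNReal.mul_rpow_of_nonneg _ _ (by positivity), mul_comm]
      _ ≤ (∫⁻ x, (A x ^ p + B x ^ p) ^ (q / p) ∂ν) * (2⁻¹ : ℝ≥0∞) ^ (q / p) := by gcongr
      _ = ∫⁻ x, ((A x ^ p + B x ^ p) / 2) ^ (q / p) ∂ν := by
          rw [← lintegral_mul_const'']
          · refine lintegral_congr fun x => ?_
            rw [ENNReal.div_eq_inv_mul, ENNReal.mul_rpow_of_nonneg _ _ (by positivity), mul_comm]
          · exact ((hA.pow_const _).add (hB.pow_const _)).pow_const _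
      _ ≤ _ := by
          refine lintegral_mono fun x => ?_
          have e5 : q / p = (2 / p) * (q / 2) := by field_simp
          dsimp only
          rw [e5, ENNReal.rpow_mul]
          exact ENNReal.rpow_le_rpow (h x) (by positivity)
  calc (X / 2) ^ (2 / p) = ((X / 2) ^ (q / p)) ^ (2 / q) := by
        rw [← ENNReal.rpow_mul]; congr 1; field_simp
    _ ≤ (∫⁻ x, (U x ^ (2 : ℝ) + C * V x ^ (2 : ℝ)) ^ (q / 2) ∂ν) ^ (2 / q) :=
        ENNReal.rpow_le_rpow step1 (by positivity)
    _ ≤ _ := lintegral_sq_add_le ν hq hU hV C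

end TwoPoint

/-! ### Moments of `ℓ^s`-norms and their smoothness -/

section LsMoment

/-- The moment `‖ |f|_s ‖_q = (E |f|_s^q)^(1/q)` of a random vector, with values in `[0, ∞]`. -/
noncomputable def lsMoment {Ω : Type*} [MeasurableSpace Ω] {d : ℕ} (s : ℕ) (q : ℝ) (P : Measure Ω)
    (f : Ω → Fin d → ℝ) : ℝ≥0∞ :=
  eLpNorm (fun ω => lsNorm s (f ω)) (ENNReal.ofReal q) P

variable {Ω : Type*} [MeasurableSpace Ω] {P : Measure Ω} {d s : ℕ} {q : ℝ}

lemma enorm_lsNorm (s : ℕ) (v : Fin d → ℝ) : ‖lsNorm s v‖ₑ = ENNReal.ofReal (lsNorm s v) :=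
  Real.enorm_of_nonneg (lsNorm_nonneg s v)

lemma aemeasurable_lsNorm (hs : s ≠ 0) {f : Ω → Fin d → ℝ} (hf : AEMeasurable f P) :
    AEMeasurable (fun ω => lsNorm s (f ω)) P :=
  (continuous_lsNorm hs).measurable.comp_aemeasurable hf

lemma aestronglyMeasurable_lsNorm (hs : s ≠ 0) {f : Ω → Fin d → ℝ} (hf : AEMeasurable f P) :
    AEStronglyMeasurable (fun ω => lsNorm s (f ω)) P :=
  (aemeasurable_lsNorm hs hf).aestronglyMeasurable

lemma lsMoment_eq_lintegral (hq : 0 < q) (f : Ω → Fin d → ℝ) :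
    lsMoment s q P f = (∫⁻ ω, ENNReal.ofReal (lsNorm s (f ω)) ^ q ∂P) ^ (1 / q) := by
  rw [lsMoment, eLpNorm_eq_lintegral_rpow_enorm_toReal (by simpa using hq) ENNReal.ofReal_ne_top,
    ENNReal.toReal_ofReal hq.le]
  simp_rw [enorm_lsNorm]

lemma lsMoment_mono {f g : Ω → Fin d → ℝ} (h : ∀ ω, lsNorm s (f ω) ≤ lsNorm s (g ω)) :
    lsMoment s q P f ≤ lsMoment s q P g :=
  eLpNorm_mono fun ω => by
    rw [Real.norm_of_nonneg (lsNorm_nonneg _ _), Real.norm_of_nonneg (lsNorm_nonneg _ _)]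
    exact h ω

lemma lsMoment_add_le (hs : 1 ≤ s) (hq : 1 ≤ q) {f g : Ω → Fin d → ℝ} (hf : AEMeasurable f P)
    (hg : AEMeasurable g P) :
    lsMoment s q P (fun ω => f ω + g ω) ≤ lsMoment s q P f + lsMoment s q P g := by
  have hs0 : s ≠ 0 := by omega
  refine le_trans (eLpNorm_mono_real fun ω => ?_)
    (eLpNorm_add_le (aestronglyMeasurable_lsNorm hs0 hf) (aestronglyMeasurable_lsNorm hs0 hg)
      (by simpa using hq))
  rw [Real.norm_of_nonneg (lsNorm_nonneg _ _)]
  exact lsNorm_add_le hs _ _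

lemma lsMoment_neg (f : Ω → Fin d → ℝ) :
    lsMoment s q P (fun ω => -f ω) = lsMoment s q P f := by
  simp [lsMoment, lsNorm_neg]

lemma lsMoment_sub_le (hs : 1 ≤ s) (hq : 1 ≤ q) {f g : Ω → Fin d → ℝ} (hf : AEMeasurable f P)
    (hg : AEMeasurable g P) :
    lsMoment s q P (fun ω => f ω - g ω) ≤ lsMoment s q P f + lsMoment s q P g := by
  simpa [sub_eq_add_neg, lsMoment_neg g] using
    lsMoment_add_le (g := fun ω => -g ω) hs hq hf hg.neg

lemma lsMoment_sum_le {ι : Type*} (hs : 1 ≤ s) (hq : 1 ≤ q) (t : Finset ι)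
    {f : ι → Ω → Fin d → ℝ} (hf : ∀ i, AEMeasurable (f i) P) :
    lsMoment s q P (fun ω => ∑ i ∈ t, f i ω) ≤ ∑ i ∈ t, lsMoment s q P (f i) := by
  classical
  induction t using Finset.induction_on with
  | empty => simp [lsMoment, lsNorm_zero hs]
  | insert a t ha ih =>
    simp only [Finset.sum_insert ha]
    refine (lsMoment_add_le hs hq (hf a) ?_).trans (by gcongr)
    exact Finset.aemeasurable_fun_sum t fun i _ => hf i

lemma lsMoment_const_smul (hs : 1 ≤ s) (c : ℝ) (f : Ω → Fin d → ℝ) :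
    lsMoment s q P (fun ω => c • f ω) = ENNReal.ofReal |c| * lsMoment s q P f := by
  unfold lsMoment
  simp_rw [lsNorm_smul hs]
  rw [← Real.enorm_of_nonneg (abs_nonneg c), ← eLpNorm_const_smul]
  rfl

lemma lsMoment_const [IsProbabilityMeasure P] (hq : 0 < q) (v : Fin d → ℝ) :
    lsMoment s q P (fun _ => v) = ENNReal.ofReal (lsNorm s v) := by
  rw [lsMoment, eLpNorm_const _ (by simpa using hq) (IsProbabilityMeasure.ne_zero P)]
  simp [enorm_lsNorm]

lemma lsMoment_lt_top_iff (hs : s ≠ 0) {f : Ω → Fin d → ℝ} (hf : AEMeasurable f P) :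
    lsMoment s q P f < ⊤ ↔ MemLp (fun ω => lsNorm s (f ω)) (ENNReal.ofReal q) P :=
  ⟨fun h => ⟨aestronglyMeasurable_lsNorm hs hf, h⟩, fun h => h.2⟩

lemma lsMoment_map {Ω' : Type*} [MeasurableSpace Ω'] {X : Ω → Ω'} (hX : AEMeasurable X P)
    (hs : s ≠ 0) {f : Ω' → Fin d → ℝ} (hf : Measurable f) :
    lsMoment s q (P.map X) f = lsMoment s q P (fun ω => f (X ω)) := by
  unfold lsMoment
  rw [eLpNorm_map_measure (aestronglyMeasurable_lsNorm hs hf.aemeasurable) hX]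
  rfl

/-- First moments are dominated by `q`-th moments. -/
lemma integrable_lsNorm [IsProbabilityMeasure P] (hs : s ≠ 0) (hq : 1 ≤ q) {f : Ω → Fin d → ℝ}
    (hf : AEMeasurable f P) (h : lsMoment s q P f < ⊤) : Integrable (fun ω => lsNorm s (f ω)) P :=
  ((lsMoment_lt_top_iff hs hf).1 h).integrable (by simpa using hq)

lemma integrable_of_lsMoment [IsProbabilityMeasure P] (hs : s ≠ 0) (hq : 1 ≤ q)
    {f : Ω → Fin d → ℝ} (hf : AEMeasurable f P) (h : lsMoment s q P f < ⊤) : Integrable f P :=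
  (integrable_lsNorm hs hq hf h).mono' hf.aestronglyMeasurable
    (ae_of_all _ fun ω => norm_le_lsNorm hs (f ω))

lemma lsNorm_integral_le_lsMoment [IsProbabilityMeasure P] (hs : 1 ≤ s) (hq : 1 ≤ q)
    {f : Ω → Fin d → ℝ} (hf : AEMeasurable f P) :
    ENNReal.ofReal (lsNorm s (∫ ω, f ω ∂P)) ≤ lsMoment s q P f := by
  have hs0 : s ≠ 0 := by omega
  by_cases h : lsMoment s q P f < ⊤
  · refine (ENNReal.ofReal_le_ofReal
      (lsNorm_integral_le hs (integrable_of_lsMoment hs0 hq hf h))).trans ?_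
    rw [ofReal_integral_eq_lintegral_ofReal (integrable_lsNorm hs0 hq hf h)
      (ae_of_all _ fun _ => lsNorm_nonneg _ _)]
    simp_rw [← enorm_lsNorm]
    rw [← eLpNorm_one_eq_lintegral_enorm]
    exact eLpNorm_le_eLpNorm_of_exponent_le (by simpa using hq)
      (aestronglyMeasurable_lsNorm hs0 hf)
  · rw [not_lt_top_iff.1 h]; exact le_top

lemma lintegral_count_lsNorm (hs : s ≠ 0) (v : Fin d → ℝ) :
    (∫⁻ i, ENNReal.ofReal |v i| ^ (s : ℝ) ∂Measure.count) ^ (1 / (s : ℝ))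
      = ENNReal.ofReal (lsNorm s v) := by
  rw [lintegral_count, tsum_fintype, lsNorm, ← ENNReal.ofReal_rpow_of_nonneg (by positivity)
    (by positivity), ENNReal.ofReal_sum_of_nonneg fun _ _ => by positivity]
  congr 1
  refine Finset.sum_congr rfl fun i _ => ?_
  rw [ENNReal.rpow_natCast, ENNReal.ofReal_pow (abs_nonneg _)]

/-- `ℓ^s` satisfies the two-point smoothness inequality for every exponent `p ≥ s ≥ 2`. -/
lemma two_point_lsNorm (hs : 2 ≤ s) {p : ℝ} (hp : (s : ℝ) ≤ p) (u v : Fin d → ℝ) :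
    ((ENNReal.ofReal (lsNorm s (u + v)) ^ p + ENNReal.ofReal (lsNorm s (u - v)) ^ p) / 2) ^ (2 / p)
      ≤ ENNReal.ofReal (lsNorm s u) ^ (2 : ℝ)
        + ENNReal.ofReal (p - 1) * ENNReal.ofReal (lsNorm s v) ^ (2 : ℝ) := by
  have hs0 : s ≠ 0 := by omega
  have hs2 : (2 : ℝ) ≤ s := by exact_mod_cast hs
  have hp0 : 0 < p := by linarith
  have := two_point_transfer (Measure.count : Measure (Fin d)) hs2 hp (ENNReal.ofReal (p - 1))
    (A := fun i => ENNReal.ofReal |(u + v) i|) (B := fun i => ENNReal.ofReal |(u - v) i|)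
    (U := fun i => ENNReal.ofReal |u i|) (V := fun i => ENNReal.ofReal |v i|)
    (Measurable.of_discrete.aemeasurable) (Measurable.of_discrete.aemeasurable)
    (Measurable.of_discrete.aemeasurable) (Measurable.of_discrete.aemeasurable) ?_
  · simpa only [lintegral_count_lsNorm hs0] using this
  · intro i
    have h := two_point_real (by linarith : 2 ≤ p) (u i) (v i)
    have h2 := ENNReal.ofReal_le_ofReal h
    rw [← ENNReal.ofReal_rpow_of_nonneg (by positivity) (by positivity),
      ENNReal.ofReal_div_of_pos (by norm_num), ENNReal.ofReal_add (by positivity) (by positivity),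
      ← ENNReal.ofReal_rpow_of_nonneg (by positivity) (by positivity),
      ← ENNReal.ofReal_rpow_of_nonneg (by positivity) (by positivity),
      ENNReal.ofReal_add (by positivity) (mul_nonneg (by linarith) (sq_nonneg _)),
      ENNReal.ofReal_mul (by linarith), ← sq_abs (u i), ← sq_abs (v i),
      ENNReal.ofReal_pow (abs_nonneg _), ENNReal.ofReal_pow (abs_nonneg _)] at h2
    simpa using h2

/-- 2-uniform smoothness of the norm `‖ |·|_s ‖_q` with constant `max q s - 1`. -/
lemma lsMoment_smooth (hs : 2 ≤ s) (hq : 2 ≤ q) {u v : Ω → Fin d → ℝ} (hu : AEMeasurable u P)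
    (hv : AEMeasurable v P) :
    lsMoment s q P (fun ω => u ω + v ω) ^ 2 + lsMoment s q P (fun ω => u ω - v ω) ^ 2
      ≤ 2 * (lsMoment s q P u ^ 2
        + ENNReal.ofReal (max q s - 1) * lsMoment s q P v ^ 2) := by
  have hs0 : s ≠ 0 := by omega
  set p : ℝ := max q s
  have hp : 2 ≤ p := hq.trans (le_max_left _ _)
  have hp0 : 0 < p := by linarith
  have m : ∀ {w : Ω → Fin d → ℝ}, AEMeasurable w P →
      AEMeasurable (fun ω => ENNReal.ofReal (lsNorm s (w ω))) P := fun hw =>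
    (aemeasurable_lsNorm hs0 hw).ennreal_ofReal
  have T := two_point_transfer P hq (le_max_left q (s : ℝ)) (ENNReal.ofReal (p - 1))
    (m (hu.add hv)) (m (hu.sub hv)) (m hu) (m hv)
    (fun ω => two_point_lsNorm hs (le_max_right q (s : ℝ)) (u ω) (v ω))
  simp only [Pi.add_apply, Pi.sub_apply] at T
  simp_rw [← lsMoment_eq_lintegral (s := s) (P := P) (by linarith : 0 < q)] at T
  rw [ENNReal.rpow_two, ENNReal.rpow_two] at T
  refine le_trans ?_ (mul_le_mul_right T 2)
  set a := lsMoment s q P (fun ω => u ω + v ω)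
  set b := lsMoment s q P (fun ω => u ω - v ω)
  -- the power mean of order two is at most the power mean of order `p`
  have hJ := ENNReal.rpow_arith_mean_le_arith_mean2_rpow (1 / 2) (1 / 2) (a ^ 2) (b ^ 2)
    (ENNReal.add_halves 1) (by linarith : 1 ≤ p / 2)
  have e : ∀ z : ℝ≥0∞, (z ^ 2) ^ (p / 2) = z ^ p := by
    intro z
    rw [← ENNReal.rpow_two, ← ENNReal.rpow_mul]; congr 1; field_simp
  rw [e, e] at hJ
  have hJ2 := ENNReal.rpow_le_rpow hJ (by positivity : 0 ≤ 2 / p)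
  rw [← ENNReal.rpow_mul, show p / 2 * (2 / p) = 1 by field_simp, ENNReal.rpow_one] at hJ2
  have e2 : 1 / 2 * a ^ p + 1 / 2 * b ^ p = (a ^ p + b ^ p) / 2 := by
    rw [one_div, ← mul_add, ENNReal.div_eq_inv_mul]
  rw [e2] at hJ2
  calc a ^ 2 + b ^ 2 = 2 * (1 / 2 * a ^ 2 + 1 / 2 * b ^ 2) := by
        rw [mul_add, ← mul_assoc, ← mul_assoc, one_div,
          ENNReal.mul_inv_cancel (by norm_num) (by norm_num), one_mul, one_mul]
    _ ≤ _ := mul_le_mul_right hJ2 2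

end LsMoment

/-! ### A one-step moment inequality of Rio type -/

section Rio

/-- A quantitative smoothness bound at dyadic points gives a one-sided second-order Taylor bound. -/
lemma dyadic_taylor {φ : ℝ → ℝ} {φ' B : ℝ} (h : ∀ t, 0 < t → t ≤ 1 →
    φ (2 * t) + φ 0 ≤ 2 * φ t + 2 * B * t ^ 2) (hd : HasDerivAt φ φ' 0) :
    φ 1 ≤ φ 0 + φ' + B := by
  set t : ℕ → ℝ := fun n => (1 / 2 : ℝ) ^ n with ht
  have tpos : ∀ n, 0 < t n := fun n => by positivity
  have tle : ∀ n, t n ≤ 1 := fun n => pow_le_one₀ (by norm_num) (by norm_num)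
  have tsucc : ∀ n, t n = 2 * t (n + 1) := fun n => by simp only [ht, pow_succ]; ring
  have key : ∀ n, φ 1 - φ 0 ≤ (t n)⁻¹ * (φ (t n) - φ 0) + B * (1 - t n) := by
    intro n
    induction n with
    | zero => simp [ht]
    | succ n ih =>
      refine ih.trans ?_
      have h1 := h (t (n + 1)) (tpos _) (tle _)
      have h0 := tpos (n + 1)
      rw [tsucc n]
      have e : (2 * t (n + 1))⁻¹ * (φ (2 * t (n + 1)) - φ 0)
          ≤ (2 * t (n + 1))⁻¹ * (2 * (φ (t (n + 1)) - φ 0) + 2 * B * t (n + 1) ^ 2) := by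
        gcongr; linarith
      refine (add_le_add_left e _).trans (le_of_eq ?_)
      field_simp
      ring
  have ht0 : Tendsto t atTop (𝓝 0) :=
    tendsto_pow_atTop_nhds_zero_of_lt_one (by norm_num) (by norm_num)
  have hs := hd.tendsto_slope_zero
  have ht0' : Tendsto t atTop (𝓝[≠] 0) :=
    tendsto_nhdsWithin_iff.2 ⟨ht0, Eventually.of_forall fun n => (tpos n).ne'⟩
  have L1 := hs.comp ht0'
  have L2 : Tendsto (fun n => (t n)⁻¹ * (φ (t n) - φ 0) + B * (1 - t n)) atTop
      (𝓝 (φ' + B * (1 - 0))) := by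
    refine Tendsto.add ?_ ((tendsto_const_nhds.sub ht0).const_mul B)
    refine L1.congr fun n => ?_
    simp [smul_eq_mul]
  have := ge_of_tendsto' L2 key
  linarith

lemma abs_rpow_sub_rpow_le {q R a b : ℝ} (hq : 1 ≤ q) (ha : 0 ≤ a) (hb : 0 ≤ b) (haR : a ≤ R)
    (hbR : b ≤ R) : |a ^ q - b ^ q| ≤ q * R ^ (q - 1) * |a - b| := by
  have := (convex_Icc (0 : ℝ) R).norm_image_sub_le_of_norm_hasDerivWithin_le
    (f := fun x : ℝ => x ^ q) (f' := fun x => q * x ^ (q - 1)) (C := q * R ^ (q - 1))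
    (x := b) (y := a)
    (fun x _ => (Real.hasDerivAt_rpow_const (Or.inr hq)).hasDerivWithinAt) (fun x hx => by
      rw [Real.norm_of_nonneg (mul_nonneg (by linarith) (Real.rpow_nonneg hx.1 _))]
      have := Real.rpow_le_rpow hx.1 hx.2 (by linarith : 0 ≤ q - 1)
      gcongr) ⟨hb, hbR⟩ ⟨ha, haR⟩
  simpa [Real.norm_eq_abs] using this

variable {Ω : Type*} [MeasurableSpace Ω] {P : Measure Ω} {d s : ℕ} {q : ℝ}

lemma hasDerivAt_lsNorm_rpow (hs : 2 ≤ s) (hev : Even s) {x : Fin d → ℝ} (hx : x ≠ 0)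
    (y : Fin d → ℝ) : HasDerivAt (fun t : ℝ => lsNorm s (x + t • y) ^ q)
      (q * lsNorm s x ^ (q - s) * ∑ i, x i ^ (s - 1) * y i) 0 := by
  have hs0 : s ≠ 0 := by omega
  have hsR : (s : ℝ) ≠ 0 := by exact_mod_cast hs0
  have hxn : 0 < lsNorm s x :=
    lt_of_le_of_ne (lsNorm_nonneg _ _) fun h => hx (eq_zero_of_lsNorm_eq_zero hs0 h.symm)
  have e : (fun t : ℝ => lsNorm s (x + t • y) ^ q)
      = fun t : ℝ => (∑ i, (x i + t * y i) ^ s) ^ (q / s) := by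
    funext t
    rw [lsNorm, ← Real.rpow_mul (by positivity)]
    congr 1
    · refine Finset.sum_congr rfl fun i _ => ?_
      rw [hev.pow_abs]; simp
    · field_simp
  have h1 : HasDerivAt (fun t : ℝ => ∑ i, (x i + t * y i) ^ s)
      (∑ i, (s : ℝ) * x i ^ (s - 1) * y i) 0 := by
    refine HasDerivAt.fun_sum fun i _ => ?_
    have : HasDerivAt (fun t : ℝ => x i + t * y i) (y i) 0 := by
      simpa using ((hasDerivAt_id (0 : ℝ)).mul_const (y i)).const_add (x i)
    simpa using this.fun_pow s
  have h0 : ∑ i, (x i + 0 * y i) ^ s = lsNorm s x ^ s := by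
    rw [lsNorm_pow hs0]
    exact Finset.sum_congr rfl fun i _ => by rw [hev.pow_abs]; simp
  have h2 := h1.rpow_const (p := q / s) (Or.inl (by rw [h0]; positivity))
  rw [e]
  refine h2.congr_deriv ?_
  rw [h0, ← Real.rpow_natCast, ← Real.rpow_mul hxn.le, show (s : ℝ) * (q / s - 1) = q - s by
    field_simp]
  simp_rw [mul_assoc]
  rw [← Finset.mul_sum]
  field_simp

lemma toReal_lsMoment (hq : 0 < q) (hs : s ≠ 0) {f : Ω → Fin d → ℝ} (hf : AEMeasurable f P)
    (h : lsMoment s q P f < ⊤) :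
    (lsMoment s q P f).toReal = (∫ ω, lsNorm s (f ω) ^ q ∂P) ^ (1 / q) := by
  have := ((lsMoment_lt_top_iff hs hf).1 h).eLpNorm_eq_integral_rpow_norm (by simpa using hq)
    ENNReal.ofReal_ne_top
  rw [lsMoment, this, ENNReal.toReal_ofReal (by positivity), ENNReal.toReal_ofReal hq.le, one_div]
  congr 2
  funext ω
  rw [Real.norm_of_nonneg (lsNorm_nonneg _ _)]

/-- The first-order term in `lsMoment_add_sq_le`: the derivative of `t ↦ E |x + tY|_s^q` at `0`. -/
lemma hasDerivAt_integral_lsNorm_rpow [IsProbabilityMeasure P] (hs : 2 ≤ s) (hev : Even s)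
    (hq : 2 ≤ q) {Y : Ω → Fin d → ℝ} (hY : AEMeasurable Y P) {x : Fin d → ℝ} (hx : x ≠ 0)
    (hYt : lsMoment s q P Y < ⊤) :
    HasDerivAt (fun t : ℝ => ∫ ω, lsNorm s (x + t • Y ω) ^ q ∂P)
      (q * lsNorm s x ^ (q - s) * ∑ i, x i ^ (s - 1) * (∫ ω, Y ω i ∂P)) 0 := by
  have hs0 : s ≠ 0 := by omega
  have hs1 : 1 ≤ s := by omega
  have hq0 : 0 < q := by linarith
  have hq1 : 1 ≤ q := by linarith
  have hxn : 0 < lsNorm s x :=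
    lt_of_le_of_ne (lsNorm_nonneg _ _) fun h => hx (eq_zero_of_lsNorm_eq_zero hs0 h.symm)
  have hmeas : ∀ t : ℝ, AEMeasurable (fun ω => x + t • Y ω) P := fun t =>
    (hY.const_smul t).const_add x
  have hIR : Integrable (fun ω => (lsNorm s x + lsNorm s (Y ω)) ^ q) P := by
    have h0 : MemLp (fun _ : Ω => lsNorm s x) (ENNReal.ofReal q) P := memLp_const _
    have h1 := h0.add ((lsMoment_lt_top_iff hs0 hY).1 hYt)
    have := h1.integrable_norm_rpow (by simpa using hq0) ENNReal.ofReal_ne_top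
    rw [ENNReal.toReal_ofReal hq0.le] at this
    refine this.congr (ae_of_all _ fun ω => ?_)
    have : 0 ≤ lsNorm s x + lsNorm s (Y ω) := add_nonneg (lsNorm_nonneg _ _) (lsNorm_nonneg _ _)
    simp only [Pi.add_apply, Real.norm_of_nonneg this]
  have hYi' : ∀ i, Integrable (fun ω => Y ω i) P := fun i =>
    (integrable_of_lsMoment hs0 hq1 hY hYt).eval i
  have hSint : ∫ ω, q * lsNorm s x ^ (q - s) * ∑ i, x i ^ (s - 1) * Y ω i ∂P
      = q * lsNorm s x ^ (q - s) * ∑ i, x i ^ (s - 1) * (∫ ω, Y ω i ∂P) := by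
    rw [integral_const_mul, integral_finsetSum _ fun i _ => (hYi' i).const_mul _]
    simp_rw [integral_const_mul]
  have hF : ∀ t : ℝ, AEStronglyMeasurable (fun ω => lsNorm s (x + t • Y ω) ^ q) P := fun t =>
    ((aemeasurable_lsNorm hs0 (hmeas t)).pow_const q).aestronglyMeasurable
  have hF0 : Integrable (fun ω => lsNorm s (x + (0 : ℝ) • Y ω) ^ q) P := by simp
  have hF' : AEStronglyMeasurable
      (fun ω => q * lsNorm s x ^ (q - s) * ∑ i, x i ^ (s - 1) * Y ω i) P :=
    ((integrable_finsetSum Finset.univ fun i _ =>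
      (hYi' i).const_mul (x i ^ (s - 1))).const_mul _).aestronglyMeasurable
  have hlip : ∀ ω, LipschitzOnWith (Real.nnabs (q * (lsNorm s x + lsNorm s (Y ω)) ^ q))
      (fun t : ℝ => lsNorm s (x + t • Y ω) ^ q) (Metric.ball 0 1) := by
    refine fun ω => LipschitzOnWith.of_dist_le_mul fun t ht t' ht' => ?_
    have hR : 0 ≤ lsNorm s x + lsNorm s (Y ω) := add_nonneg (lsNorm_nonneg _ _) (lsNorm_nonneg _ _)
    have hbd : ∀ t ∈ Metric.ball (0 : ℝ) 1,
        lsNorm s (x + t • Y ω) ≤ lsNorm s x + lsNorm s (Y ω) := by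
      intro t ht
      rw [mem_ball_zero_iff, Real.norm_eq_abs] at ht
      refine (lsNorm_add_le hs1 _ _).trans ?_
      rw [lsNorm_smul hs1]
      nlinarith [lsNorm_nonneg s (Y ω)]
    have h1 := abs_rpow_sub_rpow_le hq1 (lsNorm_nonneg s (x + t • Y ω))
      (lsNorm_nonneg s (x + t' • Y ω)) (hbd t ht) (hbd t' ht')
    have h2 : |lsNorm s (x + t • Y ω) - lsNorm s (x + t' • Y ω)|
        ≤ |t - t'| * lsNorm s (Y ω) := by
      rw [← lsNorm_smul hs1]
      have e : ∀ a b : ℝ, (x + a • Y ω) - (x + b • Y ω) = (a - b) • Y ω := by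
        intro a b; rw [sub_smul]; abel
      rw [abs_sub_le_iff]
      constructor
      · have := lsNorm_le_add_sub hs1 (x + t • Y ω) (x + t' • Y ω)
        rw [e] at this; linarith
      · have := lsNorm_le_add_sub hs1 (x + t' • Y ω) (x + t • Y ω)
        rw [lsNorm_sub_comm, e] at this; linarith
    rw [Real.dist_eq, Real.dist_eq, Real.coe_nnabs,
      abs_of_nonneg (mul_nonneg hq0.le (Real.rpow_nonneg hR _))]
    refine h1.trans ?_
    have h3 : (lsNorm s x + lsNorm s (Y ω)) ^ q
        = (lsNorm s x + lsNorm s (Y ω)) ^ (q - 1) * (lsNorm s x + lsNorm s (Y ω)) := by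
      have : 0 < lsNorm s x + lsNorm s (Y ω) := by
        have := lsNorm_nonneg s (Y ω); linarith
      conv_rhs => rw [← Real.rpow_add_one this.ne', sub_add_cancel]
    rw [h3]
    have h4 : 0 ≤ (lsNorm s x + lsNorm s (Y ω)) ^ (q - 1) := Real.rpow_nonneg hR _
    calc q * (lsNorm s x + lsNorm s (Y ω)) ^ (q - 1)
          * |lsNorm s (x + t • Y ω) - lsNorm s (x + t' • Y ω)|
        ≤ q * (lsNorm s x + lsNorm s (Y ω)) ^ (q - 1)
          * (|t - t'| * (lsNorm s x + lsNorm s (Y ω))) := by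
          gcongr
          refine h2.trans ?_
          gcongr
          linarith
      _ = _ := by ring
  rw [← hSint]
  exact (hasDerivAt_integral_of_dominated_loc_of_lip (s := Metric.ball 0 1)
    (bound := fun ω => q * (lsNorm s x + lsNorm s (Y ω)) ^ q)
    (Metric.ball_mem_nhds 0 one_pos) (Eventually.of_forall hF) hF0 hF' (ae_of_all _ hlip)
    (hIR.const_mul q) (ae_of_all _ fun ω => hasDerivAt_lsNorm_rpow hs hev hx (Y ω))).2

/-- A Rio-type inequality: adding to a deterministic vector `x` a random vector `Y` whose mean has
pairing at most `c |x|_s^s` with `x^{s-1}` raises the squared moment of the norm by at most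
`2c |x|_s²` and a term of second order in `Y`. The term of first order is the derivative of `t ↦ ‖ |x + tY|_s ‖_q²` at `0`, and
2-uniform smoothness controls the remainder. -/
theorem lsMoment_add_sq_le [IsProbabilityMeasure P] (hs : 2 ≤ s) (hev : Even s) (hq : 2 ≤ q)
    {Y : Ω → Fin d → ℝ} (hY : AEMeasurable Y P) {x : Fin d → ℝ} {b c : ℝ}
    (hYb : lsMoment s q P Y ≤ ENNReal.ofReal b) (hb : 0 ≤ b)
    (hc : ∑ i, x i ^ (s - 1) * (∫ ω, Y ω i ∂P) ≤ c * lsNorm s x ^ s) :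
    (lsMoment s q P (fun ω => x + Y ω)).toReal ^ 2
      ≤ (1 + 2 * c) * lsNorm s x ^ 2 + (max q s - 1) * b ^ 2 := by
  have hs0 : s ≠ 0 := by omega
  have hs1 : 1 ≤ s := by omega
  have hq0 : 0 < q := by linarith
  have hq1 : 1 ≤ q := by linarith
  have hm : 2 ≤ max q (s : ℝ) := hq.trans (le_max_left _ _)
  have hYt : lsMoment s q P Y < ⊤ := hYb.trans_lt ENNReal.ofReal_lt_top
  have hYr : (lsMoment s q P Y).toReal ≤ b := ENNReal.toReal_le_of_le_ofReal hb hYb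
  rcases eq_or_ne x 0 with rfl | hx
  · simp only [zero_add, lsNorm_zero hs1]
    have : (lsMoment s q P Y).toReal ^ 2 ≤ b ^ 2 := by gcongr
    nlinarith [sq_nonneg b]
  have hxn : 0 < lsNorm s x :=
    lt_of_le_of_ne (lsNorm_nonneg _ _) fun h => hx (eq_zero_of_lsNorm_eq_zero hs0 h.symm)
  have hmeas : ∀ t : ℝ, AEMeasurable (fun ω => x + t • Y ω) P := fun t =>
    (hY.const_smul t).const_add x
  have hfin : ∀ t : ℝ, lsMoment s q P (fun ω => x + t • Y ω) < ⊤ := by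
    intro t
    refine (lsMoment_add_le hs1 hq1 aemeasurable_const (hY.const_smul t)).trans_lt ?_
    rw [lsMoment_const hq0, show (t • Y) = (fun ω => t • Y ω) from rfl, lsMoment_const_smul hs1]
    exact ENNReal.add_lt_top.2 ⟨ENNReal.ofReal_lt_top, ENNReal.mul_lt_top ENNReal.ofReal_lt_top hYt⟩
  set φ : ℝ → ℝ := fun t => (lsMoment s q P (fun ω => x + t • Y ω)).toReal ^ 2 with hφ
  set B : ℝ := (max q s - 1) * b ^ 2 with hB
  have hφ0 : φ 0 = lsNorm s x ^ 2 := by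
    simp [hφ, lsMoment_const hq0, ENNReal.toReal_ofReal (lsNorm_nonneg _ _)]
  have smooth : ∀ t : ℝ, 0 < t → t ≤ 1 → φ (2 * t) + φ 0 ≤ 2 * φ t + 2 * B * t ^ 2 := by
    intro t ht _
    have h := lsMoment_smooth hs hq (hmeas t) (hY.const_smul t)
    simp only [Pi.smul_apply] at h
    have e1 : (fun ω => x + t • Y ω + t • Y ω) = fun ω => x + (2 * t) • Y ω := by
      funext ω; rw [two_mul, add_smul, add_assoc]
    have e2 : (fun ω => x + t • Y ω - t • Y ω) = fun ω => x + (0 : ℝ) • Y ω := by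
      funext ω; simp
    have h3 : lsMoment s q P (t • Y) ≤ ENNReal.ofReal (t * b) := by
      rw [show (t • Y) = (fun ω => t • Y ω) from rfl, lsMoment_const_smul hs1, abs_of_pos ht,
        ENNReal.ofReal_mul ht.le]
      gcongr
    rw [e1, e2] at h
    have h4 : lsMoment s q P (fun ω => x + (2 * t) • Y ω) ^ 2
        + lsMoment s q P (fun ω => x + (0 : ℝ) • Y ω) ^ 2
        ≤ 2 * (lsMoment s q P (fun ω => x + t • Y ω) ^ 2
          + ENNReal.ofReal (max q s - 1) * ENNReal.ofReal (t * b) ^ 2) := by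
      refine h.trans ?_
      gcongr
    have h5 := ENNReal.toReal_mono (by
      have := hfin t
      finiteness) h4
    rw [ENNReal.toReal_add (by have := hfin (2 * t); finiteness) (by have := hfin 0; finiteness),
      ENNReal.toReal_mul, ENNReal.toReal_add (by have := hfin t; finiteness) (by finiteness),
      ENNReal.toReal_mul, ENNReal.toReal_pow, ENNReal.toReal_pow, ENNReal.toReal_pow,
      ENNReal.toReal_pow, ENNReal.toReal_ofReal (by linarith),
      ENNReal.toReal_ofReal (by positivity)] at h5
    simp only [ENNReal.toReal_ofNat] at h5
    simp only [hφ, hB]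
    linarith
  set N : ℝ → ℝ := fun t => ∫ ω, lsNorm s (x + t • Y ω) ^ q ∂P with hN
  set S : ℝ := ∑ i, x i ^ (s - 1) * (∫ ω, Y ω i ∂P) with hS
  have hNd : HasDerivAt N (q * lsNorm s x ^ (q - s) * S) 0 :=
    hasDerivAt_integral_lsNorm_rpow hs hev hq hY hx hYt
  have hN0 : N 0 = lsNorm s x ^ q := by simp [hN]
  have hφN : φ = fun t => N t ^ (2 / q) := by
    funext t
    simp only [hφ, hN]
    have hnn : 0 ≤ ∫ ω, lsNorm s (x + t • Y ω) ^ q ∂P :=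
      integral_nonneg fun ω => Real.rpow_nonneg (lsNorm_nonneg _ _) _
    rw [toReal_lsMoment hq0 hs0 (hmeas t) (hfin t), ← Real.rpow_natCast, ← Real.rpow_mul hnn]
    congr 1
    push_cast
    field_simp
  have hφd : HasDerivAt φ (2 * lsNorm s x ^ (2 - s : ℝ) * S) 0 := by
    rw [hφN]
    refine (hNd.rpow_const (p := 2 / q) (Or.inl ?_)).congr_deriv ?_
    · rw [hN0]; positivity
    · rw [hN0, ← Real.rpow_mul hxn.le]
      have e : q * lsNorm s x ^ (q - s) * S * (2 / q) * lsNorm s x ^ (q * (2 / q - 1))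
          = 2 * (lsNorm s x ^ (q - s) * lsNorm s x ^ (q * (2 / q - 1))) * S := by
        field_simp
      rw [e, ← Real.rpow_add hxn]
      congr 3
      field_simp
      ring
  have H := dyadic_taylor smooth hφd
  have hφ1 : φ 1 = (lsMoment s q P (fun ω => x + Y ω)).toReal ^ 2 := by simp [hφ]
  rw [hφ1, hφ0] at H
  refine H.trans ?_
  have h1 : lsNorm s x ^ (2 - s : ℝ) * S ≤ c * lsNorm s x ^ 2 := by
    calc lsNorm s x ^ (2 - s : ℝ) * S ≤ lsNorm s x ^ (2 - s : ℝ) * (c * lsNorm s x ^ s) := by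
          gcongr
      _ = c * (lsNorm s x ^ (2 - s : ℝ) * lsNorm s x ^ (s : ℝ)) := by
          rw [Real.rpow_natCast]; ring
      _ = c * lsNorm s x ^ 2 := by
          rw [← Real.rpow_add hxn, sub_add_cancel, Real.rpow_two]
  linarith

end Rio

/-! ### Random recursions driven by independent samples -/

section Product

variable {T Ξ : Type*} [MeasurableSpace T] [MeasurableSpace Ξ] {d s : ℕ} {q : ℝ}

lemma lintegral_enorm_le_lsMoment {P : Measure T} [IsProbabilityMeasure P] (hs : s ≠ 0)
    (hq : 1 ≤ q) {f : T → Fin d → ℝ} (hf : AEMeasurable f P) :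
    ∫⁻ ω, ‖f ω‖ₑ ∂P ≤ lsMoment s q P f := by
  calc ∫⁻ ω, ‖f ω‖ₑ ∂P ≤ ∫⁻ ω, ‖lsNorm s (f ω)‖ₑ ∂P := by
        refine lintegral_mono fun ω => ?_
        rw [enorm_lsNorm, ← ofReal_norm]
        exact ENNReal.ofReal_le_ofReal (norm_le_lsNorm hs _)
    _ = eLpNorm (fun ω => lsNorm s (f ω)) 1 P := by rw [eLpNorm_one_eq_lintegral_enorm]
    _ ≤ _ := eLpNorm_le_eLpNorm_of_exponent_le (by simpa using hq)
      (aestronglyMeasurable_lsNorm hs hf)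

/-- Integrating a conditional second-order moment bound over the conditioning variable. -/
lemma lsMoment_prod_sq_le {ν : Measure T} [SFinite ν] {Q : Measure Ξ} [SFinite Q] (hs : s ≠ 0)
    (hq : 2 ≤ q) {H : T × Ξ → Fin d → ℝ} (hH : Measurable H) {a b : T → ℝ}
    (ha : AEMeasurable a ν) (hb : AEMeasurable b ν)
    (h : ∀ t, lsMoment s q Q (fun x => H (t, x)) ^ 2 ≤ ENNReal.ofReal (a t ^ 2 + b t ^ 2)) :
    lsMoment s q (ν.prod Q) H ^ 2
      ≤ eLpNorm a (ENNReal.ofReal q) ν ^ 2 + eLpNorm b (ENNReal.ofReal q) ν ^ 2 := by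
  have hq0 : 0 < q := by linarith
  have e : ∀ c : T → ℝ, eLpNorm c (ENNReal.ofReal q) ν ^ 2 = (∫⁻ t, ‖c t‖ₑ ^ q ∂ν) ^ (2 / q) := by
    intro c
    rw [eLpNorm_eq_lintegral_rpow_enorm_toReal (by simpa using hq0) ENNReal.ofReal_ne_top,
      ENNReal.toReal_ofReal hq0.le, ← ENNReal.rpow_two, ← ENNReal.rpow_mul]
    congr 1; field_simp
  have e' : ∀ {Ω : Type _} [MeasurableSpace Ω] (P : Measure Ω) (f : Ω → Fin d → ℝ),
      ∫⁻ ω, ENNReal.ofReal (lsNorm s (f ω)) ^ q ∂P = (lsMoment s q P f ^ 2) ^ (q / 2) := by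
    intro Ω _ P f
    rw [lsMoment_eq_lintegral hq0, ← ENNReal.rpow_two, ← ENNReal.rpow_mul, ← ENNReal.rpow_mul]
    rw [show 1 / q * (2 * (q / 2)) = 1 by field_simp, ENNReal.rpow_one]
  have hmeas : Measurable fun z => ENNReal.ofReal (lsNorm s (H z)) ^ q :=
    (((continuous_lsNorm hs).measurable.comp hH).ennreal_ofReal).pow_const q
  have hsq : ∀ c : ℝ, ENNReal.ofReal (c ^ 2) = ‖c‖ₑ ^ (2 : ℝ) := by
    intro c
    rw [ENNReal.rpow_two, ← sq_abs, ENNReal.ofReal_pow (abs_nonneg _), Real.enorm_eq_ofReal_abs]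
  have key : ∫⁻ z, ENNReal.ofReal (lsNorm s (H z)) ^ q ∂(ν.prod Q)
      ≤ ∫⁻ t, (‖a t‖ₑ ^ (2 : ℝ) + 1 * ‖b t‖ₑ ^ (2 : ℝ)) ^ (q / 2) ∂ν := by
    rw [lintegral_prod _ hmeas.aemeasurable]
    refine lintegral_mono fun t => ?_
    have := e' Q (fun x => H (t, x))
    dsimp only
    rw [this, one_mul, ← hsq, ← hsq, ← ENNReal.ofReal_add (sq_nonneg _) (sq_nonneg _)]
    exact ENNReal.rpow_le_rpow (h t) (by positivity)
  have h2 := (ENNReal.rpow_le_rpow key (by positivity : 0 ≤ 2 / q)).trans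
    (lintegral_sq_add_le ν hq ha.enorm hb.enorm 1)
  rw [e, e]
  rw [one_mul] at h2
  refine le_trans (le_of_eq ?_) h2
  rw [lsMoment_eq_lintegral hq0, ← ENNReal.rpow_two, ← ENNReal.rpow_mul]
  congr 1; field_simp

lemma lsMoment_prod_le {ν : Measure T} [SFinite ν] {Q : Measure Ξ} [SFinite Q] (hs : s ≠ 0)
    (hq : 2 ≤ q) {H : T × Ξ → Fin d → ℝ} (hH : Measurable H) {a : T → ℝ}
    (ha : AEMeasurable a ν)
    (h : ∀ t, lsMoment s q Q (fun x => H (t, x)) ≤ ENNReal.ofReal (a t)) :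
    lsMoment s q (ν.prod Q) H ≤ eLpNorm a (ENNReal.ofReal q) ν := by
  have := lsMoment_prod_sq_le (b := fun _ => 0) hs hq hH ha aemeasurable_const (fun t => by
    refine (pow_le_pow_left' (h t) 2).trans ?_
    rcases le_total 0 (a t) with h0 | h0
    · rw [← ENNReal.ofReal_pow h0]; simp
    · rw [ENNReal.ofReal_of_nonpos h0]; simp)
  simp only [eLpNorm_zero', ne_eq, OfNat.ofNat_ne_zero, not_false_eq_true, zero_pow, add_zero]
    at this
  exact (ENNReal.pow_le_pow_left_iff two_ne_zero).1 this

end Product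

section Sequence

variable {T Ξ Ω : Type*} [MeasurableSpace T] [MeasurableSpace Ξ] [MeasurableSpace Ω]

/-- Splitting off the first coordinate of an i.i.d. sequence. -/
lemma infinitePi_map_tail_head (Q : Measure Ξ) [IsProbabilityMeasure Q] :
    (Measure.infinitePi fun _ : ℕ => Q).map (fun ω => ((fun n => ω (n + 1)), ω 0))
      = (Measure.infinitePi fun _ : ℕ => Q).prod Q := by
  have hm1 : Measurable fun ω : ℕ → Ξ => ((fun n => ω (n + 1)), ω 0) := by fun_prop
  -- the inverse map, which prepends a coordinate
  let cons : (ℕ → Ξ) × Ξ → ℕ → Ξ := fun p n => Nat.casesOn n p.2 fun k => p.1 k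
  have hc : Measurable cons := by
    refine measurable_pi_lambda _ fun n => ?_
    cases n with
    | zero => exact measurable_snd
    | succ k => exact (measurable_pi_apply k).comp measurable_fst
  have hcons : ((Measure.infinitePi fun _ : ℕ => Q).prod Q).map cons
      = Measure.infinitePi fun _ : ℕ => Q := by
    refine Measure.eq_infinitePi _ fun S t ht => ?_
    classical
    have hinj : Set.InjOn (fun n : ℕ => n + 1) ((fun n : ℕ => n + 1) ⁻¹' (S : Set ℕ)) :=
      fun a _ b _ h => by simpa using h
    have hpre : cons ⁻¹' (Set.pi S t) =
        (Set.pi (S.preimage (fun n : ℕ => n + 1) hinj) fun n => t (n + 1)) ×ˢ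
          (if 0 ∈ S then t 0 else Set.univ) := by
      ext ⟨ω, x⟩
      simp only [Set.mem_preimage, Set.mem_pi, Set.mem_prod, Finset.mem_coe, Finset.mem_preimage]
      constructor
      · intro h
        refine ⟨fun n hn => h (n + 1) hn, ?_⟩
        split_ifs with h0
        · exact h 0 h0
        · trivial
      · rintro ⟨h1, h2⟩ n hn
        cases n with
        | zero => rw [if_pos hn] at h2; exact h2
        | succ k => exact h1 k hn
    rw [Measure.map_apply hc (MeasurableSet.pi S.countable_toSet fun i _ => ht i), hpre,
      Measure.prod_prod, Measure.infinitePi_pi _ fun i _ => ht (i + 1)]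
    have hprod : ∏ i ∈ S.preimage (fun n : ℕ => n + 1) hinj, Q (t (i + 1))
        = ∏ i ∈ S.erase 0, Q (t i) := by
      refine Finset.prod_bij (fun n _ => n + 1) ?_ ?_ ?_ ?_
      · intro n hn; simpa using hn
      · intro a _ b _ h; simpa using h
      · intro b hb
        rw [Finset.mem_erase] at hb
        obtain ⟨k, rfl⟩ := Nat.exists_eq_succ_of_ne_zero hb.1
        exact ⟨k, by simpa using hb.2, rfl⟩
      · intro n _; rfl
    rw [hprod]
    split_ifs with h0
    · rw [mul_comm, Finset.mul_prod_erase S (fun i => Q (t i)) h0]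
    · rw [measure_univ, mul_one, Finset.erase_eq_of_notMem h0]
  conv_lhs => rw [← hcons]
  rw [Measure.map_map hm1 hc]
  exact Measure.map_id

/-- Along a recursion `p (n+1) = Φ n (p n, ξ n)` driven by i.i.d. samples, the current state stays
independent of all future samples. -/
lemma map_recursion_prod {P : Measure Ω} [IsProbabilityMeasure P] {Q : Measure Ξ}
    [IsProbabilityMeasure Q] {ξ : ℕ → Ω → Ξ} (hξ : ∀ n, Measurable (ξ n))
    {Φ : ℕ → T × Ξ → T} (hΦ : ∀ n, Measurable (Φ n)) {p : ℕ → Ω → T} (hp0 : Measurable (p 0))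
    (hp : ∀ n ω, p (n + 1) ω = Φ n (p n ω, ξ n ω))
    (h0 : P.map (fun ω => (p 0 ω, fun k => ξ k ω))
      = (P.map (p 0)).prod (Measure.infinitePi fun _ : ℕ => Q)) (n : ℕ) :
    Measurable (p n) ∧ P.map (fun ω => (p n ω, fun k => ξ (k + n) ω))
      = (P.map (p n)).prod (Measure.infinitePi fun _ : ℕ => Q) := by
  induction n with
  | zero => exact ⟨hp0, h0⟩
  | succ n ih =>
    obtain ⟨hm, ih⟩ := ih
    have hpe : p (n + 1) = fun ω => Φ n (p n ω, ξ n ω) := funext (hp n)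
    have hm' : Measurable (p (n + 1)) := by
      rw [hpe]; exact (hΦ n).comp (hm.prodMk (hξ n))
    refine ⟨hm', ?_⟩
    have : IsProbabilityMeasure (P.map (p n)) := Measure.isProbabilityMeasure_map hm.aemeasurable
    have htl : Measurable fun ω : ℕ → Ξ => ((fun n => ω (n + 1)), ω 0) := by fun_prop
    have hbig : Measurable fun ω => (p n ω, fun k => ξ (k + n) ω) :=
      hm.prodMk (measurable_pi_lambda _ fun k => hξ _)
    -- separate the head of the sample sequence from its tail
    have h1 : P.map (fun ω => (p n ω, ((fun k => ξ (k + (n + 1)) ω), ξ n ω)))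
        = (P.map (p n)).prod ((Measure.infinitePi fun _ : ℕ => Q).prod Q) := by
      rw [← infinitePi_map_tail_head Q]
      conv_rhs => rw [← Measure.map_id (μ := P.map (p n))]
      rw [Measure.map_prod_map _ _ measurable_id htl, ← ih,
        Measure.map_map (measurable_id.prodMap htl) hbig]
      congr 1
      funext ω
      simp [Prod.map, add_assoc, add_comm 1 n]
    set R : T × ((ℕ → Ξ) × Ξ) → T × (ℕ → Ξ) := fun z => (Φ n (z.1, z.2.2), z.2.1) with hR
    have hRm : Measurable R := ((hΦ n).comp (by fun_prop)).prodMk (by fun_prop)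
    have h2 : P.map (fun ω => (p (n + 1) ω, fun k => ξ (k + (n + 1)) ω))
        = ((P.map (p n)).prod ((Measure.infinitePi fun _ : ℕ => Q).prod Q)).map R := by
      rw [← h1, Measure.map_map hRm (hm.prodMk ((measurable_pi_lambda _ fun k => hξ _).prodMk
        (hξ n)))]
      congr 1
      funext ω
      simp [hR, hp]
    have h3 : ((P.map (p n)).prod ((Measure.infinitePi fun _ : ℕ => Q).prod Q)).map R
        = (((P.map (p n)).prod Q).map (Φ n)).prod (Measure.infinitePi fun _ : ℕ => Q) := by
      have hsw : (P.map (p n)).prod ((Measure.infinitePi fun _ : ℕ => Q).prod Q)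
          = (((P.map (p n)).prod Q).prod (Measure.infinitePi fun _ : ℕ => Q)).map
            (Prod.map id Prod.swap ∘ MeasurableEquiv.prodAssoc) := by
        rw [← Measure.map_map (measurable_id.prodMap measurable_swap)
          (MeasurableEquiv.measurable _), Measure.prodAssoc_prod,
          ← Measure.map_prod_map _ _ measurable_id measurable_swap, Measure.map_id,
          Measure.prod_swap]
      conv_rhs => rw [← Measure.map_id (μ := Measure.infinitePi fun _ : ℕ => Q)]
      rw [Measure.map_prod_map _ _ (hΦ n) measurable_id, hsw, Measure.map_map hRm
        ((measurable_id.prodMap measurable_swap).comp (MeasurableEquiv.measurable _))]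
      rfl
    rw [h2, h3]
    congr 1
    have h4 : P.map (fun ω => (p n ω, ξ n ω)) = (P.map (p n)).prod Q := by
      have := congrArg (fun M => M.map (Prod.map id Prod.snd)) h1
      beta_reduce at this
      rw [Measure.map_map (by fun_prop) (hm.prodMk ((measurable_pi_lambda _ fun k => hξ _).prodMk
        (hξ n))), ← Measure.map_prod_map _ _ measurable_id measurable_snd, Measure.map_id,
        Measure.map_snd_prod, measure_univ, one_smul] at this
      exact this
    rw [← h4, Measure.map_map (hΦ n) (hm.prodMk (hξ n)), hpe]
    rfl

lemma map_recursion_prod_single {P : Measure Ω} [IsProbabilityMeasure P] {Q : Measure Ξ}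
    [IsProbabilityMeasure Q] {ξ : ℕ → Ω → Ξ} (hξ : ∀ n, Measurable (ξ n))
    {Φ : ℕ → T × Ξ → T} (hΦ : ∀ n, Measurable (Φ n)) {p : ℕ → Ω → T} (hp0 : Measurable (p 0))
    (hp : ∀ n ω, p (n + 1) ω = Φ n (p n ω, ξ n ω))
    (h0 : P.map (fun ω => (p 0 ω, fun k => ξ k ω))
      = (P.map (p 0)).prod (Measure.infinitePi fun _ : ℕ => Q)) (n : ℕ) :
    Measurable (p n) ∧ P.map (fun ω => (p n ω, ξ n ω)) = (P.map (p n)).prod Q := by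
  obtain ⟨hm, h⟩ := map_recursion_prod hξ hΦ hp0 hp h0 n
  have : IsProbabilityMeasure (P.map (p n)) := Measure.isProbabilityMeasure_map hm.aemeasurable
  refine ⟨hm, ?_⟩
  have h1 := congrArg (fun M => M.map (Prod.map id fun ω : ℕ → Ξ => ω 0)) h
  beta_reduce at h1
  rw [Measure.map_map (by fun_prop) (hm.prodMk (measurable_pi_lambda _ fun k => hξ _)),
    ← Measure.map_prod_map _ _ measurable_id (measurable_pi_apply 0), Measure.map_id,
    Measure.infinitePi_map_eval] at h1
  rw [← h1]
  congr 1
  funext ω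
  simp

lemma map_prodMk_infinitePi {P : Measure Ω} [IsProbabilityMeasure P] {Q : Measure Ξ}
    {ξ : ℕ → Ω → Ξ} (hξ : ∀ n, Measurable (ξ n)) (hlaw : ∀ n, P.map (ξ n) = Q)
    (hind : iIndepFun ξ P) {X : Ω → T} (hX : Measurable X)
    (hXξ : IndepFun X (fun ω n => ξ n ω) P) :
    P.map (fun ω => (X ω, fun k => ξ k ω))
      = (P.map X).prod (Measure.infinitePi fun _ : ℕ => Q) := by
  rw [(indepFun_iff_map_prod_eq_prod_map_map hX.aemeasurable
    (measurable_pi_lambda _ fun n => hξ n).aemeasurable).1 hXξ,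
    hind.map_fun_eq_infinitePi_map hξ]
  simp_rw [hlaw]

end Sequence

/-! ### Stationary laws of contracting random maps -/

section Stationary

variable {T Ξ : Type*} [MeasurableSpace T] [MeasurableSpace Ξ] {d s : ℕ} {q κ : ℝ}
  {Q : Measure Ξ} {F : (Fin d → ℝ) × Ξ → Fin d → ℝ}

/-- A random map that contracts the `‖ |·|_s ‖_q` distance between deterministic points also
contracts the distance between random points that are independent of the map. -/
lemma lsMoment_map_sub_le [SFinite Q] (hs : 1 ≤ s) (hq : 2 ≤ q) (hF : Measurable F)
    (hκ0 : 0 ≤ κ) (hκ : ∀ b b', lsMoment s q Q (fun x => F (b, x) - F (b', x))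
      ≤ ENNReal.ofReal (κ * lsNorm s (b - b')))
    {ν : Measure T} [SFinite ν] {U V : T → Fin d → ℝ} (hU : Measurable U) (hV : Measurable V) :
    lsMoment s q (ν.prod Q) (fun z => F (U z.1, z.2) - F (V z.1, z.2))
      ≤ ENNReal.ofReal κ * lsMoment s q ν (fun t => U t - V t) := by
  have hs0 : s ≠ 0 := by omega
  refine (lsMoment_prod_le (H := fun z : T × Ξ => F (U z.1, z.2) - F (V z.1, z.2))
    (a := fun t => κ * lsNorm s (U t - V t)) hs0 hq ?_ ?_ ?_).trans (le_of_eq ?_)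
  · have h1 : Measurable fun z : T × Ξ => (U z.1, z.2) :=
      (hU.comp measurable_fst).prodMk measurable_snd
    have h2 : Measurable fun z : T × Ξ => (V z.1, z.2) :=
      (hV.comp measurable_fst).prodMk measurable_snd
    exact (hF.comp h1).sub (hF.comp h2)
  · exact (aemeasurable_lsNorm (f := fun t => U t - V t) hs0 (hU.sub hV).aemeasurable).const_mul κ
  · exact fun t => hκ (U t) (V t)
  · rw [lsMoment, ← Real.enorm_of_nonneg hκ0, ← eLpNorm_const_smul]
    rfl

/-- Existence of a stationary law: the backward iterates of the random map form an almost surely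
convergent sequence, whose limit has a stationary law. -/
theorem exists_stationary [IsProbabilityMeasure Q] (hs : 1 ≤ s) (hq : 2 ≤ q) (hF : Measurable F)
    (hFc : ∀ x, Continuous fun b => F (b, x)) (hκ0 : 0 ≤ κ) (hκ1 : κ < 1)
    (hκ : ∀ b b', lsMoment s q Q (fun x => F (b, x) - F (b', x))
      ≤ ENNReal.ofReal (κ * lsNorm s (b - b')))
    (b₀ : Fin d → ℝ) (hb₀ : lsMoment s q Q (fun x => F (b₀, x) - b₀) < ⊤) :
    ∃ π : Measure (Fin d → ℝ), IsProbabilityMeasure π ∧ (π.prod Q).map F = π ∧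
      lsMoment s q π (fun u => u) < ⊤ := by
  have hs0 : s ≠ 0 := by omega
  have hq0 : 0 < q := by linarith
  have hq1 : 1 ≤ q := by linarith
  set I := Measure.infinitePi fun _ : ℕ => Q
  have htl : Measurable fun ω : ℕ → Ξ => ((fun n => ω (n + 1)), ω 0) := by fun_prop
  have hHT := infinitePi_map_tail_head Q
  let Z : ℕ → (ℕ → Ξ) → Fin d → ℝ := fun n => Nat.rec (fun _ => b₀)
    (fun _ z ω => F (z (fun k => ω (k + 1)), ω 0)) n
  have Zs : ∀ n ω, Z (n + 1) ω = F (Z n (fun k => ω (k + 1)), ω 0) := fun _ _ => rfl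
  have Zm : ∀ n, Measurable (Z n) := by
    intro n
    induction n with
    | zero => exact measurable_const
    | succ n ih => exact hF.comp ((ih.comp (by fun_prop)).prodMk (by fun_prop))
  have Zd : ∀ n, Measurable fun ω => Z (n + 1) ω - Z n ω := fun n => (Zm (n + 1)).sub (Zm n)
  set D : ℕ → ℝ≥0∞ := fun n => lsMoment s q I (fun ω => Z (n + 1) ω - Z n ω) with hD
  -- transport of moments along the head-tail decomposition
  have trans : ∀ {H : (ℕ → Ξ) × Ξ → Fin d → ℝ}, Measurable H →
      lsMoment s q I (fun ω => H ((fun k => ω (k + 1)), ω 0)) = lsMoment s q (I.prod Q) H := by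
    intro H hH
    rw [← hHT, lsMoment_map htl.aemeasurable hs0 hH]
  have hD0 : D 0 < ⊤ := by
    refine lt_of_le_of_lt (le_of_eq ?_) hb₀
    have hm : Measurable fun x => F (b₀, x) - b₀ := (hF.comp (by fun_prop)).sub_const _
    have := lsMoment_map (P := I) (X := fun ω : ℕ → Ξ => ω 0) (s := s) (q := q)
      (measurable_pi_apply 0).aemeasurable hs0 hm
    rw [Measure.infinitePi_map_eval] at this
    rw [this]
    rfl
  have hDs : ∀ n, D (n + 1) ≤ ENNReal.ofReal κ * D n := by
    intro n
    have := lsMoment_map_sub_le (ν := I) hs hq hF hκ0 hκ (Zm (n + 1)) (Zm n)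
    refine le_trans (le_of_eq ?_) this
    refine trans (H := fun z => F (Z (n + 1) z.1, z.2) - F (Z n z.1, z.2)) ?_
    have h1 : ∀ n, Measurable fun z : (ℕ → Ξ) × Ξ => F (Z n z.1, z.2) := fun n =>
      hF.comp (((Zm n).comp measurable_fst).prodMk measurable_snd)
    exact (h1 (n + 1)).sub (h1 n)
  have hDn : ∀ n, D n ≤ ENNReal.ofReal κ ^ n * D 0 := by
    intro n
    induction n with
    | zero => simp
    | succ n ih =>
      refine (hDs n).trans ((mul_le_mul_right ih _).trans (le_of_eq ?_))
      rw [pow_succ]; ring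
  have hκ1' : ENNReal.ofReal κ < 1 := by simpa using hκ1
  have hsum : ∑' n, D n < ⊤ := by
    refine (ENNReal.tsum_le_tsum hDn).trans_lt ?_
    rw [ENNReal.tsum_mul_right, ENNReal.tsum_geometric]
    refine ENNReal.mul_lt_top (ENNReal.inv_lt_top.2 ?_) hD0
    exact tsub_pos_of_lt hκ1'
  have hae : ∀ᵐ ω ∂I, ∃ l, Tendsto (fun n => Z n ω) atTop (𝓝 l) := by
    have h1 : ∫⁻ ω, ∑' n, ‖Z (n + 1) ω - Z n ω‖ₑ ∂I ≤ ∑' n, D n := by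
      rw [lintegral_tsum fun n => (Zd n).enorm.aemeasurable]
      exact ENNReal.tsum_le_tsum fun n =>
        lintegral_enorm_le_lsMoment hs0 hq1 (Zd n).aemeasurable
    have h2 := ae_lt_top (Measurable.tsum fun n => (Zd n).enorm)
      (h1.trans_lt hsum).ne
    filter_upwards [h2] with ω hω
    refine cauchySeq_tendsto_of_complete (cauchySeq_of_edist_le_of_tsum_ne_top _ (fun n => ?_)
      hω.ne)
    rw [edist_comm, edist_eq_enorm_sub]
  obtain ⟨W, hWm, hW⟩ := measurable_limit_of_tendsto_metrizable_ae
    (fun n => (Zm n).aemeasurable) hae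
  refine ⟨I.map W, Measure.isProbabilityMeasure_map hWm.aemeasurable, ?_, ?_⟩
  · have hWtail : ∀ᵐ ω ∂I, Tendsto (fun n => Z n (fun k => ω (k + 1))) atTop
        (𝓝 (W fun k => ω (k + 1))) := by
      have hmp : I.map (fun ω (n : ℕ) => ω (n + 1)) = I := by
        have := congrArg (fun M => M.map Prod.fst) hHT
        beta_reduce at this
        rw [Measure.map_map measurable_fst htl, Measure.map_fst_prod, measure_univ,
          one_smul] at this
        exact this
      have hq' : Measure.QuasiMeasurePreserving (fun (ω : ℕ → Ξ) (n : ℕ) => ω (n + 1)) I I :=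
        ⟨by fun_prop, by rw [hmp]⟩
      exact hq'.ae hW
    have hfix : (fun ω => F (W (fun k => ω (k + 1)), ω 0)) =ᵐ[I] W := by
      filter_upwards [hW, hWtail] with ω h1 h2
      have h3 := ((hFc (ω 0)).tendsto _).comp h2
      exact tendsto_nhds_unique h3 ((tendsto_add_atTop_iff_nat 1).2 h1)
    have h4 : (I.map W).prod Q = (I.prod Q).map (Prod.map W id) := by
      rw [← Measure.map_prod_map _ _ hWm measurable_id, Measure.map_id]
    rw [h4, ← hHT, Measure.map_map (hWm.prodMap measurable_id) htl,
      Measure.map_map hF ((hWm.prodMap measurable_id).comp htl), ← Measure.map_congr hfix]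
    rfl
  · rw [lsMoment_map hWm.aemeasurable hs0 measurable_id']
    have hZb : ∀ n, lsMoment s q I (Z n) ≤ ENNReal.ofReal (lsNorm s b₀) + ∑' n, D n := by
      intro n
      have : lsMoment s q I (Z n) ≤ ENNReal.ofReal (lsNorm s b₀) + ∑ k ∈ Finset.range n, D k := by
        induction n with
        | zero =>
          simp only [Finset.range_zero, Finset.sum_empty, add_zero]
          exact (lsMoment_const hq0 b₀).le
        | succ n ih =>
          rw [Finset.sum_range_succ, ← add_assoc]
          refine le_trans ?_ (add_le_add_left ih _)
          have := lsMoment_add_le (P := I) hs hq1 (Zm n).aemeasurable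
            (Zd n).aemeasurable
          simpa only [add_sub_cancel] using this
      exact this.trans (add_le_add_right (ENNReal.sum_le_tsum _) _)
    refine lt_of_le_of_lt (Lp.eLpNorm_le_of_ae_tendsto (u := atTop)
      (f := fun n ω => lsNorm s (Z n ω)) (Eventually.of_forall hZb)
      (fun n => aestronglyMeasurable_lsNorm hs0 (Zm n).aemeasurable) ?_)
      (ENNReal.add_lt_top.2 ⟨ENNReal.ofReal_lt_top, hsum⟩)
    filter_upwards [hW] with ω hω
    exact ((continuous_lsNorm hs0).tendsto _).comp hω

/-- Two stationary laws with finite moments agree: synchronous coupling brings copies started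
from them arbitrarily close. -/
theorem stationary_unique [IsProbabilityMeasure Q] (hs : 1 ≤ s) (hq : 2 ≤ q) (hF : Measurable F)
    (hκ0 : 0 ≤ κ) (hκ1 : κ < 1)
    (hκ : ∀ b b', lsMoment s q Q (fun x => F (b, x) - F (b', x))
      ≤ ENNReal.ofReal (κ * lsNorm s (b - b')))
    {π π' : Measure (Fin d → ℝ)} [IsProbabilityMeasure π] [IsProbabilityMeasure π']
    (hπ : (π.prod Q).map F = π) (hπ' : (π'.prod Q).map F = π')
    (hm : lsMoment s q π (fun u => u) < ⊤) (hm' : lsMoment s q π' (fun u => u) < ⊤) :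
    π = π' := by
  have hs0 : s ≠ 0 := by omega
  have hq1 : 1 ≤ q := by linarith
  set Φ : ((Fin d → ℝ) × (Fin d → ℝ)) × Ξ → (Fin d → ℝ) × (Fin d → ℝ) :=
    fun z => (F (z.1.1, z.2), F (z.1.2, z.2)) with hΦ
  have hΦm : Measurable Φ := (hF.comp (by fun_prop)).prodMk (hF.comp (by fun_prop))
  have hdm : Measurable fun z : (Fin d → ℝ) × (Fin d → ℝ) => z.1 - z.2 := by fun_prop
  -- couplings of `π` and `π'` at arbitrarily small distance
  have key : ∀ n : ℕ, ∃ γ : Measure ((Fin d → ℝ) × (Fin d → ℝ)), IsProbabilityMeasure γ ∧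
      γ.map Prod.fst = π ∧ γ.map Prod.snd = π' ∧
      lsMoment s q γ (fun z => z.1 - z.2)
        ≤ ENNReal.ofReal κ ^ n * lsMoment s q (π.prod π') (fun z => z.1 - z.2) := by
    intro n
    induction n with
    | zero =>
      refine ⟨π.prod π', inferInstance, ?_, ?_, by simp⟩
      · rw [Measure.map_fst_prod, measure_univ, one_smul]
      · rw [Measure.map_snd_prod, measure_univ, one_smul]
    | succ n ih =>
      obtain ⟨γ, hγ, h1, h2, h3⟩ := ih
      refine ⟨(γ.prod Q).map Φ, Measure.isProbabilityMeasure_map hΦm.aemeasurable, ?_, ?_, ?_⟩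
      · rw [Measure.map_map measurable_fst hΦm]
        have : Prod.fst ∘ Φ = F ∘ Prod.map Prod.fst id := rfl
        rw [this, ← Measure.map_map hF (by fun_prop),
          ← Measure.map_prod_map _ _ measurable_fst measurable_id, h1, Measure.map_id, hπ]
      · rw [Measure.map_map measurable_snd hΦm]
        have : Prod.snd ∘ Φ = F ∘ Prod.map Prod.snd id := rfl
        rw [this, ← Measure.map_map hF (by fun_prop),
          ← Measure.map_prod_map _ _ measurable_snd measurable_id, h2, Measure.map_id, hπ']
      · rw [lsMoment_map hΦm.aemeasurable hs0 hdm]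
        refine (lsMoment_map_sub_le (ν := γ) hs hq hF hκ0 hκ measurable_fst measurable_snd).trans ?_
        rw [pow_succ', mul_assoc]
        exact mul_le_mul_right h3 _
  have hΔ : lsMoment s q (π.prod π') (fun z => z.1 - z.2) < ⊤ := by
    refine (lsMoment_sub_le hs hq1 measurable_fst.aemeasurable measurable_snd.aemeasurable).trans_lt
      (ENNReal.add_lt_top.2 ⟨?_, ?_⟩)
    · have := lsMoment_map (P := π.prod π') (s := s) (q := q) measurable_fst.aemeasurable hs0
        (measurable_id' (α := Fin d → ℝ))
      rw [Measure.map_fst_prod, measure_univ, one_smul] at this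
      exact this ▸ hm
    · have := lsMoment_map (P := π.prod π') (s := s) (q := q) measurable_snd.aemeasurable hs0
        (measurable_id' (α := Fin d → ℝ))
      rw [Measure.map_snd_prod, measure_univ, one_smul] at this
      exact this ▸ hm'
  have hlim : Tendsto (fun n : ℕ => ENNReal.ofReal κ ^ n
      * lsMoment s q (π.prod π') (fun z => z.1 - z.2)) atTop (𝓝 0) := by
    have := ENNReal.Tendsto.mul_const (ENNReal.tendsto_pow_atTop_nhds_zero_of_lt_one
      (by simpa using hκ1 : ENNReal.ofReal κ < 1)) (Or.inr hΔ.ne)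
    simpa using this
  have hLP : levyProkhorovEDist π π' = 0 := by
    refine le_antisymm (levyProkhorovEDist_le_of_forall_le π π' 0 fun ε B hε hεt hB => ?_) zero_le
    obtain ⟨n, hn⟩ := (hlim.eventually_lt_const (ENNReal.mul_pos hε.ne' hε.ne')).exists
    obtain ⟨γ, hγ, h1, h2, h3⟩ := key n
    have hfar : γ {z | ε ≤ ‖z.1 - z.2‖ₑ} ≤ ε := by
      have hM := mul_meas_ge_le_lintegral₀ (μ := γ) hdm.enorm.aemeasurable ε
      have h4 : ε * γ {z | ε ≤ ‖z.1 - z.2‖ₑ} ≤ ε * ε :=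
        hM.trans ((lintegral_enorm_le_lsMoment hs0 hq1 hdm.aemeasurable).trans (h3.trans hn.le))
      exact (ENNReal.mul_le_mul_iff_right hε.ne' hεt.ne).1 h4
    have hth : MeasurableSet (Metric.thickening ε.toReal B) :=
      Metric.isOpen_thickening.measurableSet
    calc π B = γ (Prod.fst ⁻¹' B) := by rw [← h1, Measure.map_apply measurable_fst hB]
      _ ≤ γ (Prod.snd ⁻¹' (Metric.thickening ε.toReal B) ∪ {z | ε ≤ ‖z.1 - z.2‖ₑ}) := by
          refine measure_mono fun z hz => ?_
          by_cases hc : ε ≤ ‖z.1 - z.2‖ₑ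
          · exact Or.inr hc
          · refine Or.inl (Metric.mem_thickening_iff.2 ⟨z.1, hz, ?_⟩)
            rw [not_le] at hc
            rw [dist_comm, dist_eq_norm, ← toReal_enorm]
            exact (ENNReal.toReal_lt_toReal (by simp) hεt.ne).2 hc
      _ ≤ γ (Prod.snd ⁻¹' (Metric.thickening ε.toReal B)) + γ {z | ε ≤ ‖z.1 - z.2‖ₑ} :=
          measure_union_le _ _
      _ ≤ π' (Metric.thickening ε.toReal B) + ε := by
          rw [← h2, Measure.map_apply measurable_snd hth]
          gcongr
  refine ext_of_generate_finite _ (BorelSpace.measurable_eq.trans borel_eq_generateFrom_isClosed)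
    isPiSystem_isClosed (fun A hA => ?_) (by simp)
  exact measure_eq_measure_of_levyProkhorovEDist_eq_zero_of_isClosed hLP hA
    ⟨1, one_pos, measure_ne_top _ _⟩ ⟨1, one_pos, measure_ne_top _ _⟩

end Stationary

/-! ### The stochastic gradient -/

section Gradient

variable {d s : ℕ} {q μ L : ℝ} {Ξ : Type*} [MeasurableSpace Ξ]

lemma TwiceDifferentiable.continuous_grad {f : (Fin d → ℝ) → ℝ} (h : TwiceDifferentiable f) :
    Continuous (grad f) :=
  continuous_pi fun i => (h.2 i).continuous

/-- The probabilistic part of the assumptions: regularity of the noisy loss, and stochastic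
Lipschitz continuity of its gradient with a finite moment at the reference point `βstar`. -/
structure NoisyLoss (s : ℕ) (q L : ℝ) (g : (Fin d → ℝ) → Ξ → ℝ) (Q : Measure Ξ)
    (βstar : Fin d → ℝ) : Prop where
  two_le_s : 2 ≤ s
  two_le_q : 2 ≤ q
  L_nonneg : 0 ≤ L
  meas : ∀ β, Measurable (g β)
  integrable : ∀ β, Integrable (g β) Q
  moment : gradMoment s q g Q βstar < ⊤
  lip : StochLipschitz s q L g Q
  twice : ∀ x, TwiceDifferentiable fun β => g β x

variable {g : (Fin d → ℝ) → Ξ → ℝ} {Q : Measure Ξ} {βstar : Fin d → ℝ}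

lemma hasDerivAt_line {f : (Fin d → ℝ) → ℝ} {β v : Fin d → ℝ} {t : ℝ}
    (hf : DifferentiableAt ℝ f (β + t • v)) :
    HasDerivAt (fun t : ℝ => f (β + t • v)) (fderiv ℝ f (β + t • v) v) t := by
  have h1 : HasDerivAt (fun t : ℝ => β + t • v) v t := by
    simpa using ((hasDerivAt_id t).smul_const v).const_add β
  exact hf.hasFDerivAt.comp_hasDerivAt t h1

namespace NoisyLoss

variable (h : NoisyLoss s q L g Q βstar)
include h

lemma measurable_stochGrad (β : Fin d → ℝ) : Measurable (stochGrad g β) := by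
  refine measurable_pi_lambda _ fun i => ?_
  -- the partial derivative is a pointwise limit of measurable difference quotients
  set e : Fin d → ℝ := Pi.single i 1
  have hlim : ∀ x, Tendsto (fun n : ℕ => ((n : ℝ) + 1) * (g (β + ((n : ℝ) + 1)⁻¹ • e) x - g β x))
      atTop (𝓝 (stochGrad g β x i)) := by
    intro x
    have h1 : HasDerivAt (fun t : ℝ => g (β + t • e) x) (stochGrad g β x i) 0 := by
      have := hasDerivAt_line (f := fun β => g β x) (β := β) (v := e) (t := 0)
        ((h.twice x).1 _)
      simpa [stochGrad, grad, pderiv, e] using this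
    have h2 := h1.tendsto_slope_zero
    have h3 : Tendsto (fun n : ℕ => ((n : ℝ) + 1)⁻¹) atTop (𝓝[≠] 0) := by
      refine tendsto_nhdsWithin_iff.2 ⟨?_, Eventually.of_forall fun n => ?_⟩
      · simpa using tendsto_one_div_add_atTop_nhds_zero_nat (𝕜 := ℝ)
      · simp only [Set.mem_compl_iff, Set.mem_singleton_iff]; positivity
    refine (h2.comp h3).congr fun n => ?_
    simp
  refine measurable_of_tendsto_metrizable (f := fun (n : ℕ) x =>
    ((n : ℝ) + 1) * (g (β + ((n : ℝ) + 1)⁻¹ • e) x - g β x)) (fun n => ?_)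
    (tendsto_pi_nhds.2 hlim)
  exact ((h.meas _).sub (h.meas _)).const_mul _

lemma continuous_stochGrad (x : Ξ) : Continuous fun β => stochGrad g β x :=
  (h.twice x).continuous_grad

lemma measurable_uncurry_stochGrad :
    Measurable fun p : (Fin d → ℝ) × Ξ => stochGrad g p.1 p.2 :=
  measurable_uncurry_of_continuous_of_measurable h.continuous_stochGrad h.measurable_stochGrad

lemma lsMoment_stochGrad_sub_le (β β' : Fin d → ℝ) :
    lsMoment s q Q (fun x => stochGrad g β x - stochGrad g β' x)
      ≤ ENNReal.ofReal (L * lsNorm s (β - β')) := h.lip β β'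

lemma lsMoment_stochGrad_le (β : Fin d → ℝ) :
    lsMoment s q Q (stochGrad g β)
      ≤ ENNReal.ofReal ((gradMoment s q g Q βstar).toReal + L * lsNorm s (β - βstar)) := by
  have hs1 : 1 ≤ s := by have := h.two_le_s; omega
  have h1 := lsMoment_add_le (P := Q) (s := s) (q := q) hs1 (by linarith [h.two_le_q])
    (h.measurable_stochGrad βstar).aemeasurable
    ((h.measurable_stochGrad β).sub (h.measurable_stochGrad βstar)).aemeasurable
  simp only [Pi.sub_apply, add_sub_cancel] at h1
  rw [ENNReal.ofReal_add ENNReal.toReal_nonneg (mul_nonneg h.L_nonneg (lsNorm_nonneg _ _)),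
    ENNReal.ofReal_toReal h.moment.ne]
  exact h1.trans (add_le_add_right (h.lsMoment_stochGrad_sub_le β βstar) _)

variable [IsProbabilityMeasure Q]

lemma integrable_stochGrad (β : Fin d → ℝ) : Integrable (stochGrad g β) Q :=
  integrable_of_lsMoment (by have := h.two_le_s; omega) (by linarith [h.two_le_q])
    (h.measurable_stochGrad β).aemeasurable
    ((h.lsMoment_stochGrad_le β).trans_lt ENNReal.ofReal_lt_top)

lemma lsNorm_integral_sub_le (β β' : Fin d → ℝ) :
    lsNorm s ((∫ x, stochGrad g β x ∂Q) - ∫ x, stochGrad g β' x ∂Q)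
      ≤ L * lsNorm s (β - β') := by
  rw [← integral_sub (h.integrable_stochGrad β) (h.integrable_stochGrad β')]
  have h1 := lsNorm_integral_le_lsMoment (P := Q) (s := s) (q := q)
    (by have := h.two_le_s; omega) (by linarith [h.two_le_q])
    ((h.measurable_stochGrad β).sub (h.measurable_stochGrad β')).aemeasurable
  refine (ENNReal.ofReal_le_ofReal_iff (mul_nonneg h.L_nonneg (lsNorm_nonneg _ _))).1 ?_
  exact h1.trans (h.lsMoment_stochGrad_sub_le β β')

lemma integral_norm_stochGrad_le (β : Fin d → ℝ) :
    ∫ x, ‖stochGrad g β x‖ ∂Q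
      ≤ (gradMoment s q g Q βstar).toReal + L * lsNorm s (β - βstar) := by
  have h0 : 0 ≤ (gradMoment s q g Q βstar).toReal + L * lsNorm s (β - βstar) :=
    add_nonneg ENNReal.toReal_nonneg (mul_nonneg h.L_nonneg (lsNorm_nonneg _ _))
  rw [integral_norm_eq_lintegral_enorm (h.integrable_stochGrad β).aestronglyMeasurable]
  exact ENNReal.toReal_le_of_le_ofReal h0 ((lintegral_enorm_le_lsMoment
    (by have := h.two_le_s; omega) (by linarith [h.two_le_q])
    (h.measurable_stochGrad β).aemeasurable).trans (h.lsMoment_stochGrad_le β))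

/-- Differentiation under the expectation: `∇G(β) = E ∇g(β, ξ)`. The increments of `G` along a
coordinate direction are integrals of `E ∂_i g` by the fundamental theorem of calculus and Fubini,
and `E ∂_i g` is continuous. -/
theorem grad_loss (hG : Differentiable ℝ (loss g Q)) (β : Fin d → ℝ) :
    grad (loss g Q) β = ∫ x, stochGrad g β x ∂Q := by
  have hs0 : s ≠ 0 := by have := h.two_le_s; omega
  have hs1 : 1 ≤ s := by omega
  ext i
  set e : Fin d → ℝ := Pi.single i 1 with he
  set k : ℝ → Ξ → ℝ := fun u x => stochGrad g (β + u • e) x i with hk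
  set f : ℝ → ℝ := fun u => ∫ x, k u x ∂Q with hf
  have hfe : ∀ u, f u = (∫ x, stochGrad g (β + u • e) x ∂Q) i := fun u => by
    rw [eval_integral fun j => (h.integrable_stochGrad (β + u • e)).eval j]
  have hfc : Continuous f := by
    have hl : LipschitzWith (Real.toNNReal (L * lsNorm s e)) f := by
      refine LipschitzWith.of_dist_le_mul fun u v => ?_
      rw [Real.coe_toNNReal _ (mul_nonneg h.L_nonneg (lsNorm_nonneg _ _)), Real.dist_eq,
        Real.dist_eq, hfe, hfe, ← Pi.sub_apply]
      refine (abs_apply_le_lsNorm hs0 _ i).trans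
        ((h.lsNorm_integral_sub_le _ _).trans (le_of_eq ?_))
      rw [show β + u • e - (β + v • e) = (u - v) • e by rw [sub_smul]; abel, lsNorm_smul hs1]
      ring
    exact hl.continuous
  have hkd : ∀ x u, HasDerivAt (fun t : ℝ => g (β + t • e) x) (k u x) u := by
    intro x u
    exact hasDerivAt_line (f := fun β => g β x) ((h.twice x).1 _)
  have hkc : ∀ x, Continuous fun u => k u x := by
    intro x
    exact (continuous_apply i).comp ((h.continuous_stochGrad x).comp (by fun_prop))
  have hkm : Measurable (Function.uncurry k) := by
    have h1 : Measurable fun p : ℝ × Ξ => (β + p.1 • e, p.2) := by fun_prop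
    exact (measurable_pi_apply i).comp (h.measurable_uncurry_stochGrad.comp h1)
  have hki : ∀ u, Integrable (k u) Q := fun u => (h.integrable_stochGrad _).eval i
  have hGt : ∀ t : ℝ, loss g Q (β + t • e) - loss g Q β = ∫ u in (0 : ℝ)..t, f u := by
    intro t
    have hint : Integrable (Function.uncurry k) ((volume.restrict (Set.uIoc 0 t)).prod Q) := by
      rw [integrable_prod_iff hkm.aestronglyMeasurable]
      refine ⟨ae_of_all _ hki, ?_⟩
      set C : ℝ := (gradMoment s q g Q βstar).toReal
        + L * (lsNorm s (β - βstar) + |t| * lsNorm s e)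
      have hb : ∀ᵐ u ∂(volume.restrict (Set.uIoc 0 t)),
          ‖∫ x, ‖Function.uncurry k (u, x)‖ ∂Q‖ ≤ C := by
        refine (ae_restrict_iff' measurableSet_uIoc).2 (ae_of_all _ fun u hu => ?_)
        rw [Real.norm_of_nonneg (integral_nonneg fun _ => norm_nonneg _)]
        have hut : |u| ≤ |t| := by
          have := Set.abs_sub_left_of_mem_uIcc (Set.uIoc_subset_uIcc hu)
          simpa using this
        calc ∫ x, ‖Function.uncurry k (u, x)‖ ∂Q
            ≤ ∫ x, ‖stochGrad g (β + u • e) x‖ ∂Q :=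
              integral_mono (hki u).norm (h.integrable_stochGrad _).norm
                fun x => norm_le_pi_norm (stochGrad g (β + u • e) x) i
          _ ≤ _ := h.integral_norm_stochGrad_le _
          _ ≤ C := by
              have h2 : lsNorm s (β + u • e - βstar)
                  ≤ lsNorm s (β - βstar) + |t| * lsNorm s e := by
                rw [show β + u • e - βstar = (β - βstar) + u • e by abel]
                refine (lsNorm_add_le hs1 _ _).trans ?_
                rw [lsNorm_smul hs1]
                gcongr
                exact lsNorm_nonneg _ _
              have := h.L_nonneg
              simp only [C]
              gcongr
      have : IsFiniteMeasure (volume.restrict (Set.uIoc 0 t)) := by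
        rw [Set.uIoc]; infer_instance
      refine Integrable.of_bound ?_ C hb
      exact (hkm.norm.stronglyMeasurable.integral_prod_right'
        (ν := Q)).aestronglyMeasurable
    have h1 : ∀ x, g (β + t • e) x - g β x = ∫ u in (0 : ℝ)..t, k u x := by
      intro x
      rw [intervalIntegral.integral_eq_sub_of_hasDerivAt (fun u _ => hkd x u)
        ((hkc x).intervalIntegrable _ _)]
      simp
    rw [loss, loss, ← integral_sub (h.integrable _) (h.integrable _)]
    simp_rw [h1]
    rw [← intervalIntegral_integral_swap hint]
  have hD1 : HasDerivAt (fun t : ℝ => loss g Q (β + t • e)) (grad (loss g Q) β i) 0 := by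
    have := hasDerivAt_line (f := loss g Q) (β := β) (v := e) (t := 0) (hG _)
    simpa [grad, pderiv, e] using this
  have hD2 : HasDerivAt (fun t : ℝ => loss g Q (β + t • e)) (f 0) 0 := by
    have h1 : HasDerivAt (fun t : ℝ => ∫ u in (0 : ℝ)..t, f u) (f 0) 0 :=
      intervalIntegral.integral_hasDerivAt_right (hfc.intervalIntegrable _ _)
        (hfc.stronglyMeasurableAtFilter _ _) hfc.continuousAt
    have h2 := h1.const_add (loss g Q β)
    refine h2.congr_of_eventuallyEq (Eventually.of_forall fun t => ?_)
    dsimp only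
    rw [← hGt t]; ring
  rw [hD1.unique hD2, hfe]
  simp

end NoisyLoss

lemma grad_eq_zero_of_forall_le {G : (Fin d → ℝ) → ℝ} (h : ∀ β, G βstar ≤ G β) :
    grad G βstar = 0 := by
  have : IsLocalMin G βstar := Eventually.of_forall h
  ext i
  simp [grad, pderiv, this.fderiv_eq_zero]

end Gradient

/-! ### One step of stochastic gradient descent -/

section Step

variable {d s : ℕ} {q μ L α ρ : ℝ} {Ξ : Type*} [MeasurableSpace Ξ]

/-- One step `(β, x) ↦ β - α ∇g(β, x)` of the recursion. -/
noncomputable def sgdMap (g : (Fin d → ℝ) → Ξ → ℝ) (α : ℝ) (p : (Fin d → ℝ) × Ξ) : Fin d → ℝ :=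
  p.1 - α • stochGrad g p.1 p.2

/-- A noisy loss whose expectation is minimal at `βstar` and strongly convex in the `ℓ^s` sense. -/
structure ConvexNoisyLoss (s : ℕ) (q μ L : ℝ) (g : (Fin d → ℝ) → Ξ → ℝ) (Q : Measure Ξ)
    (βstar : Fin d → ℝ) : Prop extends NoisyLoss s q L g Q βstar where
  even_s : Even s
  μ_pos : 0 < μ
  L_pos : 0 < L
  diff : Differentiable ℝ (loss g Q)
  isMin : ∀ β, loss g Q βstar ≤ loss g Q β
  convex : LsStrongConvex s μ (loss g Q)

variable {g : (Fin d → ℝ) → Ξ → ℝ} {Q : Measure Ξ} {βstar : Fin d → ℝ}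

lemma NoisyLoss.measurable_sgdMap (h : NoisyLoss s q L g Q βstar) (α : ℝ) :
    Measurable (sgdMap g α) :=
  measurable_fst.sub (h.measurable_uncurry_stochGrad.const_smul α)

lemma NoisyLoss.continuous_sgdMap (h : NoisyLoss s q L g Q βstar) (α : ℝ) (x : Ξ) :
    Continuous fun b => sgdMap g α (b, x) :=
  continuous_id.sub ((h.continuous_stochGrad x).const_smul α)

/-- The displacement of one step from a deterministic point. -/
lemma NoisyLoss.lsMoment_sgdMap_sub_self_le (h : NoisyLoss s q L g Q βstar) (hα : 0 ≤ α)
    (b : Fin d → ℝ) :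
    lsMoment s q Q (fun x => sgdMap g α (b, x) - b)
      ≤ ENNReal.ofReal (α * (gradMoment s q g Q βstar).toReal
        + α * L * lsNorm s (b - βstar)) := by
  have hs1 : 1 ≤ s := by have := h.two_le_s; omega
  have e : (fun x => sgdMap g α (b, x) - b) = fun x => (-α) • stochGrad g b x := by
    funext x; simp [sgdMap]
  rw [e, lsMoment_const_smul hs1, abs_neg, abs_of_nonneg hα]
  refine (mul_le_mul_right (h.lsMoment_stochGrad_le b) _).trans (le_of_eq ?_)
  rw [← ENNReal.ofReal_mul hα]
  congr 1; ring

namespace ConvexNoisyLoss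

variable [IsProbabilityMeasure Q] (h : ConvexNoisyLoss s q μ L g Q βstar)
include h

lemma integral_stochGrad (β : Fin d → ℝ) (i : Fin d) :
    ∫ x, stochGrad g β x i ∂Q = grad (loss g Q) β i := by
  rw [h.grad_loss h.diff, eval_integral fun j => (h.integrable_stochGrad β).eval j]

/-- Mean-square contraction of one step, with the constant `contr`. -/
lemma sq_toReal_lsMoment_sgdMap_sub_le (hα : 0 ≤ α) (β β' : Fin d → ℝ) :
    lsMoment s q Q (fun x => sgdMap g α (β, x) - sgdMap g α (β', x)) < ⊤ ∧
    (lsMoment s q Q (fun x => sgdMap g α (β, x) - sgdMap g α (β', x))).toReal ^ 2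
      ≤ contr s q μ L α * lsNorm s (β - β') ^ 2 := by
  have hs1 : 1 ≤ s := by have := h.two_le_s; omega
  have hm : 2 ≤ max q (s : ℝ) := h.two_le_q.trans (le_max_left _ _)
  set Y : Ξ → Fin d → ℝ := fun x => (-α) • (stochGrad g β x - stochGrad g β' x) with hY
  have hYm : Measurable Y :=
    ((h.measurable_stochGrad β).sub (h.measurable_stochGrad β')).const_smul (-α)
  have e : (fun x => sgdMap g α (β, x) - sgdMap g α (β', x)) = fun x => (β - β') + Y x := by
    funext x; simp only [sgdMap, hY, neg_smul, smul_sub]; abel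
  have hb0 : 0 ≤ α * (L * lsNorm s (β - β')) :=
    mul_nonneg hα (mul_nonneg h.L_nonneg (lsNorm_nonneg _ _))
  have hYb : lsMoment s q Q Y ≤ ENNReal.ofReal (α * (L * lsNorm s (β - β'))) := by
    rw [hY, lsMoment_const_smul hs1, abs_neg, abs_of_nonneg hα, ENNReal.ofReal_mul hα]
    exact mul_le_mul_right (h.lsMoment_stochGrad_sub_le β β') _
  have hc : ∑ i, (β - β') i ^ (s - 1) * (∫ x, Y x i ∂Q)
      ≤ -(α * μ) * lsNorm s (β - β') ^ s := by
    have e1 : ∀ i, ∫ x, Y x i ∂Q = -α * (grad (loss g Q) β i - grad (loss g Q) β' i) := by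
      intro i
      simp only [hY, Pi.smul_apply, Pi.sub_apply, smul_eq_mul]
      rw [integral_const_mul, integral_sub ((h.integrable_stochGrad β).eval i)
        ((h.integrable_stochGrad β').eval i), h.integral_stochGrad, h.integral_stochGrad]
    simp_rw [e1]
    have := mul_le_mul_of_nonneg_left (h.convex β β') hα
    rw [Finset.mul_sum] at this
    simp only [Pi.sub_apply]
    rw [← neg_le_neg_iff, ← Finset.sum_neg_distrib]
    calc _ = α * (μ * lsNorm s (β - β') ^ s) := by ring
      _ ≤ _ := this
      _ = _ := Finset.sum_congr rfl fun i _ => by ring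
  have H := lsMoment_add_sq_le h.two_le_s h.even_s h.two_le_q hYm.aemeasurable hYb hb0 hc
  rw [e]
  refine ⟨?_, H.trans ?_⟩
  · refine (lsMoment_add_le (f := fun _ => β - β') hs1 (by linarith [h.two_le_q])
      aemeasurable_const hYm.aemeasurable).trans_lt (ENNReal.add_lt_top.2 ⟨?_, ?_⟩)
    · rw [lsMoment_const (by linarith [h.two_le_q])]; exact ENNReal.ofReal_lt_top
    · exact hYb.trans_lt ENNReal.ofReal_lt_top
  · have h1 : (max q s - 1) * (α * (L * lsNorm s (β - β'))) ^ 2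
        ≤ max q s * (α * (L * lsNorm s (β - β'))) ^ 2 := by
      gcongr; linarith
    rw [contr]
    nlinarith

/-- In positive dimension two distinct points exist, and the mean-square contraction between them
forces the constant to be nonnegative. -/
lemma contr_nonneg (hd : 1 ≤ d) (hα : 0 ≤ α) : 0 ≤ contr s q μ L α := by
  have hs0 : s ≠ 0 := by have := h.two_le_s; omega
  have h1 := (h.sq_toReal_lsMoment_sgdMap_sub_le hα (fun _ => 1) 0).2
  have h2 : 0 < lsNorm s ((fun _ => 1 : Fin d → ℝ) - 0) := by
    have := abs_apply_le_lsNorm hs0 ((fun _ => 1 : Fin d → ℝ) - 0) ⟨0, by omega⟩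
    simp at this ⊢
    linarith
  by_contra hneg
  rw [not_le] at hneg
  have : contr s q μ L α * lsNorm s ((fun _ => 1 : Fin d → ℝ) - 0) ^ 2 < 0 :=
    mul_neg_of_neg_of_pos hneg (by positivity)
  have h3 := sq_nonneg
    (lsMoment s q Q fun x => sgdMap g α (fun _ => 1, x) - sgdMap g α (0, x)).toReal
  linarith

lemma lsMoment_sgdMap_sub_le (hα : 0 ≤ α) (β β' : Fin d → ℝ) :
    lsMoment s q Q (fun x => sgdMap g α (β, x) - sgdMap g α (β', x))
      ≤ ENNReal.ofReal (√(contr s q μ L α) * lsNorm s (β - β')) := by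
  obtain ⟨h1, h2⟩ := h.sq_toReal_lsMoment_sgdMap_sub_le hα β β'
  rw [← ENNReal.ofReal_toReal h1.ne]
  refine ENNReal.ofReal_le_ofReal ?_
  refine (Real.le_sqrt_of_sq_le h2).trans (le_of_eq ?_)
  rw [Real.sqrt_mul' _ (sq_nonneg _), Real.sqrt_sq (lsNorm_nonneg _ _)]

/-- Second-order recursion for the distance of the iterates to the minimizer. -/
lemma sq_lsMoment_sgdMap_sub_star_le (hα : 0 ≤ α) (β : Fin d → ℝ) :
    lsMoment s q Q (fun x => sgdMap g α (β, x) - βstar) ^ 2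
      ≤ ENNReal.ofReal ((1 - 2 * μ * α) * lsNorm s (β - βstar) ^ 2 + max q s * α ^ 2
        * ((gradMoment s q g Q βstar).toReal + L * lsNorm s (β - βstar)) ^ 2) := by
  have hs1 : 1 ≤ s := by have := h.two_le_s; omega
  have hm : 2 ≤ max q (s : ℝ) := h.two_le_q.trans (le_max_left _ _)
  set M := (gradMoment s q g Q βstar).toReal
  set Y : Ξ → Fin d → ℝ := fun x => (-α) • stochGrad g β x with hY
  have hYm : Measurable Y := (h.measurable_stochGrad β).const_smul (-α)
  have e : (fun x => sgdMap g α (β, x) - βstar) = fun x => (β - βstar) + Y x := by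
    funext x; simp only [sgdMap, hY, neg_smul]; abel
  have hML : 0 ≤ M + L * lsNorm s (β - βstar) :=
    add_nonneg ENNReal.toReal_nonneg (mul_nonneg h.L_nonneg (lsNorm_nonneg _ _))
  have hYb : lsMoment s q Q Y ≤ ENNReal.ofReal (α * (M + L * lsNorm s (β - βstar))) := by
    rw [hY, lsMoment_const_smul hs1, abs_neg, abs_of_nonneg hα, ENNReal.ofReal_mul hα]
    exact mul_le_mul_right (h.lsMoment_stochGrad_le β) _
  have hc : ∑ i, (β - βstar) i ^ (s - 1) * (∫ x, Y x i ∂Q)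
      ≤ -(α * μ) * lsNorm s (β - βstar) ^ s := by
    have e1 : ∀ i, ∫ x, Y x i ∂Q = -α * (grad (loss g Q) β i - grad (loss g Q) βstar i) := by
      intro i
      simp only [hY, Pi.smul_apply, smul_eq_mul]
      rw [integral_const_mul, h.integral_stochGrad, grad_eq_zero_of_forall_le h.isMin]
      simp
    simp_rw [e1]
    have := mul_le_mul_of_nonneg_left (h.convex β βstar) hα
    rw [Finset.mul_sum] at this
    simp only [Pi.sub_apply]
    rw [← neg_le_neg_iff, ← Finset.sum_neg_distrib]
    calc _ = α * (μ * lsNorm s (β - βstar) ^ s) := by ring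
      _ ≤ _ := this
      _ = _ := Finset.sum_congr rfl fun i _ => by ring
  have H := lsMoment_add_sq_le h.two_le_s h.even_s h.two_le_q hYm.aemeasurable hYb
    (mul_nonneg hα hML) hc
  have hfin : lsMoment s q Q (fun x => (β - βstar) + Y x) < ⊤ := by
    refine (lsMoment_add_le (f := fun _ => β - βstar) hs1 (by linarith [h.two_le_q])
      aemeasurable_const hYm.aemeasurable).trans_lt (ENNReal.add_lt_top.2 ⟨?_, ?_⟩)
    · rw [lsMoment_const (by linarith [h.two_le_q])]; exact ENNReal.ofReal_lt_top
    · exact hYb.trans_lt ENNReal.ofReal_lt_top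
  rw [e, ← ENNReal.ofReal_toReal hfin.ne, ← ENNReal.ofReal_pow ENNReal.toReal_nonneg]
  refine ENNReal.ofReal_le_ofReal (H.trans ?_)
  have h1 : (max q s - 1) * (α * (M + L * lsNorm s (β - βstar))) ^ 2
      ≤ max q s * (α * (M + L * lsNorm s (β - βstar))) ^ 2 := by
    gcongr; linarith
  nlinarith

end ConvexNoisyLoss

/-! ### Consequences of the learning-rate restriction -/

lemma mul_sq_le_of_le_alphaMax (hq : 2 ≤ q) (hL : 0 < L)
    (hαρ : α ≤ ρ * alphaMax s q μ L) : max q s * L ^ 2 * α ≤ 2 * μ * ρ := by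
  have hm : 0 < max q (s : ℝ) := by linarith [le_max_left q (s : ℝ)]
  have := mul_le_mul_of_nonneg_left hαρ (by positivity : 0 ≤ max q (s : ℝ) * L ^ 2)
  refine this.trans (le_of_eq ?_)
  rw [alphaMax]; field_simp

lemma le_one_sub_contr (hq : 2 ≤ q) (hL : 0 < L) (hα : 0 ≤ α)
    (hαρ : α ≤ ρ * alphaMax s q μ L) : 2 * μ * α * (1 - ρ) ≤ 1 - contr s q μ L α := by
  have := mul_le_mul_of_nonneg_right (mul_sq_le_of_le_alphaMax hq hL hαρ) hα
  rw [contr]; nlinarith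

/-- The cross term in the recursion for the distance to the minimizer is absorbed by part of the
contraction. -/
lemma recursion_le (hq : 2 ≤ q) (hμ : 0 < μ) (hL : 0 < L) (hρ0 : 0 < ρ) (hρ1 : ρ < 1) (hα : 0 ≤ α)
    (hαρ : α ≤ ρ * alphaMax s q μ L) (M y : ℝ) :
    (1 - 2 * μ * α) * y ^ 2 + max q s * α ^ 2 * (M + L * y) ^ 2
      ≤ (1 - μ * α * (1 - ρ)) * y ^ 2 + (1 + 2 / (1 - ρ)) * max q s * α ^ 2 * M ^ 2 := by
  have hm : 0 < max q (s : ℝ) := by linarith [le_max_left q (s : ℝ)]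
  have h1ρ : 0 < 1 - ρ := by linarith
  have hA := mul_sq_le_of_le_alphaMax hq hL hαρ
  have young : (M + L * y) ^ 2
      ≤ (1 + 2 / (1 - ρ)) * M ^ 2 + (1 + (1 - ρ) / 2) * (L * y) ^ 2 := by
    have : (1 + 2 / (1 - ρ)) * M ^ 2 + (1 + (1 - ρ) / 2) * (L * y) ^ 2 - (M + L * y) ^ 2
        = (2 * M - (1 - ρ) * (L * y)) ^ 2 / (2 * (1 - ρ)) := by
      field_simp; ring
    have h2 : 0 ≤ (2 * M - (1 - ρ) * (L * y)) ^ 2 / (2 * (1 - ρ)) := by positivity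
    linarith
  have h3 := mul_le_mul_of_nonneg_left young (by positivity : 0 ≤ max q (s : ℝ) * α ^ 2)
  have h4 : max q (s : ℝ) * α ^ 2 * ((1 + (1 - ρ) / 2) * (L * y) ^ 2)
      ≤ 2 * μ * ρ * α * (1 + (1 - ρ) / 2) * y ^ 2 := by
    have := mul_le_mul_of_nonneg_right hA
      (by positivity : 0 ≤ α * (1 + (1 - ρ) / 2) * y ^ 2)
    calc _ = max q (s : ℝ) * L ^ 2 * α * (α * (1 + (1 - ρ) / 2) * y ^ 2) := by ring
      _ ≤ _ := this
      _ = _ := by ring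
  have h5 : 2 * μ * ρ * α * (1 + (1 - ρ) / 2) * y ^ 2
      ≤ (2 * μ * α - μ * α * (1 - ρ)) * y ^ 2 := by
    refine mul_le_mul_of_nonneg_right ?_ (sq_nonneg y)
    have : 0 ≤ μ * α * (1 - ρ) * (1 - ρ) := by positivity
    nlinarith
  nlinarith

end Step

/-! ### The stationary law -/

section StationaryMoment

variable {d s : ℕ} {q μ L α ρ : ℝ} {Ξ : Type*} [MeasurableSpace Ξ]
variable {g : (Fin d → ℝ) → Ξ → ℝ} {Q : Measure Ξ} {βstar : Fin d → ℝ}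

namespace ConvexNoisyLoss

variable (h : ConvexNoisyLoss s q μ L g Q βstar)
include h

lemma sqrt_contr_lt_one (hρ1 : ρ < 1) (hα : 0 < α) (hαρ : α ≤ ρ * alphaMax s q μ L) :
    √(contr s q μ L α) < 1 := by
  have h1 := le_one_sub_contr h.two_le_q h.L_pos hα.le hαρ
  have h2 : 0 < 2 * μ * α * (1 - ρ) := by
    have := h.μ_pos; have : 0 < 1 - ρ := by linarith
    positivity
  rw [Real.sqrt_lt' one_pos]; linarith

variable [IsProbabilityMeasure Q]

theorem existsUnique_stationary (hρ1 : ρ < 1) (hα : 0 < α) (hαρ : α ≤ ρ * alphaMax s q μ L) :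
    ∃ π, IsStationaryLaw s q α g Q π ∧ ∀ π', IsStationaryLaw s q α g Q π' → π' = π := by
  have hs1 : 1 ≤ s := by have := h.two_le_s; omega
  have hF := h.measurable_sgdMap α
  have hκ := h.lsMoment_sgdMap_sub_le hα.le
  have hκ1 := h.sqrt_contr_lt_one hρ1 hα hαρ
  obtain ⟨π, h1, h2, h3⟩ := exists_stationary hs1 h.two_le_q hF (h.continuous_sgdMap α)
    (Real.sqrt_nonneg _) hκ1 hκ βstar
    ((h.lsMoment_sgdMap_sub_self_le hα.le βstar).trans_lt ENNReal.ofReal_lt_top)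
  refine ⟨π, ⟨h1, h2, h3⟩, ?_⟩
  rintro π' ⟨h1', h2', h3'⟩
  exact stationary_unique hs1 h.two_le_q hF (Real.sqrt_nonneg _) hκ1 hκ h2' h2 h3' h3

/-- Under the stationary law the iterates are within `O(√(max{q,s} α))` of the minimizer. -/
theorem lsMoment_stationary_le (hd : 1 ≤ d) (hρ0 : 0 < ρ) (hρ1 : ρ < 1) (hα : 0 < α)
    (hαρ : α ≤ ρ * alphaMax s q μ L) {π : Measure (Fin d → ℝ)}
    (hπ : IsStationaryLaw s q α g Q π) :
    lsMoment s q π (fun u => u - βstar) ≤ ENNReal.ofReal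
      (√((1 + 2 / (1 - ρ)) / (μ * (1 - ρ)) * max q s * α) * (gradMoment s q g Q βstar).toReal) := by
  obtain ⟨hp, hst, hmom⟩ := hπ
  have hs0 : s ≠ 0 := by have := h.two_le_s; omega
  have hs1 : 1 ≤ s := by omega
  have hμ := h.μ_pos
  have hq0 : 0 < q := by linarith [h.two_le_q]
  have h1ρ : 0 < 1 - ρ := by linarith
  have hm : 0 < max q (s : ℝ) := lt_of_lt_of_le hq0 (le_max_left _ _)
  set M := (gradMoment s q g Q βstar).toReal with hM
  have hM0 : 0 ≤ M := ENNReal.toReal_nonneg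
  set θ := 1 - μ * α * (1 - ρ) with hθ
  have hθ0 : 0 ≤ θ := by
    have h1 := h.contr_nonneg hd hα.le
    have h2 := le_one_sub_contr h.two_le_q h.L_pos hα.le hαρ
    have h3 : 0 ≤ μ * α * (1 - ρ) := by positivity
    rw [hθ]; linarith
  set B := (1 + 2 / (1 - ρ)) * max q s * α ^ 2 * M ^ 2 with hB
  have hB0 : 0 ≤ B := by positivity
  have hF := h.measurable_sgdMap α
  have hsub : Measurable fun u : Fin d → ℝ => u - βstar := by fun_prop
  have step := lsMoment_prod_sq_le (ν := π) (Q := Q) (s := s) (q := q)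
    (H := fun z => sgdMap g α z - βstar) (a := fun u => √θ * lsNorm s (u - βstar))
    (b := fun _ => √B) hs0 h.two_le_q (hsub.comp hF)
    ((aemeasurable_lsNorm hs0 hsub.aemeasurable).const_mul _) aemeasurable_const (fun u => by
      refine (h.sq_lsMoment_sgdMap_sub_star_le hα.le u).trans (ENNReal.ofReal_le_ofReal ?_)
      rw [mul_pow, Real.sq_sqrt hθ0, Real.sq_sqrt hB0]
      exact recursion_le h.two_le_q hμ h.L_pos hρ0 hρ1 hα.le hαρ M _)
  have e1 : lsMoment s q (π.prod Q) (fun z => sgdMap g α z - βstar)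
      = lsMoment s q π (fun u => u - βstar) := by
    have := lsMoment_map (P := π.prod Q) (s := s) (q := q) hF.aemeasurable hs0 hsub
    rw [← this]
    congr 1
  have e2 : eLpNorm (fun u => √θ * lsNorm s (u - βstar)) (ENNReal.ofReal q) π
      = ENNReal.ofReal √θ * lsMoment s q π (fun u => u - βstar) := by
    rw [lsMoment, ← Real.enorm_of_nonneg (Real.sqrt_nonneg θ), ← eLpNorm_const_smul]
    rfl
  have e3 : eLpNorm (fun _ : Fin d → ℝ => √B) (ENNReal.ofReal q) π = ENNReal.ofReal √B := by
    rw [eLpNorm_const _ (by simpa using hq0) (IsProbabilityMeasure.ne_zero π),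
      Real.enorm_of_nonneg (Real.sqrt_nonneg _)]
    simp
  have hfin : lsMoment s q π (fun u => u - βstar) < ⊤ := by
    refine (lsMoment_sub_le (f := fun u => u) (g := fun _ => βstar) hs1
      (by linarith [h.two_le_q]) aemeasurable_id' aemeasurable_const).trans_lt
      (ENNReal.add_lt_top.2 ⟨hmom, ?_⟩)
    rw [lsMoment_const hq0]; exact ENNReal.ofReal_lt_top
  rw [e1, e2, e3] at step
  set N := (lsMoment s q π (fun u => u - βstar)).toReal with hN
  rw [← ENNReal.ofReal_toReal hfin.ne] at step ⊢
  rw [← hN] at step ⊢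
  have hN0 : 0 ≤ N := ENNReal.toReal_nonneg
  rw [← ENNReal.ofReal_mul (Real.sqrt_nonneg _), ← ENNReal.ofReal_pow hN0,
    ← ENNReal.ofReal_pow (by positivity), ← ENNReal.ofReal_pow (by positivity),
    ← ENNReal.ofReal_add (by positivity) (by positivity),
    ENNReal.ofReal_le_ofReal_iff (by positivity), mul_pow, Real.sq_sqrt hθ0,
    Real.sq_sqrt hB0] at step
  refine ENNReal.ofReal_le_ofReal (abs_le_of_sq_le_sq' ?_ (by positivity)).2
  rw [mul_pow, Real.sq_sqrt (by positivity)]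
  have h4 : μ * α * (1 - ρ) * N ^ 2 ≤ B := by rw [hθ] at step; linarith
  rw [← mul_le_mul_iff_right₀ (by positivity : 0 < μ * α * (1 - ρ))]
  refine h4.trans (le_of_eq ?_)
  rw [hB]; field_simp

end ConvexNoisyLoss

end StationaryMoment

/-! ### Fluctuations of sums along a stationary recursion -/

section Fluctuation

variable {Ξ Ω : Type*} [MeasurableSpace Ξ] [MeasurableSpace Ω] {d s : ℕ}
  {q κ Λ A₀ A₁ N : ℝ} {Q : Measure Ξ} {F : (Fin d → ℝ) × Ξ → Fin d → ℝ} {bs : Fin d → ℝ}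

lemma lsMoment_le_mul {P : Measure Ω} (hs : 1 ≤ s) {c : ℝ} (hc : 0 ≤ c) {f g : Ω → Fin d → ℝ}
    (h : ∀ ω, lsNorm s (f ω) ≤ c * lsNorm s (g ω)) :
    lsMoment s q P f ≤ ENNReal.ofReal c * lsMoment s q P g := by
  have := lsMoment_const_smul (s := s) (q := q) (P := P) hs c g
  rw [abs_of_nonneg hc] at this
  rw [← this]
  refine lsMoment_mono fun ω => ?_
  rw [lsNorm_smul hs, abs_of_nonneg hc]
  exact h ω

lemma continuous_of_lsNorm_sub_le (hs : s ≠ 0) (hΛ : 0 ≤ Λ) {U : (Fin d → ℝ) → Fin d → ℝ}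
    (h : ∀ b b', lsNorm s (U b - U b') ≤ Λ * lsNorm s (b - b')) : Continuous U := by
  have : LipschitzWith (Real.toNNReal (Λ * (d : ℝ) ^ ((1 : ℝ) / s))) U := by
    refine LipschitzWith.of_dist_le_mul fun b b' => ?_
    rw [Real.coe_toNNReal _ (by positivity), dist_eq_norm, dist_eq_norm, mul_assoc]
    exact (norm_le_lsNorm hs _).trans ((h b b').trans
      (mul_le_mul_of_nonneg_left (lsNorm_le_mul_norm hs _) hΛ))
  exact this.continuous

/-- The expected sum of the next `n` iterates of the random map `F`, started at a given point. -/
noncomputable def expectedSum (F : (Fin d → ℝ) × Ξ → Fin d → ℝ) (Q : Measure Ξ) :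
    ℕ → (Fin d → ℝ) → Fin d → ℝ
  | 0, _ => 0
  | n + 1, b => ∫ x, (F (b, x) + expectedSum F Q n (F (b, x))) ∂Q

/-- A random map that contracts with factor `κ` and moves every point by a bounded moment. The
constant `Λ` dominates the geometric series `∑ κ^n`. -/
structure ContractingMap (s : ℕ) (q κ Λ A₀ A₁ : ℝ) (F : (Fin d → ℝ) × Ξ → Fin d → ℝ)
    (Q : Measure Ξ) (bs : Fin d → ℝ) : Prop where
  one_le_s : 1 ≤ s
  two_le_q : 2 ≤ q
  meas : Measurable F
  κ_nonneg : 0 ≤ κ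
  Λ_nonneg : 0 ≤ Λ
  Λ_bound : 1 + κ * Λ ≤ Λ
  A₀_nonneg : 0 ≤ A₀
  A₁_nonneg : 0 ≤ A₁
  contract : ∀ b b', lsMoment s q Q (fun x => F (b, x) - F (b', x))
    ≤ ENNReal.ofReal (κ * lsNorm s (b - b'))
  disp : ∀ b, lsMoment s q Q (fun x => F (b, x) - b) ≤ ENNReal.ofReal (A₀ + A₁ * lsNorm s (b - bs))

namespace ContractingMap

variable (h : ContractingMap s q κ Λ A₀ A₁ F Q bs)
include h

lemma measurable_section (b : Fin d → ℝ) : Measurable fun x => F (b, x) :=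
  h.meas.comp measurable_prodMk_left

/-- Composition with a Lipschitz function multiplies displacements by the Lipschitz constant. -/
lemma lsMoment_comp_sub_le {U : (Fin d → ℝ) → Fin d → ℝ}
    (hU : ∀ b b', lsNorm s (U b - U b') ≤ Λ * lsNorm s (b - b')) (b : Fin d → ℝ) :
    lsMoment s q Q (fun x => U (F (b, x)) - U b)
      ≤ ENNReal.ofReal (Λ * (A₀ + A₁ * lsNorm s (b - bs))) := by
  rw [ENNReal.ofReal_mul h.Λ_nonneg]
  exact (lsMoment_le_mul h.one_le_s h.Λ_nonneg fun x => hU _ _).trans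
    (mul_le_mul_right (h.disp b) _)

variable [IsProbabilityMeasure Q]

lemma integrable_comp {U : (Fin d → ℝ) → Fin d → ℝ}
    (hU : ∀ b b', lsNorm s (U b - U b') ≤ Λ * lsNorm s (b - b')) (b : Fin d → ℝ) :
    Integrable (fun x => U (F (b, x))) Q := by
  have hs0 : s ≠ 0 := by have := h.one_le_s; omega
  have hUc := continuous_of_lsNorm_sub_le hs0 h.Λ_nonneg hU
  have h1 : Integrable (fun x => U (F (b, x)) - U b) Q :=
    integrable_of_lsMoment hs0 (by linarith [h.two_le_q])
      ((hUc.measurable.comp (h.measurable_section b)).sub_const _).aemeasurable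
      ((h.lsMoment_comp_sub_le hU b).trans_lt ENNReal.ofReal_lt_top)
  exact (h1.add (integrable_const (U b))).congr (ae_of_all _ fun x => by simp)

lemma lsNorm_expectedSum_sub_le (n : ℕ) (b b' : Fin d → ℝ) :
    lsNorm s (expectedSum F Q n b - expectedSum F Q n b') ≤ κ * Λ * lsNorm s (b - b') ∧
    lsNorm s ((b + expectedSum F Q n b) - (b' + expectedSum F Q n b')) ≤ Λ * lsNorm s (b - b') := by
  have hs0 : s ≠ 0 := by have := h.one_le_s; omega
  have second : ∀ {n b b'},
      lsNorm s (expectedSum F Q n b - expectedSum F Q n b') ≤ κ * Λ * lsNorm s (b - b') →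
      lsNorm s ((b + expectedSum F Q n b) - (b' + expectedSum F Q n b'))
        ≤ Λ * lsNorm s (b - b') := by
    intro n b b' h1
    rw [add_sub_add_comm]
    refine (lsNorm_add_le h.one_le_s _ _).trans ?_
    have := mul_le_mul_of_nonneg_right h.Λ_bound (lsNorm_nonneg s (b - b'))
    linarith
  have first : ∀ n b b',
      lsNorm s (expectedSum F Q n b - expectedSum F Q n b') ≤ κ * Λ * lsNorm s (b - b') := by
    intro n
    induction n with
    | zero =>
      intro b b'
      simp only [expectedSum, sub_self, lsNorm_zero h.one_le_s]
      exact mul_nonneg (mul_nonneg h.κ_nonneg h.Λ_nonneg) (lsNorm_nonneg _ _)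
    | succ n ih =>
      intro b b'
      have hU := fun b b' => second (ih b b')
      have hUc := continuous_of_lsNorm_sub_le hs0 h.Λ_nonneg hU
      have hm : ∀ b, Measurable fun x => F (b, x) + expectedSum F Q n (F (b, x)) := fun b =>
        hUc.measurable.comp (h.measurable_section b)
      simp only [expectedSum]
      rw [← integral_sub (h.integrable_comp hU b) (h.integrable_comp hU b')]
      have h1 := lsNorm_integral_le_lsMoment (P := Q) (s := s) (q := q) h.one_le_s
        (by linarith [h.two_le_q]) ((hm b).sub (hm b')).aemeasurable
      have h2 : lsMoment s q Q ((fun x => F (b, x) + expectedSum F Q n (F (b, x)))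
          - fun x => F (b', x) + expectedSum F Q n (F (b', x)))
          ≤ ENNReal.ofReal (Λ * (κ * lsNorm s (b - b'))) := by
        rw [ENNReal.ofReal_mul h.Λ_nonneg]
        exact (lsMoment_le_mul h.one_le_s h.Λ_nonneg fun x => hU _ _).trans
          (mul_le_mul_right (h.contract b b') _)
      have h3 := (ENNReal.ofReal_le_ofReal_iff (mul_nonneg h.Λ_nonneg
        (mul_nonneg h.κ_nonneg (lsNorm_nonneg _ _)))).1 (h1.trans h2)
      refine le_trans ?_ (h3.trans (le_of_eq (by ring)))
      exact le_rfl
  exact ⟨first n b b', second (first n b b')⟩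

lemma continuous_expectedSum (n : ℕ) : Continuous (expectedSum F Q n) :=
  continuous_of_lsNorm_sub_le (by have := h.one_le_s; omega) (mul_nonneg h.κ_nonneg h.Λ_nonneg)
    fun b b' => (h.lsNorm_expectedSum_sub_le n b b').1

/-- One martingale step. Let `v` be the sum so far, centred, and `b` the current point. The
conditional mean of the full sum, `v + expectedSum F Q (n+1) b`, changes by a centred increment
whose moment is bounded by the displacement of the random map. -/
lemma sq_lsMoment_martingale_step_le (hs : 2 ≤ s) (hev : Even s) (n : ℕ) (v b : Fin d → ℝ) :
    lsMoment s q Q (fun x => v + (F (b, x) + expectedSum F Q n (F (b, x)))) ^ 2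
      ≤ ENNReal.ofReal (lsNorm s (v + expectedSum F Q (n + 1) b) ^ 2
        + (max q s - 1) * (2 * Λ * (A₀ + A₁ * lsNorm s (b - bs))) ^ 2) := by
  have hs0 : s ≠ 0 := by omega
  have hq1 : 1 ≤ q := by linarith [h.two_le_q]
  set U : (Fin d → ℝ) → Fin d → ℝ := fun b => b + expectedSum F Q n b with hUdef
  have hU : ∀ b b', lsNorm s (U b - U b') ≤ Λ * lsNorm s (b - b') := fun b b' =>
    (h.lsNorm_expectedSum_sub_le n b b').2
  have hUc := continuous_of_lsNorm_sub_le hs0 h.Λ_nonneg hU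
  have hUm : Measurable fun x => U (F (b, x)) := hUc.measurable.comp (h.measurable_section b)
  have hUi := h.integrable_comp hU b
  set W : Fin d → ℝ := expectedSum F Q (n + 1) b with hW
  have hWeq : W = ∫ x, U (F (b, x)) ∂Q := rfl
  set a := A₀ + A₁ * lsNorm s (b - bs) with ha
  have ha0 : 0 ≤ a := add_nonneg h.A₀_nonneg (mul_nonneg h.A₁_nonneg (lsNorm_nonneg _ _))
  have hdisp := h.lsMoment_comp_sub_le hU b
  have hYb : lsMoment s q Q (fun x => U (F (b, x)) - W) ≤ ENNReal.ofReal (2 * Λ * a) := by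
    have e : (fun x => U (F (b, x)) - W)
        = fun x => (U (F (b, x)) - U b) - ∫ x, (U (F (b, x)) - U b) ∂Q := by
      funext x
      rw [integral_sub hUi (integrable_const _), hWeq]
      simp
    have hm : Measurable fun x => U (F (b, x)) - U b := hUm.sub_const _
    rw [e]
    refine (lsMoment_sub_le (g := fun _ => ∫ x, (U (F (b, x)) - U b) ∂Q) h.one_le_s hq1
      hm.aemeasurable aemeasurable_const).trans ?_
    rw [lsMoment_const (by linarith)]
    refine (add_le_add_right (lsNorm_integral_le_lsMoment h.one_le_s hq1 hm.aemeasurable)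
      _).trans ?_
    refine (add_le_add hdisp hdisp).trans (le_of_eq ?_)
    have := mul_nonneg h.Λ_nonneg ha0
    rw [← ENNReal.ofReal_add this this]
    congr 1; ring
  have hmean : ∑ i, (v + W) i ^ (s - 1) * (∫ x, (U (F (b, x)) - W) i ∂Q)
      ≤ 0 * lsNorm s (v + W) ^ s := by
    have : ∀ i, ∫ x, (U (F (b, x)) - W) i ∂Q = 0 := by
      intro i
      simp only [Pi.sub_apply]
      rw [integral_sub (hUi.eval i) (integrable_const _), hWeq, eval_integral fun j => hUi.eval j]
      simp
    rw [zero_mul]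
    exact (Finset.sum_eq_zero fun i _ => by rw [this i, mul_zero]).le
  have h2Λ : 0 ≤ 2 * Λ * a := mul_nonneg (mul_nonneg zero_le_two h.Λ_nonneg) ha0
  have H := lsMoment_add_sq_le hs hev h.two_le_q (hUm.sub_const W).aemeasurable hYb h2Λ hmean
  have e2 : (fun x => v + U (F (b, x))) = fun x => (v + W) + (U (F (b, x)) - W) := by
    funext x; abel
  have hfin : lsMoment s q Q (fun x => (v + W) + (U (F (b, x)) - W)) < ⊤ := by
    refine (lsMoment_add_le (f := fun _ => v + W) h.one_le_s hq1 aemeasurable_const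
      (hUm.sub_const W).aemeasurable).trans_lt (ENNReal.add_lt_top.2 ⟨?_, ?_⟩)
    · rw [lsMoment_const (by linarith)]; exact ENNReal.ofReal_lt_top
    · exact hYb.trans_lt ENNReal.ofReal_lt_top
  change lsMoment s q Q (fun x => v + U (F (b, x))) ^ 2 ≤ _
  rw [e2, ← ENNReal.ofReal_toReal hfin.ne, ← ENNReal.ofReal_pow ENNReal.toReal_nonneg]
  refine ENNReal.ofReal_le_ofReal (H.trans (le_of_eq ?_))
  ring

variable {P : Measure Ω} [IsProbabilityMeasure P] {ξ : ℕ → Ω → Ξ} {β : ℕ → Ω → Fin d → ℝ}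
  {π : Measure (Fin d → ℝ)}

/-- The joint recursion of the partial sums and the iterates. -/
lemma map_sum_iterate (hξ : ∀ n, Measurable (ξ n)) (hβ0 : Measurable (β 0))
    (hβ : ∀ n ω, β (n + 1) ω = F (β n ω, ξ n ω))
    (h0 : P.map (fun ω => (β 0 ω, fun k => ξ k ω))
      = (P.map (β 0)).prod (Measure.infinitePi fun _ : ℕ => Q)) (n : ℕ) :
    Measurable (fun ω => (∑ j ∈ Finset.range n, β (j + 1) ω, β n ω)) ∧
    P.map (fun ω => ((∑ j ∈ Finset.range n, β (j + 1) ω, β n ω), ξ n ω))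
      = (P.map (fun ω => (∑ j ∈ Finset.range n, β (j + 1) ω, β n ω))).prod Q := by
  have hm := h.meas
  refine map_recursion_prod_single (T := (Fin d → ℝ) × (Fin d → ℝ)) hξ
    (Φ := fun _ z => (z.1.1 + F (z.1.2, z.2), F (z.1.2, z.2))) (fun _ => ?_)
    (p := fun n ω => (∑ j ∈ Finset.range n, β (j + 1) ω, β n ω)) ?_ ?_ ?_ n
  · have : Measurable fun z : ((Fin d → ℝ) × (Fin d → ℝ)) × Ξ => F (z.1.2, z.2) :=
      hm.comp (by fun_prop)
    exact (measurable_fst.fst.add this).prodMk this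
  · simpa using measurable_const.prodMk hβ0
  · intro n ω
    simp only [Finset.sum_range_succ, hβ]
  · have hz : Measurable fun b : Fin d → ℝ => ((0 : Fin d → ℝ), b) := measurable_prodMk_left
    have h1 := congrArg (fun M => M.map (Prod.map (fun b : Fin d → ℝ => ((0 : Fin d → ℝ), b)) id))
      h0
    beta_reduce at h1
    rw [Measure.map_map (hz.prodMap measurable_id)
      (hβ0.prodMk (measurable_pi_lambda _ fun k => hξ _)),
      ← Measure.map_prod_map _ _ hz measurable_id, Measure.map_id, Measure.map_map hz hβ0] at h1
    simpa [Function.comp_def] using h1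

lemma map_iterate_prod (hξ : ∀ n, Measurable (ξ n)) (hβ0 : Measurable (β 0))
    (hβ : ∀ n ω, β (n + 1) ω = F (β n ω, ξ n ω))
    (h0 : P.map (fun ω => (β 0 ω, fun k => ξ k ω))
      = (P.map (β 0)).prod (Measure.infinitePi fun _ : ℕ => Q)) (n : ℕ) :
    Measurable (β n) ∧ P.map (fun ω => (β n ω, ξ n ω)) = (P.map (β n)).prod Q :=
  map_recursion_prod_single hξ (Φ := fun _ => F) (fun _ => h.meas) hβ0 hβ h0 n

lemma map_iterate_eq (hξ : ∀ n, Measurable (ξ n)) (hβ0 : Measurable (β 0))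
    (hβ : ∀ n ω, β (n + 1) ω = F (β n ω, ξ n ω))
    (h0 : P.map (fun ω => (β 0 ω, fun k => ξ k ω))
      = (P.map (β 0)).prod (Measure.infinitePi fun _ : ℕ => Q))
    (hst : (π.prod Q).map F = π) (hlaw : P.map (β 0) = π) (n : ℕ) : P.map (β n) = π := by
  induction n with
  | zero => exact hlaw
  | succ n ih =>
    obtain ⟨hm, hp⟩ := h.map_iterate_prod hξ hβ0 hβ h0 n
    have e : β (n + 1) = F ∘ fun ω => (β n ω, ξ n ω) := funext (hβ n)
    rw [e, ← Measure.map_map h.meas (hm.prodMk (hξ n)), hp, ih, hst]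

/-- Moment bound for the martingale formed by the conditional means of the sum of `k` iterates. -/
lemma sq_lsMoment_martingale_le (hs : 2 ≤ s) (hev : Even s) (hξ : ∀ n, Measurable (ξ n))
    (hβ0 : Measurable (β 0)) (hβ : ∀ n ω, β (n + 1) ω = F (β n ω, ξ n ω))
    (h0 : P.map (fun ω => (β 0 ω, fun k => ξ k ω))
      = (P.map (β 0)).prod (Measure.infinitePi fun _ : ℕ => Q))
    (hN0 : 0 ≤ N) (hN : ∀ n, lsMoment s q P (fun ω => β n ω - bs) ≤ ENNReal.ofReal N)
    (k i : ℕ) (hi : i ≤ k) :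
    lsMoment s q P (fun ω => ∑ j ∈ Finset.range i, β (j + 1) ω
        + expectedSum F Q (k - i) (β i ω) - expectedSum F Q k bs) ^ 2
      ≤ ENNReal.ofReal ((Λ * N) ^ 2 + i * ((max q s - 1) * (2 * Λ * (A₀ + A₁ * N)) ^ 2)) := by
  have hs0 : s ≠ 0 := by omega
  have hq1 : 1 ≤ q := by linarith [h.two_le_q]
  have hm1 : 0 ≤ max q (s : ℝ) - 1 := by linarith [le_max_left q (s : ℝ)]
  have hΛ0 := h.Λ_nonneg
  have hA0 := h.A₀_nonneg
  have hA1 := h.A₁_nonneg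
  set c := expectedSum F Q k bs with hc
  induction i with
  | zero =>
    simp only [Finset.range_zero, Finset.sum_empty, zero_add, Nat.sub_zero, Nat.cast_zero,
      zero_mul, add_zero]
    rw [ENNReal.ofReal_pow (by positivity), ENNReal.ofReal_mul hΛ0]
    refine pow_le_pow_left' ?_ 2
    refine (lsMoment_le_mul (g := fun ω => β 0 ω - bs) h.one_le_s hΛ0 fun ω => ?_).trans
      (mul_le_mul_right (hN 0) _)
    refine (h.lsNorm_expectedSum_sub_le k _ _).1.trans ?_
    refine mul_le_mul_of_nonneg_right ?_ (lsNorm_nonneg _ _)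
    linarith [h.Λ_bound]
  | succ i ih =>
    specialize ih (by omega)
    obtain ⟨n, hn⟩ : ∃ n, k - i = n + 1 := ⟨k - i - 1, by omega⟩
    have hn' : k - (i + 1) = n := by omega
    rw [hn] at ih
    rw [hn']
    obtain ⟨hpm, hlaw⟩ := h.map_sum_iterate hξ hβ0 hβ h0 i
    obtain ⟨hβm, -⟩ := h.map_iterate_prod hξ hβ0 hβ h0 i
    set p : Ω → (Fin d → ℝ) × (Fin d → ℝ) :=
      fun ω => (∑ j ∈ Finset.range i, β (j + 1) ω, β i ω) with hp
    have hν : IsProbabilityMeasure (P.map p) := Measure.isProbabilityMeasure_map hpm.aemeasurable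
    have hVc := h.continuous_expectedSum n
    have hVc' := h.continuous_expectedSum (n + 1)
    set H : ((Fin d → ℝ) × (Fin d → ℝ)) × Ξ → Fin d → ℝ := fun z =>
      (z.1.1 - c) + (F (z.1.2, z.2) + expectedSum F Q n (F (z.1.2, z.2))) with hH
    have hFm : Measurable fun z : ((Fin d → ℝ) × (Fin d → ℝ)) × Ξ => F (z.1.2, z.2) :=
      h.meas.comp (by fun_prop)
    have hHm : Measurable H :=
      (measurable_fst.fst.sub_const c).add (hFm.add (hVc.measurable.comp hFm))
    set X : (Fin d → ℝ) × (Fin d → ℝ) → Fin d → ℝ :=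
      fun t => t.1 - c + expectedSum F Q (n + 1) t.2 with hX
    have hXm : Measurable X :=
      (measurable_fst.sub_const c).add (hVc'.measurable.comp measurable_snd)
    have hsnd : Measurable fun t : (Fin d → ℝ) × (Fin d → ℝ) => t.2 - bs := by fun_prop
    set γ : ℝ := √(max q s - 1) * (2 * Λ) with hγ
    have hγ0 : 0 ≤ γ := by positivity
    have hγ2 : γ ^ 2 = (max q s - 1) * (4 * Λ ^ 2) := by
      rw [hγ, mul_pow, Real.sq_sqrt hm1]; ring
    have step := lsMoment_prod_sq_le (ν := P.map p) (Q := Q) (s := s) (q := q) (H := H)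
      (a := fun t => lsNorm s (X t))
      (b := fun t => γ * (A₀ + A₁ * lsNorm s (t.2 - bs))) hs0 h.two_le_q hHm
      (aemeasurable_lsNorm hs0 hXm.aemeasurable)
      (((aemeasurable_lsNorm hs0 hsnd.aemeasurable).const_mul _).const_add _ |>.const_mul _)
      (fun t => by
        refine (h.sq_lsMoment_martingale_step_le hs hev n (t.1 - c) t.2).trans (le_of_eq ?_)
        congr 2
        rw [mul_pow γ, hγ2]
        ring)
    have e1 : lsMoment s q P (fun ω => ∑ j ∈ Finset.range (i + 1), β (j + 1) ω
        + expectedSum F Q n (β (i + 1) ω) - c) = lsMoment s q ((P.map p).prod Q) H := by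
      rw [← hlaw, lsMoment_map (hpm.prodMk (hξ i)).aemeasurable hs0 hHm]
      congr 1
      funext ω
      simp only [hH, hp, Finset.sum_range_succ, hβ i ω]
      abel
    have e2 : eLpNorm (fun t => lsNorm s (X t)) (ENNReal.ofReal q) (P.map p)
        = lsMoment s q P (fun ω => ∑ j ∈ Finset.range i, β (j + 1) ω
          + expectedSum F Q (n + 1) (β i ω) - c) := by
      change lsMoment s q (P.map p) X = _
      rw [lsMoment_map hpm.aemeasurable hs0 hXm]
      congr 1
      funext ω
      simp only [hX, hp]
      abel
    have e3 : eLpNorm (fun t : (Fin d → ℝ) × (Fin d → ℝ) => γ * (A₀ + A₁ * lsNorm s (t.2 - bs)))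
        (ENNReal.ofReal q) (P.map p) ≤ ENNReal.ofReal (γ * (A₀ + A₁ * N)) := by
      have f1 : eLpNorm (fun t : (Fin d → ℝ) × (Fin d → ℝ) =>
          γ * (A₀ + A₁ * lsNorm s (t.2 - bs))) (ENNReal.ofReal q) (P.map p)
          = ENNReal.ofReal γ * eLpNorm (fun t : (Fin d → ℝ) × (Fin d → ℝ) =>
            A₀ + A₁ * lsNorm s (t.2 - bs)) (ENNReal.ofReal q) (P.map p) := by
        rw [← Real.enorm_of_nonneg hγ0, ← eLpNorm_const_smul]; rfl
      have f2 : eLpNorm (fun t : (Fin d → ℝ) × (Fin d → ℝ) => A₁ * lsNorm s (t.2 - bs))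
          (ENNReal.ofReal q) (P.map p) ≤ ENNReal.ofReal (A₁ * N) := by
        have g1 : eLpNorm (fun t : (Fin d → ℝ) × (Fin d → ℝ) => A₁ * lsNorm s (t.2 - bs))
            (ENNReal.ofReal q) (P.map p)
            = ENNReal.ofReal A₁ * lsMoment s q (P.map p) (fun t => t.2 - bs) := by
          rw [lsMoment, ← Real.enorm_of_nonneg hA1, ← eLpNorm_const_smul]; rfl
        rw [g1, lsMoment_map hpm.aemeasurable hs0 hsnd, ENNReal.ofReal_mul hA1]
        exact mul_le_mul_right (hN i) _
      have f3 : eLpNorm (fun t : (Fin d → ℝ) × (Fin d → ℝ) => A₀ + A₁ * lsNorm s (t.2 - bs))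
          (ENNReal.ofReal q) (P.map p) ≤ ENNReal.ofReal A₀ + ENNReal.ofReal (A₁ * N) := by
        have f4 := eLpNorm_add_le (μ := P.map p) (p := ENNReal.ofReal q)
          (f := fun _ : (Fin d → ℝ) × (Fin d → ℝ) => A₀)
          (g := fun t : (Fin d → ℝ) × (Fin d → ℝ) => A₁ * lsNorm s (t.2 - bs))
          aestronglyMeasurable_const
          (((aemeasurable_lsNorm hs0 hsnd.aemeasurable).const_mul A₁).aestronglyMeasurable)
          (by simpa using hq1)
        refine f4.trans (add_le_add (le_of_eq ?_) f2)
        rw [eLpNorm_const _ (by simp; linarith) (IsProbabilityMeasure.ne_zero _),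
          Real.enorm_of_nonneg hA0]
        simp
      rw [f1, ENNReal.ofReal_mul hγ0, ENNReal.ofReal_add hA0 (mul_nonneg hA1 hN0)]
      exact mul_le_mul_right f3 _
    rw [e1]
    refine step.trans ?_
    rw [e2]
    refine (add_le_add ih (pow_le_pow_left' e3 2)).trans (le_of_eq ?_)
    rw [← ENNReal.ofReal_pow (by positivity), ← ENNReal.ofReal_add (by positivity)
      (by positivity)]
    congr 1
    rw [mul_pow γ, hγ2]
    push_cast
    ring

/-- Sums along a stationary recursion concentrate around their mean at the square-root rate. -/
theorem lsMoment_sum_sub_le (hs : 2 ≤ s) (hev : Even s) (hξ : ∀ n, Measurable (ξ n))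
    (hβ0 : Measurable (β 0)) (hβ : ∀ n ω, β (n + 1) ω = F (β n ω, ξ n ω))
    (h0 : P.map (fun ω => (β 0 ω, fun k => ξ k ω))
      = (P.map (β 0)).prod (Measure.infinitePi fun _ : ℕ => Q))
    (hst : (π.prod Q).map F = π) (hlaw : P.map (β 0) = π)
    (hN0 : 0 ≤ N) (hN : lsMoment s q π (fun u => u - bs) ≤ ENNReal.ofReal N) (k : ℕ) :
    lsMoment s q P (fun ω => ∑ j ∈ Finset.range k, β (j + 1) ω - (k : ℝ) • ∫ u, u ∂π)
      ≤ ENNReal.ofReal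
        (2 * √((Λ * N) ^ 2 + k * ((max q s - 1) * (2 * Λ * (A₀ + A₁ * N)) ^ 2))) := by
  have hs0 : s ≠ 0 := by omega
  have hq1 : 1 ≤ q := by linarith [h.two_le_q]
  have hm1 : 0 ≤ max q (s : ℝ) - 1 := by linarith [le_max_left q (s : ℝ)]
  have hβm : ∀ n, Measurable (β n) := fun n => (h.map_iterate_prod hξ hβ0 hβ h0 n).1
  have hπ : ∀ n, P.map (β n) = π := h.map_iterate_eq hξ hβ0 hβ h0 hst hlaw
  have hsub : Measurable fun u : Fin d → ℝ => u - bs := by fun_prop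
  have hNβ : ∀ n, lsMoment s q P (fun ω => β n ω - bs) ≤ ENNReal.ofReal N := by
    intro n
    rw [← lsMoment_map (f := fun u => u - bs) (hβm n).aemeasurable hs0 hsub, hπ n]
    exact hN
  have key := h.sq_lsMoment_martingale_le hs hev hξ hβ0 hβ h0 hN0 hNβ k k le_rfl
  set c := expectedSum F Q k bs
  set R := (Λ * N) ^ 2 + k * ((max q s - 1) * (2 * Λ * (A₀ + A₁ * N)) ^ 2) with hR
  have hR0 : 0 ≤ R := by positivity
  simp only [Nat.sub_self, expectedSum, add_zero] at key
  have hSm : Measurable fun ω => ∑ j ∈ Finset.range k, β (j + 1) ω :=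
    Finset.measurable_fun_sum _ fun j _ => hβm (j + 1)
  have hX : lsMoment s q P (fun ω => ∑ j ∈ Finset.range k, β (j + 1) ω - c)
      ≤ ENNReal.ofReal √R := by
    refine (ENNReal.pow_le_pow_left_iff two_ne_zero).1 ?_
    rwa [← ENNReal.ofReal_pow (Real.sqrt_nonneg _), Real.sq_sqrt hR0]
  have hXm : Measurable fun ω => ∑ j ∈ Finset.range k, β (j + 1) ω - c := hSm.sub_const _
  have hβi : ∀ n, Integrable (β n) P := by
    intro n
    have h1 : Integrable (fun ω => β n ω - bs) P :=
      integrable_of_lsMoment hs0 hq1 ((hβm n).sub_const _).aemeasurable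
        ((hNβ n).trans_lt ENNReal.ofReal_lt_top)
    exact (h1.add (integrable_const bs)).congr (ae_of_all _ fun x => by simp)
  have hmean : ∫ ω, (∑ j ∈ Finset.range k, β (j + 1) ω - c) ∂P
      = (k : ℝ) • (∫ u, u ∂π) - c := by
    rw [integral_sub (integrable_finsetSum _ fun j _ => hβi _) (integrable_const _),
      integral_finsetSum _ fun j _ => hβi _]
    have : ∀ j, ∫ ω, β (j + 1) ω ∂P = ∫ u, u ∂π := by
      intro j
      rw [← hπ (j + 1)]
      exact (integral_map (f := fun u : Fin d → ℝ => u) (hβm _).aemeasurable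
        aemeasurable_id'.aestronglyMeasurable).symm
    simp only [this]
    rw [Finset.sum_const, Finset.card_range, integral_const, probReal_univ, one_smul,
      Nat.cast_smul_eq_nsmul]
  -- the deterministic centring differs from the mean by at most the moment itself
  have e : (fun ω => ∑ j ∈ Finset.range k, β (j + 1) ω - (k : ℝ) • ∫ u, u ∂π)
      = fun ω => (∑ j ∈ Finset.range k, β (j + 1) ω - c)
        - ∫ ω, (∑ j ∈ Finset.range k, β (j + 1) ω - c) ∂P := by
    funext ω
    rw [hmean]; abel
  rw [e]
  refine (lsMoment_sub_le (g := fun _ => ∫ ω, (∑ j ∈ Finset.range k, β (j + 1) ω - c) ∂P)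
    h.one_le_s hq1 hXm.aemeasurable aemeasurable_const).trans ?_
  rw [lsMoment_const (by linarith)]
  refine (add_le_add hX ((lsNorm_integral_le_lsMoment h.one_le_s hq1 hXm.aemeasurable).trans
    hX)).trans (le_of_eq ?_)
  rw [← ENNReal.ofReal_add (Real.sqrt_nonneg _) (Real.sqrt_nonneg _)]
  congr 1; ring

end ContractingMap

end Fluctuation

/-! ### Second-order expansion of the gradient -/

section Taylor

variable {d : ℕ}

lemma fderiv_apply_eq_sum (f : (Fin d → ℝ) → ℝ) (x w : Fin d → ℝ) :
    fderiv ℝ f x w = ∑ l, w l * pderiv l f x := by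
  conv_lhs => rw [pi_eq_sum_univ' w]
  simp [pderiv]

lemma TwiceDifferentiable.differentiable_fderiv {f : (Fin d → ℝ) → ℝ}
    (h : TwiceDifferentiable f) : Differentiable ℝ (fderiv ℝ f) := by
  have e : fderiv ℝ f = fun x => ∑ l, pderiv l f x •
      (ContinuousLinearMap.proj l : (Fin d → ℝ) →L[ℝ] ℝ) := by
    funext x
    ext w
    rw [fderiv_apply_eq_sum]
    simp [mul_comm]
  rw [e]
  exact Differentiable.fun_sum fun l _ => (h.2 l).smul_const _

/-- Symmetry of second partial derivatives. -/
lemma TwiceDifferentiable.pderiv_comm {f : (Fin d → ℝ) → ℝ} (h : TwiceDifferentiable f)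
    (i j : Fin d) : pderiv i (pderiv j f) = pderiv j (pderiv i f) := by
  funext x
  have hd := h.differentiable_fderiv
  have e : ∀ i j, pderiv i (pderiv j f) x
      = fderiv ℝ (fderiv ℝ f) x (Pi.single i 1) (Pi.single j 1) := by
    intro i j
    have h1 : HasFDerivAt (fun y => fderiv ℝ f y (Pi.single j 1))
        ((fderiv ℝ (fderiv ℝ f) x).flip (Pi.single j 1)) x := by
      have := (hd x).hasFDerivAt.clm_apply (hasFDerivAt_const (Pi.single j (1 : ℝ)) x)
      simpa using this
    change fderiv ℝ (fun y => fderiv ℝ f y (Pi.single j 1)) x (Pi.single i 1) = _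
    rw [h1.fderiv]
    rfl
  rw [e, e]
  exact second_derivative_symmetric (fun y => (h.1 y).hasFDerivAt) (hd x).hasFDerivAt _ _

/-- First-order Taylor bound for a function of a real variable. -/
lemma abs_sub_sub_deriv_le {φ φ' φ'' : ℝ → ℝ} {B : ℝ} (h1 : ∀ t, HasDerivAt φ (φ' t) t)
    (h2 : ∀ t, HasDerivAt φ' (φ'' t) t) (hB : ∀ t, |φ'' t| ≤ B) : |φ 1 - φ 0 - φ' 0| ≤ B := by
  have hB0 : 0 ≤ B := (abs_nonneg _).trans (hB 0)
  have key : ∀ t ∈ Set.Icc (0 : ℝ) 1, ‖φ' t - φ' 0‖ ≤ B := by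
    intro t ht
    have := (convex_Icc (0 : ℝ) 1).norm_image_sub_le_of_norm_hasDerivWithin_le
      (fun x _ => (h2 x).hasDerivWithinAt) (fun x _ => hB x) (Set.left_mem_Icc.2 zero_le_one) ht
    refine this.trans ?_
    rw [sub_zero, Real.norm_of_nonneg ht.1]
    exact mul_le_of_le_one_right hB0 ht.2
  have h3 : ∀ t, HasDerivAt (fun t => φ t - t * φ' 0) (φ' t - φ' 0) t := by
    intro t
    have := (hasDerivAt_id t).mul_const (φ' 0)
    simp only [id, one_mul] at this
    exact (h1 t).sub this
  have := (convex_Icc (0 : ℝ) 1).norm_image_sub_le_of_norm_hasDerivWithin_le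
    (fun x _ => (h3 x).hasDerivWithinAt) key (Set.left_mem_Icc.2 zero_le_one)
    (Set.right_mem_Icc.2 zero_le_one)
  simp only [one_mul, zero_mul, sub_zero, norm_one, mul_one, Real.norm_eq_abs] at this
  rwa [sub_right_comm]

/-- Schur's test for a quadratic form with bounded absolute row and column sums. -/
lemma abs_quadratic_le {T : Fin d → Fin d → ℝ} {K : ℝ} (hrow : ∀ r, ∑ l, |T r l| ≤ K)
    (hcol : ∀ l, ∑ r, |T r l| ≤ K) (w : Fin d → ℝ) :
    |∑ r, ∑ l, w r * w l * T r l| ≤ K * ∑ l, w l ^ 2 := by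
  calc |∑ r, ∑ l, w r * w l * T r l| ≤ ∑ r, ∑ l, |w r * w l * T r l| :=
        (Finset.abs_sum_le_sum_abs _ _).trans
          (Finset.sum_le_sum fun r _ => Finset.abs_sum_le_sum_abs _ _)
    _ ≤ ∑ r, ∑ l, (w r ^ 2 / 2 * |T r l| + w l ^ 2 / 2 * |T r l|) := by
        refine Finset.sum_le_sum fun r _ => Finset.sum_le_sum fun l _ => ?_
        rw [abs_mul, ← add_mul]
        refine mul_le_mul_of_nonneg_right ?_ (abs_nonneg _)
        rw [abs_le]
        constructor <;> nlinarith [sq_nonneg (w r - w l), sq_nonneg (w r + w l)]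
    _ = ∑ r, w r ^ 2 / 2 * ∑ l, |T r l| + ∑ l, w l ^ 2 / 2 * ∑ r, |T r l| := by
        simp_rw [Finset.sum_add_distrib, Finset.mul_sum]
        congr 1
        exact Finset.sum_comm
    _ ≤ ∑ r, w r ^ 2 / 2 * K + ∑ l, w l ^ 2 / 2 * K := by
        gcongr with r _ l _
        · exact hrow r
        · exact hcol l
    _ = K * ∑ l, w l ^ 2 := by
        rw [← Finset.sum_mul, ← Finset.sum_div]; ring

/-- Linearisation of the gradient with a quadratic error. -/
lemma abs_grad_sub_linear_le {G : (Fin d → ℝ) → ℝ} {K : ℝ} (h : ThriceDifferentiable G)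
    (hK : ThirdDerivBound K G) (b b₀ : Fin d → ℝ) (i : Fin d) :
    |grad G b i - grad G b₀ i - ∑ l, (b - b₀) l * pderiv l (pderiv i G) b₀|
      ≤ K * ∑ l, (b - b₀) l ^ 2 := by
  set f := pderiv i G with hf
  set w := b - b₀ with hw
  have hf2 : TwiceDifferentiable f := ⟨h.1.2 i, fun l => h.2 l i⟩
  have d1 : ∀ t : ℝ, HasDerivAt (fun t : ℝ => f (b₀ + t • w))
      (∑ l, w l * pderiv l f (b₀ + t • w)) t := by
    intro t
    rw [← fderiv_apply_eq_sum]
    exact hasDerivAt_line (hf2.1 _)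
  have d2 : ∀ t : ℝ, HasDerivAt (fun t : ℝ => ∑ l, w l * pderiv l f (b₀ + t • w))
      (∑ l, w l * ∑ r, w r * pderiv r (pderiv l f) (b₀ + t • w)) t := by
    intro t
    refine HasDerivAt.fun_sum fun l _ => HasDerivAt.const_mul _ ?_
    rw [← fderiv_apply_eq_sum]
    exact hasDerivAt_line (hf2.2 l _)
  have hrow : ∀ x r, ∑ l, |pderiv r (pderiv l f) x| ≤ K := by
    intro x r
    refine le_trans (le_of_eq ?_) (hK x r i)
    refine Finset.sum_congr rfl fun l _ => ?_
    rw [hf, h.1.pderiv_comm l i]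
  have hcol : ∀ x l, ∑ r, |pderiv r (pderiv l f) x| ≤ K := by
    intro x l
    refine le_trans (le_of_eq ?_) (hrow x l)
    exact Finset.sum_congr rfl fun r _ => by rw [hf2.pderiv_comm r l]
  have := abs_sub_sub_deriv_le (B := K * ∑ l, w l ^ 2) d1 d2 (fun t => by
    have h1 := abs_quadratic_le (T := fun r l => pderiv r (pderiv l f) (b₀ + t • w))
      (hrow _) (hcol _) w
    refine le_trans (le_of_eq ?_) h1
    rw [Finset.sum_comm]
    congr 1
    refine Finset.sum_congr rfl fun l _ => ?_
    rw [Finset.mul_sum]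
    exact Finset.sum_congr rfl fun r _ => by ring)
  simpa [hw, grad, hf] using this

end Taylor

/-! ### The bias of the stationary law -/

section Bias

variable {d s : ℕ} {q μ L α K V : ℝ} {Ξ : Type*} [MeasurableSpace Ξ]
variable {g : (Fin d → ℝ) → Ξ → ℝ} {Q : Measure Ξ} {βstar : Fin d → ℝ}

lemma LsStrongConvex.mul_lsNorm_sub_le {G : (Fin d → ℝ) → ℝ} (hs : 2 ≤ s)
    (h : LsStrongConvex s μ G) (β β' : Fin d → ℝ) :
    μ * lsNorm s (β - β') ≤ lsNorm s (grad G β - grad G β') := by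
  have h1 := (h β β').trans (sum_pow_mul_le hs (β - β') (grad G β - grad G β'))
  rcases (lsNorm_nonneg s (β - β')).eq_or_lt with h0 | h0
  · rw [← h0, mul_zero]; exact lsNorm_nonneg _ _
  · obtain ⟨n, rfl⟩ : ∃ n, s = n + 1 := ⟨s - 1, by omega⟩
    rw [Nat.add_sub_cancel, pow_succ] at h1
    refine le_of_mul_le_mul_left ?_ (pow_pos h0 n)
    linarith

variable [IsProbabilityMeasure Q]

/-- The expected gradient vanishes under the stationary law. -/
lemma ConvexNoisyLoss.integral_grad_eq_zero (h : ConvexNoisyLoss s q μ L g Q βstar) (hα : α ≠ 0)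
    {π : Measure (Fin d → ℝ)} (hπ : IsStationaryLaw s q α g Q π) (i : Fin d) :
    Integrable (fun u => grad (loss g Q) u i) π ∧ ∫ u, grad (loss g Q) u i ∂π = 0 := by
  obtain ⟨hp, hst, hmom⟩ := hπ
  have hs0 : s ≠ 0 := by have := h.two_le_s; omega
  have hF := h.measurable_sgdMap α
  have hst' : (π.prod Q).map (sgdMap g α) = π := hst
  have hid : Integrable (fun u : Fin d → ℝ => u) π :=
    integrable_of_lsMoment hs0 (by linarith [h.two_le_q]) aemeasurable_id' hmom
  have hidi : Integrable (fun u : Fin d → ℝ => u i) π := hid.eval i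
  have h1 : Integrable (fun z : (Fin d → ℝ) × Ξ => z.1 i) (π.prod Q) := hidi.comp_fst Q
  have h2 : Integrable (fun z : (Fin d → ℝ) × Ξ => sgdMap g α z i) (π.prod Q) := by
    have : Integrable (fun u : Fin d → ℝ => u i) ((π.prod Q).map (sgdMap g α)) := by
      rw [hst']; exact hidi
    exact this.comp_measurable hF
  have e : (fun z : (Fin d → ℝ) × Ξ => stochGrad g z.1 z.2 i)
      = fun z => α⁻¹ * (z.1 i - sgdMap g α z i) := by
    funext z
    simp [sgdMap, hα]
  have h3 : Integrable (fun z : (Fin d → ℝ) × Ξ => stochGrad g z.1 z.2 i) (π.prod Q) := by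
    rw [e]; exact (h1.sub h2).const_mul _
  have h4 : ∫ z, stochGrad g z.1 z.2 i ∂(π.prod Q) = 0 := by
    rw [e, integral_const_mul, integral_sub h1 h2]
    have e1 : ∫ z : (Fin d → ℝ) × Ξ, z.1 i ∂(π.prod Q) = ∫ u, u i ∂π := by
      rw [integral_fun_fst (fun u : Fin d → ℝ => u i)]; simp
    have e2 : ∫ z, sgdMap g α z i ∂(π.prod Q) = ∫ u, u i ∂π := by
      conv_rhs => rw [← hst']
      exact (integral_map (f := fun u : Fin d → ℝ => u i) hF.aemeasurable
        (measurable_pi_apply i).aestronglyMeasurable).symm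
    rw [e1, e2, sub_self, mul_zero]
  have e3 : ∀ u, ∫ x, stochGrad g u x i ∂Q = grad (loss g Q) u i := fun u =>
    h.integral_stochGrad u i
  refine ⟨?_, ?_⟩
  · simpa only [e3] using h3.integral_prod_left
  · rw [integral_prod _ h3] at h4
    simpa only [e3] using h4

/-- The mean of the stationary law is close to the minimizer: at the mean, the linear part of the
vanishing expected gradient cancels, so the gradient there is of the order of the variance, and
strong convexity turns this into a bound for the distance. -/
theorem ConvexNoisyLoss.lsNorm_mean_sub_le (h : ConvexNoisyLoss s q μ L g Q βstar) (hα : α ≠ 0)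
    (hK0 : 0 ≤ K) (hG : ThriceDifferentiable (loss g Q)) (hK : ThirdDerivBound K (loss g Q))
    {π : Measure (Fin d → ℝ)} (hπ : IsStationaryLaw s q α g Q π) (hV0 : 0 ≤ V)
    (hV : lsMoment s q π (fun u => u - ∫ u, u ∂π) ≤ ENNReal.ofReal V) :
    μ * lsNorm s ((∫ u, u ∂π) - βstar)
      ≤ (d : ℝ) ^ ((1 : ℝ) / s) * (K * (d : ℝ) ^ (1 - 2 / (s : ℝ)) * V ^ 2) := by
  have hgrad := fun i => h.integral_grad_eq_zero hα hπ i
  obtain ⟨hp, hst, hmom⟩ := hπ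
  have hs0 : s ≠ 0 := by have := h.two_le_s; omega
  have hid : Integrable (fun u : Fin d → ℝ => u) π :=
    integrable_of_lsMoment hs0 (by linarith [h.two_le_q]) aemeasurable_id' hmom
  set m := ∫ u, u ∂π with hm
  have hsub : Measurable fun u : Fin d → ℝ => u - m := by fun_prop
  -- second moment
  have hmem : MemLp (fun u => lsNorm s (u - m)) 2 π := by
    have := (lsMoment_lt_top_iff (q := q) hs0 hsub.aemeasurable).1
      (hV.trans_lt ENNReal.ofReal_lt_top)
    refine this.mono_exponent ?_
    rw [← ENNReal.ofReal_ofNat]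
    exact ENNReal.ofReal_le_ofReal h.two_le_q
  have hsq : Integrable (fun u => lsNorm s (u - m) ^ 2) π := hmem.integrable_sq
  have hsqV : ∫ u, lsNorm s (u - m) ^ 2 ∂π ≤ V ^ 2 := by
    have h1 : eLpNorm (fun u => lsNorm s (u - m)) 2 π ≤ ENNReal.ofReal V := by
      refine le_trans (eLpNorm_le_eLpNorm_of_exponent_le ?_
        (aestronglyMeasurable_lsNorm hs0 hsub.aemeasurable)) hV
      rw [← ENNReal.ofReal_ofNat]
      exact ENNReal.ofReal_le_ofReal h.two_le_q
    have h2 := hmem.eLpNorm_eq_integral_rpow_norm two_ne_zero ENNReal.ofNat_ne_top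
    rw [h2, ENNReal.ofReal_le_ofReal_iff hV0] at h1
    simp only [ENNReal.toReal_ofNat, Real.rpow_two] at h1
    have h3 : 0 ≤ ∫ u, lsNorm s (u - m) ^ 2 ∂π := integral_nonneg fun u => sq_nonneg _
    simp only [Real.norm_eq_abs, sq_abs] at h1
    have h4 := pow_le_pow_left₀ (by positivity) h1 2
    rwa [← Real.rpow_natCast, ← Real.rpow_mul h3, show (2 : ℝ)⁻¹ * (2 : ℕ) = 1 by norm_num,
      Real.rpow_one] at h4
  have hcoord : ∀ i, |grad (loss g Q) m i| ≤ K * (d : ℝ) ^ (1 - 2 / (s : ℝ)) * V ^ 2 := by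
    intro i
    set ℓ : (Fin d → ℝ) → ℝ := fun u => ∑ l, (u - m) l * pderiv l (pderiv i (loss g Q)) m with hℓ
    have hli : ∀ l, Integrable (fun u : Fin d → ℝ => (u - m) l) π := fun l =>
      (hid.sub (integrable_const m)).eval l
    have hℓi : Integrable ℓ π := integrable_finsetSum _ fun l _ => (hli l).mul_const _
    have hℓ0 : ∫ u, ℓ u ∂π = 0 := by
      rw [integral_finsetSum _ fun l _ => (hli l).mul_const _]
      refine Finset.sum_eq_zero fun l _ => ?_
      rw [integral_mul_const]
      have : ∫ u, (u - m) l ∂π = 0 := by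
        simp only [Pi.sub_apply]
        rw [integral_sub (hid.eval l) (integrable_const _), hm, eval_integral fun j => hid.eval j]
        simp
      rw [this, zero_mul]
    have hrem : ∫ u, (grad (loss g Q) u i - grad (loss g Q) m i - ℓ u) ∂π
        = - grad (loss g Q) m i := by
      have hg1 : Integrable (fun u => grad (loss g Q) u i - grad (loss g Q) m i) π :=
        (hgrad i).1.sub (integrable_const _)
      rw [integral_sub hg1 hℓi,
        integral_sub (hgrad i).1 (integrable_const _), hℓ0, (hgrad i).2]
      simp
    rw [← abs_neg, ← hrem]
    calc |∫ u, (grad (loss g Q) u i - grad (loss g Q) m i - ℓ u) ∂π|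
        ≤ ∫ u, K * (d : ℝ) ^ (1 - 2 / (s : ℝ)) * lsNorm s (u - m) ^ 2 ∂π := by
          rw [← Real.norm_eq_abs]
          refine norm_integral_le_of_norm_le (hsq.const_mul _) (ae_of_all _ fun u => ?_)
          refine (abs_grad_sub_linear_le hG hK u m i).trans ?_
          rw [mul_assoc]
          exact mul_le_mul_of_nonneg_left (sum_sq_le h.two_le_s _) hK0
      _ ≤ _ := by
          rw [integral_const_mul]
          exact mul_le_mul_of_nonneg_left hsqV (by positivity)
  have h1 := h.convex.mul_lsNorm_sub_le h.two_le_s m βstar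
  rw [grad_eq_zero_of_forall_le h.isMin, sub_zero] at h1
  exact h1.trans (lsNorm_le_mul_of_abs_le hs0 (by positivity) hcoord)

end Bias

/-! ### The three error terms of the averaged iterates -/

section Averages

variable {d s : ℕ} {q μ L α ρ K : ℝ} {Ξ Ω : Type*} [MeasurableSpace Ξ] [MeasurableSpace Ω]
variable {g : (Fin d → ℝ) → Ξ → ℝ} {Q : Measure Ξ} {βstar : Fin d → ℝ}

omit [MeasurableSpace Ξ] in
lemma asgd_eq_sum_range (g : (Fin d → ℝ) → Ξ → ℝ) (α : ℝ) (x : ℕ → Ξ) (b : Fin d → ℝ) (k : ℕ) :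
    asgd g α x b k = (k : ℝ)⁻¹ • ∑ j ∈ Finset.range k, sgd g α x b (j + 1) := by
  rw [asgd, ← Finset.Ico_add_one_right_eq_Icc, Finset.sum_Ico_eq_sum_range]
  simp [add_comm]

lemma lsNorm_le_exp_mul_norm (hd : 1 ≤ d) (v : Fin d → ℝ) :
    lsNorm (sDim d) v ≤ Real.exp 1 * ‖v‖ := by
  have : sDim d ≠ 0 := by have := two_le_sDim hd; omega
  exact (lsNorm_le_mul_norm this v).trans
    (mul_le_mul_of_nonneg_right (rpow_inv_sDim_le hd) (norm_nonneg v))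

lemma sum_pow_succ_sqrt_le {r : ℝ} (hr0 : 0 ≤ r) (hr1 : r < 1) (k : ℕ) :
    ∑ j ∈ Finset.range k, √r ^ (j + 1) ≤ 2 / (1 - r) := by
  have h0 := Real.sqrt_nonneg r
  have h1 : √r < 1 := by rw [Real.sqrt_lt' one_pos]; simpa using hr1
  have h2 := Real.sq_sqrt hr0
  have h3 := geom_sum_mul_neg (√r) k
  have h4 : 0 ≤ √r ^ k := by positivity
  have h5 : 0 ≤ ∑ j ∈ Finset.range k, √r ^ j := Finset.sum_nonneg fun j _ => by positivity
  simp only [pow_succ, ← Finset.sum_mul]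
  rw [le_div_iff₀ (by linarith)]
  have e : (∑ j ∈ Finset.range k, √r ^ j) * √r * (1 - r)
      = (1 - √r ^ k) * (√r * (1 + √r)) := by
    rw [← h3]; linear_combination (∑ j ∈ Finset.range k, √r ^ j) * √r * h2
  rw [e]
  have h6 : √r * (1 + √r) ≤ 2 := by nlinarith
  nlinarith [mul_nonneg h0 (by linarith : 0 ≤ 1 + √r)]

/-- The fluctuation bound when `k` exceeds the relaxation time `1 / α`. -/
lemma two_mul_sqrt_fluctuation_le {τ A m M k : ℝ} (hτ : 0 < τ) (hA : 0 ≤ A) (hm : 1 ≤ m)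
    (hα : 0 < α) (hM : 0 ≤ M) (hL : 0 ≤ L) (hk : 1 ≤ k * α) (hk0 : 0 < k) :
    2 * √((τ / α * (√(A * m * α) * M)) ^ 2
        + k * ((m - 1) * (2 * (τ / α) * (α * M + α * L * (√(A * m * α) * M))) ^ 2))
      ≤ k * (4 * τ * (√A + 1) * (√(m / k) * M * (L * √(α * m) + 1))) := by
  have e1 : √(A * m * α) = √A * √(α * m) := by
    rw [mul_assoc, mul_comm m, Real.sqrt_mul hA]
  have e2 : k * √(m / k) = √(k * m) := by
    rw [← Real.sqrt_sq hk0.le, ← Real.sqrt_mul (sq_nonneg k), Real.sqrt_sq hk0.le]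
    congr 1; field_simp
  have ha := Real.sqrt_nonneg A
  have hp := Real.sqrt_nonneg (α * m)
  have hp2 : √(α * m) ^ 2 = α * m := Real.sq_sqrt (by positivity)
  have hh2 : √(k * m) ^ 2 = k * m := Real.sq_sqrt (by positivity)
  have hh := Real.sqrt_nonneg (k * m)
  have e3 : k * (4 * τ * (√A + 1) * (√(m / k) * M * (L * √(α * m) + 1)))
      = 2 * (√(k * m) * (τ * M) * (2 * (√A + 1) * (L * √(α * m) + 1))) := by
    rw [← e2]; ring
  rw [e1, e3]
  generalize √A = a at *
  generalize √(α * m) = p at *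
  generalize √(k * m) = w at *
  refine mul_le_mul_of_nonneg_left (Real.sqrt_le_iff.2 ⟨by positivity, ?_⟩) zero_le_two
  have f1 : (τ / α * (a * p * M)) ^ 2 ≤ w ^ 2 * (τ * M) ^ 2 * a ^ 2 := by
    have : (τ / α * (a * p * M)) ^ 2 = (m / α) * ((τ * M) ^ 2 * a ^ 2) := by
      rw [show (τ / α * (a * p * M)) ^ 2 = p ^ 2 / α ^ 2 * ((τ * M) ^ 2 * a ^ 2) by ring, hp2]
      congr 1; field_simp
    rw [this, hh2, mul_assoc]
    refine mul_le_mul_of_nonneg_right ?_ (by positivity)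
    rw [div_le_iff₀ hα]; nlinarith
  have f2 : k * ((m - 1) * (2 * (τ / α) * (α * M + α * L * (a * p * M))) ^ 2)
      ≤ w ^ 2 * (τ * M) ^ 2 * (4 * (1 + a * (L * p)) ^ 2) := by
    have : 2 * (τ / α) * (α * M + α * L * (a * p * M)) = 2 * (τ * M) * (1 + a * (L * p)) := by
      field_simp
    rw [this, hh2]
    have : 0 ≤ k * (4 * (τ * M) ^ 2 * (1 + a * (L * p)) ^ 2) := by positivity
    nlinarith
  have hy : 0 ≤ L * p := mul_nonneg hL hp
  have f3 : a ^ 2 + 4 * (1 + a * (L * p)) ^ 2 ≤ (2 * (a + 1) * (L * p + 1)) ^ 2 := by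
    have : (2 * (a + 1) * (L * p + 1)) ^ 2 - (a ^ 2 + 4 * (1 + a * (L * p)) ^ 2)
        = 3 * a ^ 2 + 4 * (L * p) ^ 2 + 8 * (a * (L * p))
          + 8 * (1 + a * (L * p)) * (a + L * p) := by ring
    have : 0 ≤ 3 * a ^ 2 + 4 * (L * p) ^ 2 + 8 * (a * (L * p))
          + 8 * (1 + a * (L * p)) * (a + L * p) := by positivity
    linarith
  rw [mul_pow (w * (τ * M)), mul_pow w]
  have := mul_le_mul_of_nonneg_left f3 (by positivity : 0 ≤ w ^ 2 * (τ * M) ^ 2)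
  linarith

/-- Centring at the mean at most doubles the moment. -/
lemma lsMoment_sub_integral_le {π : Measure (Fin d → ℝ)} [IsProbabilityMeasure π]
    (hs : 1 ≤ s) (hq : 1 ≤ q) {c : Fin d → ℝ} {N : ℝ} (hN0 : 0 ≤ N)
    (hN : lsMoment s q π (fun u => u - c) ≤ ENNReal.ofReal N) :
    lsMoment s q π (fun u => u - ∫ u, u ∂π) ≤ ENNReal.ofReal (2 * N) := by
  have hsub : Measurable fun u : Fin d → ℝ => u - c := by fun_prop
  have hi : Integrable (fun u : Fin d → ℝ => u - c) π :=
    integrable_of_lsMoment (by omega) hq hsub.aemeasurable (hN.trans_lt ENNReal.ofReal_lt_top)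
  have hid : Integrable (fun u : Fin d → ℝ => u) π :=
    (hi.add (integrable_const c)).congr (ae_of_all _ fun x => by simp)
  have e : (fun u : Fin d → ℝ => u - ∫ u, u ∂π) = fun u => (u - c) - ∫ u, (u - c) ∂π := by
    funext u
    rw [integral_sub hid (integrable_const c), integral_const, probReal_univ, one_smul]
    abel
  rw [e]
  refine (lsMoment_sub_le (g := fun _ => ∫ u, (u - c) ∂π) hs hq hsub.aemeasurable
    aemeasurable_const).trans ?_
  rw [lsMoment_const (by linarith), two_mul, ENNReal.ofReal_add hN0 hN0]
  exact add_le_add hN ((lsNorm_integral_le_lsMoment hs hq hsub.aemeasurable).trans hN)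

namespace ConvexNoisyLoss

variable [IsProbabilityMeasure Q] (h : ConvexNoisyLoss s q μ L g Q βstar)
variable {P : Measure Ω} [IsProbabilityMeasure P] {ξ : ℕ → Ω → Ξ} {β₀ β₀' : Ω → Fin d → ℝ}
include h

/-- Iterates driven by the same samples approach each other geometrically. -/
lemma lsMoment_sgd_sub_le (hα : 0 ≤ α) (hξ : ∀ n, Measurable (ξ n)) (hβ₀ : Measurable β₀)
    (hβ₀' : Measurable β₀') (h0 : P.map (fun ω => ((β₀ ω, β₀' ω), fun k => ξ k ω))
      = (P.map fun ω => (β₀ ω, β₀' ω)).prod (Measure.infinitePi fun _ : ℕ => Q)) (n : ℕ) :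
    (Measurable (fun ω => sgd g α (fun n => ξ n ω) (β₀ ω) n) ∧
      Measurable (fun ω => sgd g α (fun n => ξ n ω) (β₀' ω) n)) ∧
    lsMoment s q P (fun ω => sgd g α (fun n => ξ n ω) (β₀ ω) n
        - sgd g α (fun n => ξ n ω) (β₀' ω) n)
      ≤ ENNReal.ofReal (√(contr s q μ L α) ^ n) * lsMoment s q P (fun ω => β₀ ω - β₀' ω) := by
  have hs1 : 1 ≤ s := by have := h.two_le_s; omega
  have hs0 : s ≠ 0 := by omega
  have hF := h.measurable_sgdMap α
  set p : ℕ → Ω → (Fin d → ℝ) × (Fin d → ℝ) := fun n ω =>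
    (sgd g α (fun n => ξ n ω) (β₀ ω) n, sgd g α (fun n => ξ n ω) (β₀' ω) n) with hp
  set Φ : ((Fin d → ℝ) × (Fin d → ℝ)) × Ξ → (Fin d → ℝ) × (Fin d → ℝ) := fun z =>
    (sgdMap g α (z.1.1, z.2), sgdMap g α (z.1.2, z.2)) with hΦ
  have hΦ1 : Measurable fun z : ((Fin d → ℝ) × (Fin d → ℝ)) × Ξ => sgdMap g α (z.1.1, z.2) :=
    hF.comp (by fun_prop)
  have hΦ2 : Measurable fun z : ((Fin d → ℝ) × (Fin d → ℝ)) × Ξ => sgdMap g α (z.1.2, z.2) :=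
    hF.comp (by fun_prop)
  have key := fun n => map_recursion_prod_single (Q := Q) (P := P) hξ
    (Φ := fun _ => Φ) (fun _ => hΦ1.prodMk hΦ2) (p := p)
    (hβ₀.prodMk hβ₀') (fun n ω => rfl) h0 n
  refine ⟨⟨(key n).1.fst, (key n).1.snd⟩, ?_⟩
  induction n with
  | zero => simp [sgd]
  | succ n ih =>
    obtain ⟨hm, hlaw⟩ := key n
    have : IsProbabilityMeasure (P.map (p n)) := Measure.isProbabilityMeasure_map hm.aemeasurable
    have h1 := lsMoment_map_sub_le (ν := P.map (p n)) hs1 h.two_le_q hF (Real.sqrt_nonneg _)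
      (h.lsMoment_sgdMap_sub_le hα) measurable_fst measurable_snd
    have hΦ3 : Measurable fun z : ((Fin d → ℝ) × (Fin d → ℝ)) × Ξ =>
        sgdMap g α (z.1.1, z.2) - sgdMap g α (z.1.2, z.2) := hΦ1.sub hΦ2
    have hsub : Measurable fun t : (Fin d → ℝ) × (Fin d → ℝ) => t.1 - t.2 := by fun_prop
    rw [← hlaw, lsMoment_map (hm.prodMk (hξ n)).aemeasurable hs0 hΦ3,
      lsMoment_map hm.aemeasurable hs0 hsub] at h1
    refine h1.trans ((mul_le_mul_right ih _).trans (le_of_eq ?_))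
    rw [← mul_assoc, ← ENNReal.ofReal_mul (Real.sqrt_nonneg _), pow_succ']

/-- The influence of the initial value on the averaged iterates. -/
theorem lsMoment_asgd_sub_le (hd : 1 ≤ d) (hr : contr s q μ L α < 1)
    (hα : 0 ≤ α) (hξ : ∀ n, Measurable (ξ n)) (hβ₀ : Measurable β₀)
    (hβ₀' : Measurable β₀') (h0 : P.map (fun ω => ((β₀ ω, β₀' ω), fun k => ξ k ω))
      = (P.map fun ω => (β₀ ω, β₀' ω)).prod (Measure.infinitePi fun _ : ℕ => Q)) (k : ℕ) :
    lsMoment s q P (fun ω => asgd g α (fun n => ξ n ω) (β₀ ω) k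
        - asgd g α (fun n => ξ n ω) (β₀' ω) k)
      ≤ ENNReal.ofReal (2 * (1 / (k * (1 - contr s q μ L α))))
        * lsMoment s q P (fun ω => β₀ ω - β₀' ω) := by
  have hs1 : 1 ≤ s := by have := h.two_le_s; omega
  have key := h.lsMoment_sgd_sub_le hα hξ hβ₀ hβ₀' h0
  have e : (fun ω => asgd g α (fun n => ξ n ω) (β₀ ω) k - asgd g α (fun n => ξ n ω) (β₀' ω) k)
      = fun ω => (k : ℝ)⁻¹ • ∑ j ∈ Finset.range k, (sgd g α (fun n => ξ n ω) (β₀ ω) (j + 1)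
        - sgd g α (fun n => ξ n ω) (β₀' ω) (j + 1)) := by
    funext ω
    rw [asgd_eq_sum_range, asgd_eq_sum_range, ← smul_sub, Finset.sum_sub_distrib]
  rw [e, lsMoment_const_smul hs1, abs_of_nonneg (by positivity)]
  have hsum := lsMoment_sum_le (P := P) (s := s) (q := q) hs1 (by linarith [h.two_le_q])
    (Finset.range k) (f := fun j ω => sgd g α (fun n => ξ n ω) (β₀ ω) (j + 1)
        - sgd g α (fun n => ξ n ω) (β₀' ω) (j + 1))
    fun j => ((key (j + 1)).1.1.sub (key (j + 1)).1.2).aemeasurable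
  refine (mul_le_mul_right (hsum.trans (Finset.sum_le_sum fun j _ => (key (j + 1)).2)) _).trans ?_
  rw [← Finset.sum_mul, ← ENNReal.ofReal_sum_of_nonneg (fun j _ => by positivity), ← mul_assoc,
    ← ENNReal.ofReal_mul (by positivity)]
  refine mul_le_mul_left (ENNReal.ofReal_le_ofReal ?_) _
  calc _ ≤ (k : ℝ)⁻¹ * (2 / (1 - contr s q μ L α)) := by
        gcongr
        exact sum_pow_succ_sqrt_le (h.contr_nonneg hd hα) hr k
    _ = _ := by rw [one_div, mul_inv]; ring

/-- Since `1 - √r_α ≥ μ (1 - ρ) α`, the geometric series of the contraction factor is at most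
`1 / (μ (1 - ρ) α)`. -/
lemma contractingMap (hd : 1 ≤ d) (hρ1 : ρ < 1) (hα : 0 < α) (hαρ : α ≤ ρ * alphaMax s q μ L) :
    ContractingMap s q √(contr s q μ L α) (1 / (μ * (1 - ρ)) / α)
      (α * (gradMoment s q g Q βstar).toReal) (α * L) (sgdMap g α) Q βstar := by
  have hμ := h.μ_pos
  have h1ρ : 0 < 1 - ρ := by linarith
  refine ⟨by have := h.two_le_s; omega, h.two_le_q, h.measurable_sgdMap α, Real.sqrt_nonneg _,
    by positivity, ?_, by positivity, mul_nonneg hα.le h.L_nonneg, h.lsMoment_sgdMap_sub_le hα.le,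
    h.lsMoment_sgdMap_sub_self_le hα.le⟩
  -- `√r ≤ (1 + r) / 2 ≤ 1 - μ α (1 - ρ)`
  have h1 := le_one_sub_contr h.two_le_q h.L_pos hα.le hαρ
  have h2 : √(contr s q μ L α) ≤ 1 - μ * (1 - ρ) * α := by
    have := Real.sq_sqrt (h.contr_nonneg hd hα.le)
    nlinarith [sq_nonneg (1 - √(contr s q μ L α))]
  have h3 := mul_le_mul_of_nonneg_right h2 (by positivity : 0 ≤ 1 / (μ * (1 - ρ)) / α)
  have h4 : (1 - μ * (1 - ρ) * α) * (1 / (μ * (1 - ρ)) / α) = 1 / (μ * (1 - ρ)) / α - 1 := by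
    field_simp
  linarith

/-- The averaged stationary iterates concentrate around the mean of the stationary law. -/
theorem lsMoment_asgd_stationary_sub_le {A : ℝ} {k : ℕ} (hd : 1 ≤ d) (hρ1 : ρ < 1) (hα : 0 < α)
    (hαρ : α ≤ ρ * alphaMax s q μ L) {π : Measure (Fin d → ℝ)}
    (hπ : IsStationaryLaw s q α g Q π) (hA : 0 ≤ A)
    (hN : lsMoment s q π (fun u => u - βstar)
      ≤ ENNReal.ofReal (√(A * max q s * α) * (gradMoment s q g Q βstar).toReal))
    (hV : lsMoment s q π (fun u => u - ∫ u, u ∂π)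
      ≤ ENNReal.ofReal (2 * (√(A * max q s * α) * (gradMoment s q g Q βstar).toReal)))
    (hξ : ∀ n, Measurable (ξ n)) (hβ₀ : Measurable β₀)
    (h0 : P.map (fun ω => (β₀ ω, fun k => ξ k ω))
      = (P.map β₀).prod (Measure.infinitePi fun _ : ℕ => Q))
    (hlaw : P.map β₀ = π) (hk : 1 ≤ k) :
    lsMoment s q P (fun ω => asgd g α (fun n => ξ n ω) (β₀ ω) k - ∫ u, u ∂π)
      ≤ ENNReal.ofReal ((4 * (1 / (μ * (1 - ρ))) * (√A + 1) + 2 * √A)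
        * (√(q * s / k) * (gradMoment s q g Q βstar).toReal * (L * √(α * max q s) + 1))) := by
  have hs1 : 1 ≤ s := by have := h.two_le_s; omega
  have hs0 : s ≠ 0 := by omega
  have hμ := h.μ_pos
  have hL := h.L_nonneg
  have hq2 := h.two_le_q
  have h1ρ : 0 < 1 - ρ := by linarith
  have hk0 : (0 : ℝ) < k := by exact_mod_cast hk
  have hs2 : (2 : ℝ) ≤ s := by exact_mod_cast h.two_le_s
  have hm : 1 ≤ max q (s : ℝ) := by linarith [le_max_left q (s : ℝ)]
  have hmq : max q (s : ℝ) ≤ q * s := max_le (by nlinarith) (by nlinarith)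
  have hM : 0 ≤ (gradMoment s q g Q βstar).toReal := ENNReal.toReal_nonneg
  have hsq : √(max q (s : ℝ) / k) ≤ √(q * s / k) := Real.sqrt_le_sqrt (by gcongr)
  have hC := h.contractingMap hd hρ1 hα hαρ
  have hst : (π.prod Q).map (sgdMap g α) = π := hπ.2.1
  set x : Ω → ℕ → Ξ := fun ω n => ξ n ω with hx
  set β : ℕ → Ω → Fin d → ℝ := fun n ω => sgd g α (x ω) (β₀ ω) n with hβ
  have hβs : ∀ n ω, β (n + 1) ω = sgdMap g α (β n ω, ξ n ω) := fun n ω => rfl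
  have hβm : ∀ n, Measurable (β n) := fun n => (hC.map_iterate_prod hξ hβ₀ hβs h0 n).1
  set M := (gradMoment s q g Q βstar).toReal
  have e : (fun ω => asgd g α (x ω) (β₀ ω) k - ∫ u, u ∂π) = fun ω => (k : ℝ)⁻¹ •
      (∑ j ∈ Finset.range k, β (j + 1) ω - (k : ℝ) • ∫ u, u ∂π) := by
    funext ω
    rw [asgd_eq_sum_range, smul_sub, smul_smul, inv_mul_cancel₀ hk0.ne', one_smul]
  rw [e, lsMoment_const_smul hs1, abs_of_nonneg (by positivity)]
  rcases le_total 1 (k * α) with hkα | hkα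
  · refine (mul_le_mul_right (hC.lsMoment_sum_sub_le h.two_le_s h.even_s hξ hβ₀ hβs h0 hst hlaw
      (by positivity) hN k) _).trans ?_
    rw [← ENNReal.ofReal_mul (by positivity)]
    refine ENNReal.ofReal_le_ofReal ?_
    have h1 := two_mul_sqrt_fluctuation_le (τ := 1 / (μ * (1 - ρ))) (L := L) (by positivity) hA hm hα
      hM hL hkα hk0
    refine (mul_le_mul_of_nonneg_left h1 (by positivity)).trans ?_
    rw [inv_mul_cancel_left₀ hk0.ne', mul_comm α]
    gcongr
    linarith [Real.sqrt_nonneg A]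
  · -- before the relaxation time, every summand is bounded separately
    have e2 : (fun ω => ∑ j ∈ Finset.range k, β (j + 1) ω - (k : ℝ) • ∫ u, u ∂π)
        = fun ω => ∑ j ∈ Finset.range k, (β (j + 1) ω - ∫ u, u ∂π) := by
      funext ω
      rw [Finset.sum_sub_distrib, Finset.sum_const, Finset.card_range, Nat.cast_smul_eq_nsmul]
    have hsub : Measurable fun u : Fin d → ℝ => u - ∫ u, u ∂π := by fun_prop
    have hj : ∀ j, lsMoment s q P (fun ω => β (j + 1) ω - ∫ u, u ∂π)
        ≤ ENNReal.ofReal (2 * (√(A * max q s * α) * M)) := by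
      intro j
      rw [← lsMoment_map (f := fun u => u - ∫ u, u ∂π) (hβm _).aemeasurable hs0 hsub,
        hC.map_iterate_eq hξ hβ₀ hβs h0 hst hlaw]
      exact hV
    rw [e2]
    refine (mul_le_mul_right ((lsMoment_sum_le hs1 (by linarith) _
      (f := fun j ω => β (j + 1) ω - ∫ u, u ∂π)
      fun j => (hsub.comp (hβm _)).aemeasurable).trans (Finset.sum_le_sum fun j _ => hj j)) _).trans ?_
    rw [Finset.sum_const, Finset.card_range, nsmul_eq_mul, ← mul_assoc, ← ENNReal.ofReal_natCast,
      ← ENNReal.ofReal_mul (by positivity), inv_mul_cancel₀ hk0.ne', ENNReal.ofReal_one, one_mul]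
    refine ENNReal.ofReal_le_ofReal ?_
    have h1 : √(A * max q s * α) ≤ √A * √(q * s / k) := by
      rw [mul_assoc, Real.sqrt_mul hA]
      refine mul_le_mul_of_nonneg_left ((Real.sqrt_le_sqrt ?_).trans hsq) (Real.sqrt_nonneg _)
      rw [le_div_iff₀ hk0]
      nlinarith
    have h2 : 2 * (√(A * max q s * α) * M) ≤ 2 * √A * (√(q * s / k) * M * 1) := by
      have := mul_le_mul_of_nonneg_right h1 hM
      linarith
    refine h2.trans ?_
    gcongr
    · have : 0 ≤ 4 * (1 / (μ * (1 - ρ))) * (√A + 1) := by positivity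
      linarith
    · have : 0 ≤ L * √(α * max q s) := by positivity
      linarith

end ConvexNoisyLoss

end Averages

end ASGD

theorem mainTheorem2 :
    ∃ (c : ℝ → ℝ) (C₂ : ℝ), (∀ q, 2 ≤ q → 0 < c q) ∧ 0 < C₂ ∧
    ∀ (μ ρ : ℝ), 0 < μ → 0 < ρ → ρ < 1 →
    ∃ C₁ : ℝ, 0 < C₁ ∧
    ∀ K : ℝ, 0 ≤ K →
    ∃ C₃ : ℝ, 0 < C₃ ∧
    ∀ (d : ℕ), 1 ≤ d →
    ∀ (s : ℕ), s = ASGD.sDim d →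
    ∀ (q L α : ℝ), 2 ≤ q → 0 < L → 0 < α → α ≤ ρ * ASGD.alphaMax s q μ L →
    ∀ {Ξ : Type*} [MeasurableSpace Ξ] (Q : MeasureTheory.Measure Ξ)
      [MeasureTheory.IsProbabilityMeasure Q] (g : (Fin d → ℝ) → Ξ → ℝ) (βstar : Fin d → ℝ),
    (∀ β, Measurable (g β)) →
    (∀ β, MeasureTheory.Integrable (g β) Q) →
    (∀ β, ASGD.loss g Q βstar ≤ ASGD.loss g Q β) →
    ASGD.Coercive s (ASGD.loss g Q) →
    ASGD.LsStrongConvex s μ (ASGD.loss g Q) →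
    ASGD.gradMoment s q g Q βstar < ⊤ →
    ASGD.StochLipschitz s q L g Q →
    (∀ x, ASGD.TwiceDifferentiable (fun β => g β x)) →
    ASGD.ThriceDifferentiable (ASGD.loss g Q) →
    (ASGD.hessian (ASGD.loss g Q) βstar).PosDef →
    ASGD.ThirdDerivBound K (ASGD.loss g Q) →
    ∃ π : MeasureTheory.Measure (Fin d → ℝ), ASGD.IsStationaryLaw s q α g Q π ∧
      (∀ π', ASGD.IsStationaryLaw s q α g Q π' → π' = π) ∧
      ∀ {Ω : Type*} [MeasurableSpace Ω] (P : MeasureTheory.Measure Ω)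
        [MeasureTheory.IsProbabilityMeasure P]
        (ξ : ℕ → Ω → Ξ) (β₀ β₀' : Ω → (Fin d → ℝ)),
      (∀ n, Measurable (ξ n)) →
      (∀ n, P.map (ξ n) = Q) →
      ProbabilityTheory.iIndepFun ξ P →
      Measurable β₀ → Measurable β₀' →
      P.map β₀' = π →
      ProbabilityTheory.IndepFun (fun ω => (β₀ ω, β₀' ω)) (fun ω n => ξ n ω) P →
      ∀ k : ℕ, 1 ≤ k →
      MeasureTheory.eLpNorm
          (fun ω => ‖ASGD.asgd g α (fun n => ξ n ω) (β₀ ω) k - βstar‖) (ENNReal.ofReal q) P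
        ≤ ENNReal.ofReal (C₁ * (√(c q * s / k) * (ASGD.gradMoment s q g Q βstar).toReal
              * (L * √(α * max q (s : ℝ)) + 1)))
          + ENNReal.ofReal (C₂ * (1 / (k * (1 - ASGD.contr s q μ L α))))
              * MeasureTheory.eLpNorm (fun ω => ‖β₀ ω - β₀' ω‖) (ENNReal.ofReal q) P
          + ENNReal.ofReal (C₃ * ((ASGD.gradMoment s q g Q βstar).toReal ^ 2 * max q (s : ℝ) * α
              * (d : ℝ) ^ (q / (q - 1) * (1 - 2 / (s : ℝ))))) := by
  -- `c_q = q` suffices because only `max q s ≤ q * s` is needed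
  refine ⟨fun q => q, 2 * Real.exp 1, fun q hq => by linarith, by positivity, ?_⟩
  intro μ ρ hμ hρ0 hρ1
  have h1ρ : 0 < 1 - ρ := by linarith
  -- `A` is the constant in the bound for the moment of the stationary law
  set A : ℝ := (1 + 2 / (1 - ρ)) / (μ * (1 - ρ)) with hA
  have hA0 : 0 ≤ A := by positivity
  refine ⟨4 * (1 / (μ * (1 - ρ))) * (√A + 1) + 2 * √A, by positivity, ?_⟩
  intro K hK0
  -- the summand `1` keeps the constant positive when `K = 0`
  refine ⟨Real.exp 1 * K * (4 * A) / μ + 1, by positivity, ?_⟩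
  intro d hd s hs q L α hq hL hα hαρ Ξ _ Q _ g βstar hmeas hint hmin _ hconv hmom hlip htw hG _ hK
  have hs2 : 2 ≤ s := hs ▸ ASGD.two_le_sDim hd
  have hs1 : 1 ≤ s := by omega
  have hs0 : s ≠ 0 := by omega
  have hq1 : 1 ≤ q := by linarith
  have h : ASGD.ConvexNoisyLoss s q μ L g Q βstar :=
    ⟨⟨hs2, hq, hL.le, hmeas, hint, hmom, hlip, htw⟩, hs ▸ ASGD.even_sDim d, hμ, hL, hG.1.1, hmin,
      hconv⟩
  obtain ⟨π, hπ, huniq⟩ := h.existsUnique_stationary hρ1 hα hαρ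
  refine ⟨π, hπ, huniq, ?_⟩
  have : MeasureTheory.IsProbabilityMeasure π := hπ.1
  set M := (ASGD.gradMoment s q g Q βstar).toReal with hM
  have hM0 : 0 ≤ M := ENNReal.toReal_nonneg
  have hm0 : 0 ≤ max q (s : ℝ) := le_max_of_le_right (Nat.cast_nonneg s)
  have hN := h.lsMoment_stationary_le hd hρ0 hρ1 hα hαρ hπ
  rw [← hA, ← hM] at hN
  have hV := ASGD.lsMoment_sub_integral_le hs1 hq1 (by positivity) hN
  have hbias : ASGD.lsNorm s ((∫ u, u ∂π) - βstar)
      ≤ (Real.exp 1 * K * (4 * A) / μ + 1) * (M ^ 2 * max q (s : ℝ) * α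
        * (d : ℝ) ^ (q / (q - 1) * (1 - 2 / (s : ℝ)))) := by
    have hb := h.lsNorm_mean_sub_le hα.ne' hK0 hG hK hπ (by positivity) hV
    have hexp : (d : ℝ) ^ ((1 : ℝ) / s) ≤ Real.exp 1 := hs ▸ ASGD.rpow_inv_sDim_le hd
    have hpow : (d : ℝ) ^ (1 - 2 / (s : ℝ)) ≤ (d : ℝ) ^ (q / (q - 1) * (1 - 2 / (s : ℝ))) := by
      refine Real.rpow_le_rpow_of_exponent_le (by exact_mod_cast hd) ?_
      have h1 : 0 ≤ 1 - 2 / (s : ℝ) := by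
        have : (2 : ℝ) ≤ s := by exact_mod_cast hs2
        rw [sub_nonneg, div_le_one (by linarith)]; exact this
      have h2 : 1 ≤ q / (q - 1) := by rw [le_div_iff₀ (by linarith)]; linarith
      nlinarith
    have hsq : (2 * (√(A * max q s * α) * M)) ^ 2 = 4 * A * (M ^ 2 * max q (s : ℝ) * α) := by
      rw [mul_pow, mul_pow, Real.sq_sqrt (by positivity)]; ring
    rw [hsq] at hb
    set D := (d : ℝ) ^ (q / (q - 1) * (1 - 2 / (s : ℝ)))
    have hD0 : 0 ≤ D := by positivity
    have hb2 : μ * ASGD.lsNorm s ((∫ u, u ∂π) - βstar)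
        ≤ Real.exp 1 * (K * D * (4 * A * (M ^ 2 * max q (s : ℝ) * α))) :=
      hb.trans (by gcongr)
    rw [← le_div_iff₀' hμ] at hb2
    refine hb2.trans ?_
    rw [add_mul, one_mul]
    refine le_add_of_le_of_nonneg (le_of_eq (by ring)) (by positivity)
  intro Ω _ P _ ξ β₀ β₀' hξ hξQ hind hβ₀ hβ₀' hβ₀'π hindep k hk
  have h0 := ASGD.map_prodMk_infinitePi hξ hξQ hind (hβ₀.prodMk hβ₀') hindep
  have h0' := ASGD.map_prodMk_infinitePi hξ hξQ hind hβ₀'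
    (hindep.comp measurable_snd measurable_id)
  have hr : ASGD.contr s q μ L α < 1 := by
    have := ASGD.le_one_sub_contr hq hL hα.le hαρ
    have : 0 < 2 * μ * α * (1 - ρ) := by positivity
    linarith
  have T1 := h.lsMoment_asgd_sub_le hd hr hα.le hξ hβ₀ hβ₀' h0 k
  have T2 := h.lsMoment_asgd_stationary_sub_le hd hρ1 hα hαρ hπ hA0 hN hV hξ hβ₀' h0' hβ₀'π hk
  have hm : ∀ n, (Measurable fun ω => ASGD.sgd g α (fun n => ξ n ω) (β₀ ω) n) ∧
      Measurable fun ω => ASGD.sgd g α (fun n => ξ n ω) (β₀' ω) n := fun n =>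
    (h.lsMoment_sgd_sub_le hα.le hξ hβ₀ hβ₀' h0 n).1
  have hm1 : Measurable fun ω => ASGD.asgd g α (fun n => ξ n ω) (β₀ ω) k :=
    (Finset.measurable_fun_sum _ fun n _ => (hm n).1).const_smul ((k : ℝ)⁻¹)
  have hm2 : Measurable fun ω => ASGD.asgd g α (fun n => ξ n ω) (β₀' ω) k :=
    (Finset.measurable_fun_sum _ fun n _ => (hm n).2).const_smul ((k : ℝ)⁻¹)
  -- the initial value enters through the maximum norm, which `|·|_s` exceeds by at most a factor `e`
  have hinit : ASGD.lsMoment s q P (fun ω => β₀ ω - β₀' ω) ≤ ENNReal.ofReal (Real.exp 1)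
      * MeasureTheory.eLpNorm (fun ω => ‖β₀ ω - β₀' ω‖) (ENNReal.ofReal q) P := by
    rw [← Real.enorm_of_nonneg (Real.exp_nonneg 1), ← MeasureTheory.eLpNorm_const_smul]
    refine MeasureTheory.eLpNorm_mono_real fun ω => ?_
    rw [Real.norm_of_nonneg (ASGD.lsNorm_nonneg _ _)]
    exact hs ▸ ASGD.lsNorm_le_exp_mul_norm hd (β₀ ω - β₀' ω)
  have T1' := T1.trans (mul_le_mul_right hinit _)
  rw [← mul_assoc, ← ENNReal.ofReal_mul (by have : 0 < 1 - ASGD.contr s q μ L α := by linarith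
                                            positivity)] at T1'
  have split : (fun ω => ASGD.asgd g α (fun n => ξ n ω) (β₀ ω) k - βstar) = fun ω =>
      ((ASGD.asgd g α (fun n => ξ n ω) (β₀' ω) k - ∫ u, u ∂π)
        + (ASGD.asgd g α (fun n => ξ n ω) (β₀ ω) k - ASGD.asgd g α (fun n => ξ n ω) (β₀' ω) k))
        + ((∫ u, u ∂π) - βstar) := by
    funext ω; abel
  calc MeasureTheory.eLpNorm
          (fun ω => ‖ASGD.asgd g α (fun n => ξ n ω) (β₀ ω) k - βstar‖) (ENNReal.ofReal q) P
      ≤ ASGD.lsMoment s q P (fun ω => ASGD.asgd g α (fun n => ξ n ω) (β₀ ω) k - βstar) := by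
        refine MeasureTheory.eLpNorm_mono_real fun ω => ?_
        rw [norm_norm]
        exact ASGD.norm_le_lsNorm hs0 _
    _ ≤ _ := by
        rw [split]
        refine (ASGD.lsMoment_add_le (g := fun _ => (∫ u, u ∂π) - βstar) hs1 hq1
          ((hm2.sub_const _).add (hm1.sub hm2)).aemeasurable aemeasurable_const).trans ?_
        refine add_le_add ((ASGD.lsMoment_add_le hs1 hq1 (hm2.sub_const _).aemeasurable
          (hm1.sub hm2).aemeasurable).trans (add_le_add T2 (T1'.trans (le_of_eq ?_)))) ?_
        · congr 2; ring
        · rw [ASGD.lsMoment_const (by linarith)]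
          exact ENNReal.ofReal_le_ofReal hbias
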